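/- **Conventions.** Work in the universe $V$ of sets. $a^{+n}$ is the $n$-th cardinal successor. An *embedding* is an elementary $j:V\to M$ into a transitive class $M$. For $D$ a set, $x\in j(D)$ and a function $G$ on $D\times D$, $j^2(G)(x,j(x))$ (with $j^2=j(j)\circ j$) is $j(h)(x)$, where $h(v)=j(G(v,\cdot))(x)$. **The posets $R(a,b)$.** For inaccessible $a<b$, $R(a,b)$ is $$\mathrm{Add}(a^{+},a^{+4})\times \mathrm{Add}(a^{++},a^{+5})\times \mathrm{Add}(a^{+3},a^{+6})\times \mathrm{Add}(a^{+4},b^{+})\times \mathrm{Add}(a^{+5},b^{++})\times \mathrm{Add}(a^{+6},b^{+3})\times \mathrm{Col}(a^{+6},b),$$ where $\mathrm{Add}(\delta,\lambda)$ consists of the partial functions $\lambda\times\delta\to2$ of size $<\delta$, $\mathrm{Col}(\delta,\lambda)$ of the partial functions $\delta\to\lambda$ of size $<\delta$, and the order is coordinatewise reverse inclusion. $R(a,b)$ is trivial for all other $a,b$. **Extender sequence systems.** Let $\bar E=\langle\bar E_\alpha:\alpha\in[\kappa,\kappa^{+3})\rangle$, $\bar E_\alpha=\langle\alpha,F(\tau),I(\tau):\tau<l\rangle$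 with $l=l(\bar E)>0$ and $F(\tau)=\langle\langle F_\alpha(\tau)\rangle_\alpha,\langle\pi_{\beta,\alpha}\rangle_{\beta\ge_{\bar E}\alpha}\rangle$. It is an *extender sequence system with guiding generics* on $\kappa$ if: - there is an embedding $j_{\bar E}:V\to M_{\bar E}$ with critical point $\kappa$ such that, for all $\alpha$ and all $\tau<l$, $\bar E_\alpha{\restriction}\tau\in j_{\bar E}(V_\kappa)$ and $X\in F_\alpha(\tau)\iff X\subseteq V_\kappa$ and $\bar E_\alpha{\restriction}\tau\in j_{\bar E}(X)$, and every element of $M_{\bar E}$ is $j_{\bar E}(f)(\bar E_\alpha{\restriction}\tau)$ for some $f$ on $V_\kappa$, $\alpha$ and $\tau<l$; - for each $\tau<l$ the same holds for an embedding $j_\tau:V\to M_\tau\simeq \mathrm{Ult}(V,F(\tau))$ with only the index $\tau$ in place of all $\tau<l$; moreover $\bar E_\alpha{\restriction}\sigma\in j_\tau(V_\kappa)$ for $\sigma\le\tau$, and $j_\tau(f)(\bar E_\alpha{\restriction}\sigma)\mapsto j_{\bar E}(f)(\bar E_\alpha{\restriction}\sigma)$ ($\sigma\le\tau$) defines an elementary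 $i_\tau:M_\tau\to M_{\bar E}$; - $\beta\ge_{\bar E}\alpha$ iff $\beta\ge\alpha$ and $j_{\bar E}(f)(\beta)=\alpha$ for some $f:\kappa\to\kappa$; then $\pi_{\beta,\alpha}:\kappa\to\kappa$, $j_{\bar E}(\pi_{\beta,\alpha})(\beta)=\alpha$, and $\pi_{\alpha,\alpha}=\mathrm{id}$; - $I(\tau)$ is a filter on $j_\tau^2(R)(\kappa,j_\tau(\kappa))$ generic over $M_\tau$, and $j_\sigma(f)(\bar E_\alpha{\restriction}\sigma)\in I(\sigma)$ implies $j_\tau(f)(\bar E_\alpha{\restriction}\sigma)\in I(\tau)$ for $\sigma<\tau<l$. $I(\bar E)$ is the filter on $j_{\bar E}^2(R)(\kappa,j_{\bar E}(\kappa))$ generated by $\bigcup_{\tau<l}i_\tau''I(\tau)$. $T\in\bar E_\alpha$ means $T\in F_\alpha(\tau)$ for all $\tau<l$. An *extender sequence* $\bar\nu$ is a member of such a system on some $\kappa^0(\bar\nu)$, or a sequence $\langle a\rangle$ of length $0$ with $\kappa^0\le a<(\kappa^0)^{+3}$ and $\kappa^0=\kappa^0(\bar\nu)$ the critical point of an embedding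 ($\kappa^0(\bar\nu)$ counts as part of the data of $\bar\nu$; write $\nu^0$ for it). $\kappa(\bar\nu)$ is its first entry, $l(\bar\nu)$ its length; $\pi_{\bar E_\beta,\bar E_\alpha}$ applies $\pi_{\beta,\alpha}$ to $\kappa(\bar\nu)$ and keeps the rest. A finite list is *0-increasing* if the $\kappa^0$'s strictly increase; $\bar\nu$ is *permitted* to it if $\kappa^0(\bar\nu)$ exceeds all $\kappa^0$'s in it. $T\setminus\bar\nu=T\setminus V_{\kappa^0(\bar\nu)}$ and $T{\restriction}\bar\nu=T\cap V_{\kappa^0(\bar\nu)}$. **$\mathbb P^*_{\bar E}$.** A condition is $p=\{\langle\bar\gamma,p^{\bar\gamma}\rangle:\bar\gamma\in s\}\cup\{\langle\bar E_\alpha,T,f,F\rangle\}$ ($s=\mathrm{supp}(p)$, $\bar E_\alpha=\mathrm{mc}(p)$) where $s\subseteq\bar E$, $|s|\le\kappa$, $\bar E_\kappa\in s$; $p^0:=p^{\bar E_\kappa}$ is $\emptyset$ or an extender sequence in $V_\kappa$ with $\kappa(p^0)$ inaccessible; for the other $\bar\gamma\in s$, $p^{\bar\gamma}$ is a nonempty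 0-increasing finite sequence of extender sequences in $V_\kappa$; $\kappa(p^0)\le\max\kappa(p^{\bar\gamma})$ and $\bar E_\alpha\ge_{\bar E}\bar\gamma$ for $\bar\gamma\in s$; $T\in\bar E_\alpha$ is a set of extender sequences; for $\bar\nu\in T$, at most $\kappa^0(\bar\nu)$ many $\bar\gamma\in s$ have $\bar\nu$ permitted to $p^{\bar\gamma}$, and $\pi_{\bar E_\alpha,\bar\beta}(\bar\nu)\ne\pi_{\bar E_\alpha,\bar\gamma}(\bar\nu)$ for distinct such $\bar\beta,\bar\gamma$; $\mathrm{dom} f=\{\nu\in T:l(\nu)=0\}$ and $f(\nu)\in R(\kappa(p^0),\nu^0)$ (the empty condition if $p^0=\emptyset$); $\mathrm{dom} F=(\mathrm{dom} f)^2$, $F(\nu_1,\nu_2)\in R(\nu_1^0,\nu_2^0)$ and $j_{\bar E}^2(F)(\alpha,j_{\bar E}(\alpha))\in I(\bar E)$. Say $\xi$ *bounds* $p$ if every ordinal in the field of the $\mathrm{Col}$-part of $j_{\bar E}(f^p)(\alpha)$ is $<\xi$. $p\le^*q$ iff $\mathrm{supp}(p)\supseteq\mathrm{supp}(q)$; $p^{\bar\gamma}=q^{\bar\gamma}$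 on $\mathrm{supp}(q)$; $\mathrm{mc}(p)\ge_{\bar E}\mathrm{mc}(q)$, and $\mathrm{mc}(q)\in\mathrm{supp}(p)$ if they differ; $\max\kappa^0(p^{\bar\gamma})$ bounds $q$ for $\bar\gamma\in\mathrm{supp}(p)\setminus\mathrm{supp}(q)$; and, with $\pi=\pi_{\mathrm{mc}(p),\mathrm{mc}(q)}$, $\pi''T^p\subseteq T^q$; $\pi_{\mathrm{mc}(p),\bar\gamma}(\bar\nu)=\pi_{\mathrm{mc}(q),\bar\gamma}(\pi(\bar\nu))$ whenever $\bar\gamma\in\mathrm{supp}(q)$ and $\bar\nu\in T^p$ is permitted to $p^{\bar\gamma}$; $f^p(\nu)\le f^q(\pi(\nu))$; $F^p(\nu_1,\nu_2)\le F^q(\pi(\nu_1),\pi(\nu_2))$. For a length-$0$ system $\bar\mu=\langle c\rangle$, $c$ a critical point, $\mathbb P^*_{\bar\mu}$ consists of pairs $(p^0,r)$, $p^0$ as above (with $c$ for $\kappa$), $r\in R(\kappa(p^0),c)$ (empty if $p^0=\emptyset$), and $(p^0,r)\le^*(q^0,r')$ iff $p^0=q^0$, $r\le r'$. **$\mathbb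 P_{\bar E}$.** Conditions are $p=p_n{}^\frown\cdots{}^\frown p_0$ with $p_i\in\mathbb P^*_{\bar\mu_i}$, $\bar\mu_0=\bar E$, $\kappa^0(\bar\mu_n)<\dots<\kappa^0(\bar\mu_0)$, and for $i<n$, $p_i^0\neq\emptyset$ and $\kappa^0(p_i^0)\ge\kappa^0(\bar\mu_{i+1})$. $\le^*$ is taken blockwise between conditions with the same systems. For $p\in\mathbb P^*_{\bar E}$ and $\bar\nu\in T^p$ such that $\bar\nu$ is permitted to $p^0$ and $\kappa^0(\bar\nu)$ bounds $p$, $p_{\langle\bar\nu\rangle}=p_1{}^\frown p_0$ is given as follows, and is defined only if $p_0,p_1$ so described are conditions. $p_0$ has the same support, mc and $F$ (restricted), $T^{p_0}=T^p\setminus\bar\nu$, $f^{p_0}(\nu_1)=F^p(\kappa(\bar\nu),\nu_1)$, and $p_0^{\bar\gamma}$ is $p^{\bar\gamma}$ if $\bar\nu$ is not permitted to $p^{\bar\gamma}$, and otherwise $\langle\pi_{\mathrm{mc}(p),\bar\gamma}(\bar\nu)\rangle$ if $l(\bar\nu)>0$ or $\bar\gamma=\bar E_\kappa$, and $p^{\bar\gamma}{}^\frown\langle\pi_{\mathrm{mc}(p),\bar\gamma}(\bar\nu)\rangle$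 else. If $l(\bar\nu)=0$, $p_1\in\mathbb P^*_{\langle\nu^0\rangle}$ is $(p^0,f^p(\bar\nu))$. If $l(\bar\nu)>0$, $p_1$ belongs to the forcing $\mathbb P^*$ of the system of $\bar\nu$, $\mathrm{mc}(p_1)=\bar\nu$, its support is the set of $\pi_{\mathrm{mc}(p),\bar\gamma}(\bar\nu)$ with $\bar\gamma\in\mathrm{supp}(p)$ and $\bar\nu$ permitted to $p^{\bar\gamma}$, the entry at this point is $p^{\bar\gamma}$, $T^{p_1}=T^p{\restriction}\bar\nu$, and $f,F$ are restricted accordingly; it is also required that for these $\bar\gamma$ the projection of the system of $\bar\nu$ from $\bar\nu$ to $\pi_{\mathrm{mc}(p),\bar\gamma}(\bar\nu)$ agrees with $\pi_{\mathrm{mc}(p),\bar\gamma}$ on the elements of $T^{p_1}$ permitted to $p^{\bar\gamma}$. $p\le^1q$ iff $p\le^*$ the sequence obtained from $q$ by replacing one block $q_k$ by some $(q_k)_{\langle\bar\nu\rangle}$; $p\le^0q$ is $p\le^*q$; $p\le^nq$ iff $p=p^n\le^1\cdots\le^1p^0=q$; $p\le q$ iff $p\le^nq$ for some $n$. **$\mathbb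 Q_{\bar E}$ and $\Phi$.** $\mathbb Q_{\bar E}$ is defined like $\mathbb P_{\bar E}$ from conditions $\{\langle\bar\gamma,p^{\bar\gamma}\rangle:\bar\gamma\in s\}\cup\{\langle\bar E_\alpha,T\rangle\}$, with $p^{\bar\gamma}=\langle\rangle$ for $\bar\gamma\ne\bar E_\kappa$ and no $f,F$ (just $p^0$ for length-$0$ systems), where conditions whose blocks agree in system, $p^0$, mc and $T$ are identified. $\Phi:\mathbb P_{\bar E}\to\mathbb Q_{\bar E}$ forgets, in each block, $f$, $F$ (or $r$) and the $p^{\bar\gamma}$ with $\bar\gamma\neq\bar E_\kappa$. **Theorem.** Let $\bar E$ be an extender sequence system with guiding generics on $\kappa$ (for instance of length $\kappa^+$). If $p,q\in\mathbb P_{\bar E}$ and $\Phi(p)=\Phi(q)$, then there are $p'\le^*p$ and $q'\le^*q$ in $\mathbb P_{\bar E}$ such that $\mathbb P_{\bar E}/p'=\{r:r\le p'\}$ and $\mathbb P_{\bar E}/q'=\{r:r\le q'\}$, ordered by $\le$, are isomorphic. -/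

import Mathlib

open Cardinal Ordinal ZFSet FirstOrder

universe u

noncomputable section

namespace ExtRadin

/-! ### Functions, pairs and small cardinals inside the universe `ZFSet` of sets -/

/-- The set-theoretic function with domain `D` that sends `x` to `g x`. -/
def graphOn (D : ZFSet.{u}) (g : ZFSet.{u} → ZFSet.{u}) : ZFSet.{u} :=
  @ZFSet.image (fun x => ZFSet.pair x (g x)) (Classical.allZFSetDefinable _) D

/-- The value at `x` of a set-theoretic function `f`. -/
def app (f x : ZFSet.{u}) : ZFSet.{u} :=
  ⋃₀ (ZFSet.sep (fun y => ZFSet.pair x y ∈ f) (⋃₀ (⋃₀ f : ZFSet)) : ZFSet)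

/-- `f` is a function with domain `D`. -/
def IsFun (f D : ZFSet.{u}) : Prop := f = graphOn D (app f)

/-- First component of an ordered pair. -/
def fst (z : ZFSet.{u}) : ZFSet.{u} :=
  ⋃₀ (ZFSet.sep (fun x => ∃ y, z = ZFSet.pair x y) (⋃₀ z : ZFSet) : ZFSet)

/-- Second component of an ordered pair. -/
def snd (z : ZFSet.{u}) : ZFSet.{u} :=
  ⋃₀ (ZFSet.sep (fun y => ∃ x, z = ZFSet.pair x y) (⋃₀ z : ZFSet) : ZFSet)

/-- The `n`-th cardinal successor `a^{+n}` of the cardinality of `a`, as an ordinal. -/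
def cs (n : ℕ) (a : Ordinal.{u}) : Ordinal.{u} := (Order.succ^[n] a.card).ord

/-- `a` is a strongly inaccessible cardinal. -/
def Inacc (a : Ordinal.{u}) : Prop := ∃ μ : Cardinal.{u}, μ.IsInaccessible ∧ a = μ.ord

/-- The interval `[κ, κ⁺³)` of ordinals, as a set. -/
def dom (κ : Ordinal.{u}) : ZFSet.{u} := ZFSet.sep (fun x => κ ≤ x.rank) (cs 3 κ).toZFSet

/-! ### Elementary embeddings of the universe into transitive classes -/

/-- The only symbol of the language of set theory is a binary relation symbol. -/
inductive MemSymb : ℕ → Type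
  | mem : MemSymb 2

/-- The first-order language of set theory. -/
def LSet : FirstOrder.Language := ⟨fun _ => Empty, MemSymb⟩

instance : LSet.Structure ZFSet.{u} where
  funMap f := f.elim
  RelMap r v := match r with
    | MemSymb.mem => v 0 ∈ v 1

instance (M : Set ZFSet.{u}) : LSet.Structure M where
  funMap f := f.elim
  RelMap r v := match r with
    | MemSymb.mem => (v 0 : ZFSet) ∈ (v 1 : ZFSet)

/-- An elementary embedding `j : V → M` of the universe into a transitive class. -/
structure InnerEmb where
  M : Set ZFSet.{u}
  trans : ∀ x ∈ M, ∀ y ∈ x, y ∈ M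
  emb : ZFSet.{u} ↪ₑ[LSet] M

/-- `j x`, as a set. -/
def InnerEmb.j (e : InnerEmb.{u}) (x : ZFSet.{u}) : ZFSet.{u} := (e.emb x : ZFSet)

/-- `κ` is the critical point of `e`. -/
def InnerEmb.IsCrit (e : InnerEmb.{u}) (κ : Ordinal.{u}) : Prop :=
  (∀ a < κ, e.j a.toZFSet = a.toZFSet) ∧ e.j κ.toZFSet ≠ κ.toZFSet

/-- The identity embedding. -/
instance : Nonempty InnerEmb.{u} :=
  ⟨{ M := Set.univ
     trans := fun _ _ _ _ => trivial
     emb := FirstOrder.Language.Equiv.toElementaryEmbedding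
       { toEquiv := (Equiv.Set.univ ZFSet.{u}).symm
         map_fun' := fun f => f.elim
         map_rel' := fun r v => by cases r; exact Iff.rfl } }⟩

/-- `twoStep e D x G` is `j²(G)(x, j(x))` where `G` is a function on `D × D` and
`j² = j(j) ∘ j` is the second iterate of `j`: put `h(u) = j(G(u, ·))(x)` for `u ∈ D`; then
`j²(G)(x, j(x)) = j(h)(x)`. -/
def twoStep (e : InnerEmb.{u}) (D x : ZFSet.{u}) (G : ZFSet.{u} → ZFSet.{u} → ZFSet.{u}) :
    ZFSet.{u} :=
  app (e.j (graphOn D fun v => app (e.j (graphOn D (G v))) x)) x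

/-! ### The Cohen and collapse forcings -/

/-- Partial functions from `X` to `Y` of size less than `δ`. -/
def partialFns (δ : Ordinal.{u}) (X Y : ZFSet.{u}) : ZFSet.{u} :=
  ZFSet.sep (fun p => p.card < δ.card ∧ ∀ x y z, ZFSet.pair x y ∈ p → ZFSet.pair x z ∈ p → y = z)
    (ZFSet.powerset (ZFSet.prod X Y))

/-- `Add(δ, l)`: adds `l` many subsets of `δ`. -/
def addForcing (δ l : Ordinal.{u}) : ZFSet.{u} :=
  partialFns δ (ZFSet.prod l.toZFSet δ.toZFSet) (Ordinal.toZFSet 2)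

/-- `Col(δ, l)`: collapses `l` to `δ`. -/
def colForcing (δ l : Ordinal.{u}) : ZFSet.{u} := partialFns δ δ.toZFSet l.toZFSet

/-- The seven factors of `R(a, b)`. -/
def factors (a b : Ordinal.{u}) : Fin 7 → ZFSet.{u} :=
  ![addForcing (cs 1 a) (cs 4 a), addForcing (cs 2 a) (cs 5 a), addForcing (cs 3 a) (cs 6 a),
    addForcing (cs 4 a) (cs 1 b), addForcing (cs 5 a) (cs 2 b), addForcing (cs 6 a) (cs 3 b),
    colForcing (cs 6 a) b]

/-- Seven-tuples. -/
def tup (x : Fin 7 → ZFSet.{u}) : ZFSet.{u} :=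
  ZFSet.pair (x 0) (ZFSet.pair (x 1) (ZFSet.pair (x 2) (ZFSet.pair (x 3)
    (ZFSet.pair (x 4) (ZFSet.pair (x 5) (x 6))))))

/-- Products of seven sets. -/
def tupProd (X : Fin 7 → ZFSet.{u}) : ZFSet.{u} :=
  ZFSet.prod (X 0) (ZFSet.prod (X 1) (ZFSet.prod (X 2) (ZFSet.prod (X 3)
    (ZFSet.prod (X 4) (ZFSet.prod (X 5) (X 6))))))

/-- The empty condition. -/
def rone : ZFSet.{u} := tup fun _ => ∅

open Classical in
/-- The forcing `R(a, b)` for inaccessible cardinals `a < b`; it is trivial for other `a, b`. -/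
def Rset (a b : Ordinal.{u}) : ZFSet.{u} :=
  if a < b ∧ Inacc a ∧ Inacc b then tupProd (factors a b) else {rone}

/-- The order of `R(a, b)`: `r` is stronger than `s` when it extends `s` in every factor. -/
def rle (r s : ZFSet.{u}) : Prop :=
  ∃ x y : Fin 7 → ZFSet.{u}, r = tup x ∧ s = tup y ∧ ∀ i, y i ⊆ x i

/-- The set of ordinals in the domain or in the range of the collapsing part of a condition. -/
def colField (r : ZFSet.{u}) : ZFSet.{u} := ⋃₀ (⋃₀ (snd^[6] r) : ZFSet)

/-- `j²(R)(κ, j(κ))`. -/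
def Rult (e : InnerEmb.{u}) (κ : Ordinal.{u}) : ZFSet.{u} :=
  twoStep e κ.toZFSet κ.toZFSet fun v w => Rset v.rank w.rank

/-- `I` is a filter on the poset `(R, rle)` which is generic over the class `M`. -/
def IsGeneric (M : Set ZFSet.{u}) (R I : ZFSet.{u}) : Prop :=
  I ⊆ R ∧ I.Nonempty ∧ (∀ r ∈ I, ∀ s ∈ R, rle r s → s ∈ I) ∧
  (∀ r ∈ I, ∀ s ∈ I, ∃ t ∈ I, rle t r ∧ rle t s) ∧
  ∀ D ∈ M, D ⊆ R → (∀ r ∈ R, ∃ s ∈ D, rle s r) → ∃ r ∈ D, r ∈ I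

/-! ### Extender sequences

A sequence `d = ⟨(F(τ), I(τ)) : τ < l⟩` is a function with domain `l`, where `F(τ)` is the pair
of the function `α ↦ F_α(τ)` and of the function `(β, α) ↦ π_{β,α}`. The extender sequence
`⟨α, F(0), I(0), …, F(τ), I(τ), …⟩` is given by `α`, by `d`, and by the critical point. -/

/-- The data of an extender sequence `μ`: `c = κ⁰(μ)` (the critical point), `a = κ(μ)` (the
first entry), and the sequence `d` of extenders and guiding generics. -/
@[ext] structure ESeq where
  c : Ordinal.{u}
  a : Ordinal.{u}
  d : ZFSet.{u}

/-- An extender sequence as a set. -/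
def ESeq.code (x : ESeq.{u}) : ZFSet.{u} :=
  ZFSet.pair x.c.toZFSet (ZFSet.pair x.a.toZFSet x.d)

/-- The length of the sequence `d`. -/
def len (d : ZFSet.{u}) : Ordinal.{u} := sInf {l | IsFun d l.toZFSet}

/-- The function `α ↦ F_α(τ)`. -/
def measFam (d : ZFSet.{u}) (τ : Ordinal.{u}) : ZFSet.{u} := fst (fst (app d τ.toZFSet))

/-- The set `F_α(τ)`. -/
def meas (d : ZFSet.{u}) (τ α : Ordinal.{u}) : ZFSet.{u} := app (measFam d τ) α.toZFSet

/-- The function `(β, α) ↦ π_{β,α}`. -/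
def projFam (d : ZFSet.{u}) : ZFSet.{u} := snd (fst (app d ∅))

/-- The function `π_{β,α}` on ordinals. -/
def projOrd (d : ZFSet.{u}) (β α : Ordinal.{u}) : ZFSet.{u} :=
  app (projFam d) (ZFSet.pair β.toZFSet α.toZFSet)

/-- The guiding generic `I(τ)`. -/
def gen (d : ZFSet.{u}) (τ : Ordinal.{u}) : ZFSet.{u} := snd (app d τ.toZFSet)

/-- The restriction of the sequence `d` to `τ`. -/
def restr (d : ZFSet.{u}) (τ : Ordinal.{u}) : ZFSet.{u} := graphOn τ.toZFSet (app d)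

/-- The set coding `⟨α, F(0), I(0), …, F(σ), I(σ), … : σ < τ⟩`. -/
def xpt (κ : Ordinal.{u}) (d : ZFSet.{u}) (α τ : Ordinal.{u}) : ZFSet.{u} :=
  (ESeq.mk κ α (restr d τ)).code

/-- The projection `⟨ν, e⟩ ↦ ⟨π_{β,α}(ν), e⟩` on extender sequences. -/
def proj (d : ZFSet.{u}) (β α : Ordinal.{u}) (x : ESeq.{u}) : ESeq.{u} :=
  ⟨x.c, (app (projOrd d β α) x.a.toZFSet).rank, x.d⟩

/-- For `K = {τ}`: `e` is the ultrapower embedding `j_τ : V → M_τ ≃ Ult(V, F(τ))`. For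
`K = {τ : τ < l}`: `e` is the direct limit embedding `j_E : V → M_E`. It derives the measures
`F_α(τ)`, `τ ∈ K`, and its target is generated by the points from which they are derived. -/
def IsUlt (κ : Ordinal.{u}) (d : ZFSet.{u}) (K : Set Ordinal.{u}) (e : InnerEmb.{u}) : Prop :=
  e.IsCrit κ ∧
  (∀ τ ∈ K, ∀ α, κ ≤ α → α < cs 3 κ → xpt κ d α τ ∈ e.j (V_ κ) ∧
    ∀ X, X ∈ meas d τ α ↔ X ⊆ V_ κ ∧ xpt κ d α τ ∈ e.j X) ∧
  ∀ y ∈ e.M, ∃ τ ∈ K, ∃ α, κ ≤ α ∧ α < cs 3 κ ∧ ∃ f, IsFun f (V_ κ) ∧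
    y = app (e.j f) (xpt κ d α τ)

/-- The embedding `j_τ` (`K = {τ}`) or `j_E` (`K = {τ : τ < l}`). -/
def ult (κ : Ordinal.{u}) (d : ZFSet.{u}) (K : Set Ordinal.{u}) : InnerEmb.{u} :=
  Classical.epsilon (IsUlt κ d K)

/-- The embedding `j_τ : V → M_τ`. -/
def ultAt (κ : Ordinal.{u}) (d : ZFSet.{u}) (τ : Ordinal.{u}) : InnerEmb.{u} := ult κ d {τ}

/-- The embedding `j_E : V → M_E`. -/
def ultE (κ : Ordinal.{u}) (d : ZFSet.{u}) : InnerEmb.{u} := ult κ d (Set.Iio (len d))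

/-- `E_β ≥ E_α`, for `α, β ∈ [κ, κ⁺³)`. -/
def ge (κ : Ordinal.{u}) (d : ZFSet.{u}) (β α : Ordinal.{u}) : Prop :=
  α ≤ β ∧ ∃ f ∈ ZFSet.funs κ.toZFSet κ.toZFSet,
    app ((ultE κ d).j f) β.toZFSet = α.toZFSet

/-- `d` is the sequence of extenders and guiding generics of an extender sequence system
`E = ⟨E_α : κ ≤ α < κ⁺³⟩`, `E_α = ⟨α, F(τ), I(τ) : τ < l⟩`, of positive length `l`. -/
structure IsSystem (κ : Ordinal.{u}) (d : ZFSet.{u}) : Prop where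
  pos : 0 < len d
  isFun : IsFun d (len d).toZFSet
  shape : ∀ τ < len d,
    app d τ.toZFSet = ZFSet.pair (ZFSet.pair (measFam d τ) (projFam d)) (gen d τ)
  meas_isFun : ∀ τ < len d, IsFun (measFam d τ) (dom κ)
  /-- The limit ultrapower and the ultrapowers exist, and derive the measures. -/
  ult_limit : ∃ e, IsUlt κ d (Set.Iio (len d)) e
  ult_at : ∀ τ < len d, ∃ e, IsUlt κ d {τ} e
  /-- `F(σ) : σ < τ` belongs to `M_τ`, and `i_τ : M_τ → M_E`, defined by
  `j_τ(f)(E_α ↾ σ) ↦ j_E(f)(E_α ↾ σ)` for `σ ≤ τ`, is an elementary embedding. -/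
  factor : ∀ τ < len d, ∃ i : (ultAt κ d τ).M ↪ₑ[LSet] (ultE κ d).M,
    ∀ σ ≤ τ, ∀ α, κ ≤ α → α < cs 3 κ → xpt κ d α σ ∈ (ultAt κ d τ).j (V_ κ) ∧
      ∀ f, IsFun f (V_ κ) → ∃ y : (ultAt κ d τ).M,
        (y : ZFSet) = app ((ultAt κ d τ).j f) (xpt κ d α σ) ∧
        (i y : ZFSet) = app ((ultE κ d).j f) (xpt κ d α σ)
  /-- The projections. -/
  proj_isFun : IsFun (projFam d) (ZFSet.sep
    (fun z => ∃ β α : Ordinal.{u}, z = ZFSet.pair β.toZFSet α.toZFSet ∧ ge κ d β α)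
    (ZFSet.prod (dom κ) (dom κ)))
  proj_spec : ∀ β α, κ ≤ α → β < cs 3 κ → ge κ d β α →
    projOrd d β α ∈ ZFSet.funs κ.toZFSet κ.toZFSet ∧
    app ((ultE κ d).j (projOrd d β α)) β.toZFSet = α.toZFSet
  proj_self : ∀ α, κ ≤ α → α < cs 3 κ → projOrd d α α = graphOn κ.toZFSet id
  /-- The guiding generics, and the lifting diagram `i_{σ,τ}'' I(σ) ⊆ I(τ)`. -/
  generic : ∀ τ < len d,
    IsGeneric (ultAt κ d τ).M (Rult (ultAt κ d τ) κ) (gen d τ)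
  lift : ∀ τ < len d, ∀ σ < τ, ∀ α, κ ≤ α → α < cs 3 κ → ∀ f, IsFun f (V_ κ) →
    app ((ultAt κ d σ).j f) (xpt κ d α σ) ∈ gen d σ →
    app ((ultAt κ d τ).j f) (xpt κ d α σ) ∈ gen d τ

/-- Membership in `I(E)`, the filter on `R_E = j_E²(R)(κ, j_E(κ))` generated by the images
`i_τ'' I(τ)`, `τ < l`. -/
def InGenE (κ : Ordinal.{u}) (d r : ZFSet.{u}) : Prop :=
  r ∈ Rult (ultE κ d) κ ∧ ∃ τ < len d, ∃ α, κ ≤ α ∧ α < cs 3 κ ∧ ∃ f, IsFun f (V_ κ) ∧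
    app ((ultAt κ d τ).j f) (xpt κ d α τ) ∈ gen d τ ∧
    rle (app ((ultE κ d).j f) (xpt κ d α τ)) r

/-- `x` is an extender sequence; those of length `0` only record a point `a ∈ [c, c⁺³)` above a
critical point `c`. -/
def ESeq.IsExt (x : ESeq.{u}) : Prop :=
  x.c ≤ x.a ∧ x.a < cs 3 x.c ∧
  ((x.d = ∅ ∧ ∃ e : InnerEmb.{u}, e.IsCrit x.c) ∨ IsSystem x.c x.d)

/-- `ν` is permitted to the `0`-increasing sequence `s`. -/
def Permitted (ν : ESeq.{u}) (s : List ESeq.{u}) : Prop := ∀ y ∈ s, y.c < ν.c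

/-- A set of extender sequences in `V_c` as an element of the universe. -/
def codes (c : Ordinal.{u}) (T : Set ESeq.{u}) : ZFSet.{u} :=
  ZFSet.sep (fun z => ∃ x ∈ T, x.code = z) (V_ c)

open Classical in
/-- A function of extender sequences as a function of their codes. -/
def onCodes (g : ESeq.{u} → ZFSet.{u}) (z : ZFSet.{u}) : ZFSet.{u} :=
  if h : ∃ x : ESeq.{u}, x.code = z then g h.choose else ∅

/-! ### The forcing `P*` -/

/-- The data `{⟨γ, p^γ⟩ : γ ∈ s} ∪ {⟨E_α, T, f, F⟩}`; here `E_γ` is represented by its index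
`γ ∈ [κ, κ⁺³)`, and `p^0 = p^κ` by a list of length at most one. -/
structure StarData where
  mc : Ordinal.{u}
  supp : Set Ordinal.{u}
  stem : Ordinal.{u} → List ESeq.{u}
  T : Set ESeq.{u}
  f : ESeq.{u} → ZFSet.{u}
  F : ESeq.{u} → ESeq.{u} → ZFSet.{u}

/-- `R(κ(p^0), b)`, which is trivial if `p^0` is empty. -/
def Rstem (s : List ESeq.{u}) (b : Ordinal.{u}) : ZFSet.{u} :=
  match s with
  | [] => {rone}
  | x :: _ => Rset x.a b

/-- `p^0` is empty, or it is an extender sequence in `V_c` with `κ(p^0)` inaccessible. -/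
def IsStemZero (c : Ordinal.{u}) (s : List ESeq.{u}) : Prop :=
  s = [] ∨ ∃ x, s = [x] ∧ x.IsExt ∧ x.code ∈ V_ c ∧ Inacc x.a

/-- Conditions of `P*_E`, where `E` is the system given by `d` on `c`. The functions `f` and `F`
take the value `∅` outside their domains. -/
structure StarData.Valid (c : Ordinal.{u}) (d : ZFSet.{u}) (p : StarData.{u}) : Prop where
  supp_dom : ∀ γ ∈ p.supp, c ≤ γ ∧ γ < cs 3 c
  supp_card : #p.supp ≤ Cardinal.lift.{u + 1} c.card
  zero_mem : c ∈ p.supp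
  stem_zero : IsStemZero c (p.stem c)
  stem_ne : ∀ γ ∈ p.supp, γ ≠ c → p.stem γ ≠ [] ∧
    (∀ x ∈ p.stem γ, x.IsExt ∧ x.code ∈ V_ c) ∧ (p.stem γ).Pairwise fun x y => x.c < y.c
  stem_off : ∀ γ, γ ∉ p.supp → p.stem γ = []
  /-- `κ(p^0) ≤ max κ(p^γ)` -/
  stem_le : ∀ γ ∈ p.supp, ∀ x ∈ p.stem c, ∃ y ∈ p.stem γ, x.a ≤ y.a
  mc_dom : c ≤ p.mc ∧ p.mc < cs 3 c
  mc_ge : ∀ γ ∈ p.supp, ge c d p.mc γ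
  T_ext : ∀ ν ∈ p.T, ν.IsExt ∧ ν.code ∈ V_ c
  T_mem : ∀ τ < len d, codes c p.T ∈ meas d τ p.mc
  permitted_card : ∀ ν ∈ p.T,
    #{γ | γ ∈ p.supp ∧ Permitted ν (p.stem γ)} ≤ Cardinal.lift.{u + 1} ν.c.card
  proj_ne : ∀ β ∈ p.supp, ∀ γ ∈ p.supp, ∀ ν ∈ p.T, β ≠ γ → Permitted ν (p.stem β) →
    Permitted ν (p.stem γ) → proj d p.mc β ν ≠ proj d p.mc γ ν
  f_mem : ∀ ν ∈ p.T, len ν.d = 0 → p.f ν ∈ Rstem (p.stem c) ν.c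
  f_off : ∀ ν, ¬ (ν ∈ p.T ∧ len ν.d = 0) → p.f ν = ∅
  F_mem : ∀ ν₁ ∈ p.T, ∀ ν₂ ∈ p.T, len ν₁.d = 0 → len ν₂.d = 0 → p.F ν₁ ν₂ ∈ Rset ν₁.c ν₂.c
  F_off : ∀ ν₁ ν₂, ¬ ((ν₁ ∈ p.T ∧ len ν₁.d = 0) ∧ ν₂ ∈ p.T ∧ len ν₂.d = 0) → p.F ν₁ ν₂ = ∅
  /-- `j_E²(F)(α, j_E(α)) ∈ I(E)` -/
  F_gen : InGenE c d (twoStep (ultE c d) (V_ c) (xpt c d p.mc 0)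
    fun v w => onCodes (fun x => onCodes (p.F x) w) v)

/-- `ξ > ⋃⋃ j_E(f^{p,Col})(κ(mc(p)))` -/
def StarData.Above (c : Ordinal.{u}) (d : ZFSet.{u}) (p : StarData.{u}) (ξ : Ordinal.{u}) : Prop :=
  ∀ z ∈ colField (app ((ultE c d).j (graphOn (V_ c) (onCodes p.f))) (xpt c d p.mc 0)), z.rank < ξ

/-- The Prikry extension relation `p ≤* q` of `P*_E`. -/
structure StarData.LeStar (c : Ordinal.{u}) (d : ZFSet.{u}) (p q : StarData.{u}) : Prop where
  supp_sub : q.supp ⊆ p.supp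
  stem_eq : ∀ γ ∈ q.supp, p.stem γ = q.stem γ
  mc_ge : ge c d p.mc q.mc
  mc_mem : p.mc ≠ q.mc → q.mc ∈ p.supp
  new_stem : ∀ γ ∈ p.supp, γ ∉ q.supp → ∃ y ∈ p.stem γ, q.Above c d y.c
  T_sub : ∀ ν ∈ p.T, proj d p.mc q.mc ν ∈ q.T
  comm : ∀ γ ∈ q.supp, ∀ ν ∈ p.T, Permitted ν (p.stem γ) →
    proj d p.mc γ ν = proj d q.mc γ (proj d p.mc q.mc ν)
  f_le : ∀ ν ∈ p.T, len ν.d = 0 → rle (p.f ν) (q.f (proj d p.mc q.mc ν))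
  F_le : ∀ ν₁ ∈ p.T, ∀ ν₂ ∈ p.T, len ν₁.d = 0 → len ν₂.d = 0 →
    rle (p.F ν₁ ν₂) (q.F (proj d p.mc q.mc ν₁) (proj d p.mc q.mc ν₂))

/-! ### The forcing `P_E` -/

/-- One block of a condition: an element of `P*_μ`, for a system `μ` of positive length given by
`d` on `c`, or, for `μ = ⟨c⟩` of length `0`, the element
`{⟨μ, p^0⟩, ⟨μ, T = ∅, f = r, F = ∅⟩}` with a single condition `r ∈ R(κ(p^0), c)`. -/
inductive Blk where
  | full (c : Ordinal.{u}) (d : ZFSet.{u}) (p : StarData.{u}) : Blk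
  | degen (c : Ordinal.{u}) (s : List ESeq.{u}) (r : ZFSet.{u}) : Blk

/-- `κ⁰(μ)` of the system of a block. -/
def Blk.c : Blk.{u} → Ordinal.{u}
  | .full c _ _ => c
  | .degen c _ _ => c

/-- `p^0` of a block. -/
def Blk.stemZero : Blk.{u} → List ESeq.{u}
  | .full c _ p => p.stem c
  | .degen _ s _ => s

/-- The block is a condition. -/
def Blk.Valid : Blk.{u} → Prop
  | .full c d p => IsSystem c d ∧ p.Valid c d
  | .degen c s r => (ESeq.mk c c ∅).IsExt ∧ IsStemZero c s ∧ r ∈ Rstem s c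

/-- The Prikry extension relation between blocks of the same system. -/
def Blk.LeStar : Blk.{u} → Blk.{u} → Prop
  | .full c d p, .full c' d' q => c = c' ∧ d = d' ∧ p.LeStar c d q
  | .degen c s r, .degen c' s' r' => c = c' ∧ s = s' ∧ rle r r'
  | _, _ => False

open Classical in
/-- `p_⟨ν⟩ = b₁ ⌢ b₀` is defined, for `p ∈ P*_E`: the block `b₀` on the system of `p` and the block
`b₁` on the system of `ν` (or on `⟨ν⁰⟩` if `ν` has length `0`) are conditions with the required
entries. -/
def IsOnePoint (c : Ordinal.{u}) (d : ZFSet.{u}) (p : StarData.{u}) (ν : ESeq.{u})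
    (b₁ b₀ : Blk.{u}) : Prop :=
  let pr : Ordinal.{u} → ESeq.{u} := fun γ => proj d p.mc γ ν
  let S : Set Ordinal.{u} := {γ | γ ∈ p.supp ∧ Permitted ν (p.stem γ)}
  let T₀ : Set ESeq.{u} := {x | x ∈ p.T ∧ x.code ∉ V_ ν.c}
  let T₁ : Set ESeq.{u} := {x | x ∈ p.T ∧ x.code ∈ V_ ν.c}
  ν ∈ p.T ∧ p.Above c d ν.c ∧ Permitted ν (p.stem c) ∧ b₁.Valid ∧ b₀.Valid ∧
  (b₀ = .full c d
    { mc := p.mc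
      supp := p.supp
      stem := fun γ => if γ ∈ S then
          (if 0 < len ν.d ∨ γ = c then [pr γ] else p.stem γ ++ [pr γ])
        else p.stem γ
      T := T₀
      f := fun x => if x ∈ T₀ ∧ len x.d = 0 then p.F ⟨ν.c, ν.a, ∅⟩ x else ∅
      F := fun x y => if x ∈ T₀ ∧ y ∈ T₀ then p.F x y else ∅ }) ∧
  (0 < len ν.d → ∃ p₁ : StarData.{u}, b₁ = .full ν.c ν.d p₁ ∧ p₁.mc = ν.a ∧
    p₁.supp = (fun γ => (pr γ).a) '' S ∧ (∀ γ ∈ S, p₁.stem (pr γ).a = p.stem γ) ∧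
    p₁.T = T₁ ∧ (∀ x, p₁.f x = if x ∈ T₁ then p.f x else ∅) ∧
    (∀ x y, p₁.F x y = if x ∈ T₁ ∧ y ∈ T₁ then p.F x y else ∅) ∧
    -- the projections of the system of `ν` onto the points of `supp` continue those of `E`
    ∀ γ ∈ S, ∀ x ∈ T₁, Permitted x (p.stem γ) → proj ν.d ν.a (pr γ).a x = proj d p.mc γ x) ∧
  (len ν.d = 0 → b₁ = .degen ν.c (p.stem c) (p.f ν))

/-- The block `b'` may stand directly below the block `b`. -/
def Blk.Below (b b' : Blk.{u}) : Prop := b'.c < b.c ∧ ∃ x, b.stemZero = [x] ∧ b'.c ≤ x.c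

/-- `P_E`: the condition `p = p_n ⌢ … ⌢ p_0` is the list `[p_0, …, p_n]`. -/
def PCond (κ : Ordinal.{u}) (d : ZFSet.{u}) : Type (u + 1) :=
  {L : List Blk.{u} // (∃ p L', L = Blk.full κ d p :: L') ∧ (∀ b ∈ L, b.Valid) ∧
    L.IsChain Blk.Below}

variable {κ : Ordinal.{u}} {d : ZFSet.{u}}

/-- `p ≤* q` in `P_E`. -/
def PCond.LeStar (p q : PCond κ d) : Prop := List.Forall₂ Blk.LeStar p.1 q.1

/-- `p ≤¹ q` in `P_E`. -/
def PCond.LeOne (p q : PCond κ d) : Prop :=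
  ∃ (L₀ L₁ : List Blk.{u}) (c : Ordinal.{u}) (e : ZFSet.{u}) (r : StarData.{u}) (ν : ESeq.{u})
    (b₁ b₀ : Blk.{u}), q.1 = L₀ ++ Blk.full c e r :: L₁ ∧ IsOnePoint c e r ν b₁ b₀ ∧
    List.Forall₂ Blk.LeStar p.1 (L₀ ++ b₀ :: b₁ :: L₁)

/-- `p ≤ⁿ q` in `P_E`. -/
def PCond.LeN : ℕ → PCond κ d → PCond κ d → Prop
  | 0, p, q => p.LeStar q
  | 1, p, q => p.LeOne q
  | n + 2, p, q => ∃ r : PCond κ d, p.LeOne r ∧ PCond.LeN (n + 1) r q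

/-- `p ≤ q` in `P_E`. -/
instance : LE (PCond κ d) := ⟨fun p q => ∃ n, PCond.LeN n p q⟩

/-! ### The forcing `Q_E` and the projection -/

/-- The data `{⟨γ, p^γ⟩ : γ ∈ s} ∪ {⟨E_α, T⟩}`. -/
structure QData where
  mc : Ordinal.{u}
  supp : Set Ordinal.{u}
  stem : Ordinal.{u} → List ESeq.{u}
  T : Set ESeq.{u}

/-- Conditions of `Q*_E`. -/
structure QData.Valid (c : Ordinal.{u}) (d : ZFSet.{u}) (p : QData.{u}) : Prop where
  supp_dom : ∀ γ ∈ p.supp, c ≤ γ ∧ γ < cs 3 c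
  supp_card : #p.supp ≤ Cardinal.lift.{u + 1} c.card
  zero_mem : c ∈ p.supp
  stem_zero : IsStemZero c (p.stem c)
  stem_ne : ∀ γ, γ ≠ c → p.stem γ = []
  mc_dom : c ≤ p.mc ∧ p.mc < cs 3 c
  mc_ge : ∀ γ ∈ p.supp, ge c d p.mc γ
  T_ext : ∀ ν ∈ p.T, ν.IsExt ∧ ν.code ∈ V_ c
  T_mem : ∀ τ < len d, codes c p.T ∈ meas d τ p.mc

/-- One block of a condition of `Q_E`. -/
inductive QBlk where
  | full (c : Ordinal.{u}) (d : ZFSet.{u}) (p : QData.{u}) : QBlk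
  | degen (c : Ordinal.{u}) (s : List ESeq.{u}) : QBlk

/-- `κ⁰(μ)` of the system of a block. -/
def QBlk.c : QBlk.{u} → Ordinal.{u}
  | .full c _ _ => c
  | .degen c _ => c

/-- `p^0` of a block. -/
def QBlk.stemZero : QBlk.{u} → List ESeq.{u}
  | .full c _ p => p.stem c
  | .degen _ s => s

/-- The block is a condition. -/
def QBlk.Valid : QBlk.{u} → Prop
  | .full c d p => IsSystem c d ∧ p.Valid c d
  | .degen c s => (ESeq.mk c c ∅).IsExt ∧ IsStemZero c s

/-- The block `b'` may stand directly below the block `b`. -/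
def QBlk.Below (b b' : QBlk.{u}) : Prop := b'.c < b.c ∧ ∃ x, b.stemZero = [x] ∧ b'.c ≤ x.c

/-- The identification of conditions of `Q*_E` which differ at most in their supports. -/
def QBlk.Sim : QBlk.{u} → QBlk.{u} → Prop
  | .full c d p, .full c' d' q =>
      c = c' ∧ d = d' ∧ p.stem c = q.stem c ∧ p.mc = q.mc ∧ p.T = q.T
  | .degen c s, .degen c' s' => c = c' ∧ s = s'
  | _, _ => False

/-- Conditions of `Q_E` before the identification. -/
def QCond (κ : Ordinal.{u}) (d : ZFSet.{u}) : Type (u + 1) :=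
  {L : List QBlk.{u} // (∃ p L', L = QBlk.full κ d p :: L') ∧ (∀ b ∈ L, b.Valid) ∧
    L.IsChain QBlk.Below}

theorem QBlk.Sim.refl (b : QBlk.{u}) : b.Sim b := by
  cases b <;> simp [QBlk.Sim]

theorem QBlk.Sim.symm {b b' : QBlk.{u}} (h : b.Sim b') : b'.Sim b := by
  cases b <;> cases b' <;> simp only [QBlk.Sim] at h ⊢
  · obtain ⟨rfl, rfl, h1, h2, h3⟩ := h
    exact ⟨rfl, rfl, h1.symm, h2.symm, h3.symm⟩
  · exact ⟨h.1.symm, h.2.symm⟩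

theorem QBlk.Sim.trans {b b' b'' : QBlk.{u}} (h : b.Sim b') (h' : b'.Sim b'') : b.Sim b'' := by
  cases b <;> cases b' <;> cases b'' <;> simp only [QBlk.Sim] at h h' ⊢
  · obtain ⟨rfl, rfl, h1, h2, h3⟩ := h
    obtain ⟨rfl, rfl, h4, h5, h6⟩ := h'
    exact ⟨rfl, rfl, h1.trans h4, h2.trans h5, h3.trans h6⟩
  · exact ⟨h.1.trans h'.1, h.2.trans h'.2⟩

theorem simTrans : ∀ {L L' L'' : List QBlk.{u}}, List.Forall₂ QBlk.Sim L L' →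
    List.Forall₂ QBlk.Sim L' L'' → List.Forall₂ QBlk.Sim L L''
  | _, _, _, .nil, .nil => .nil
  | _, _, _, .cons h t, .cons h' t' => .cons (h.trans h') (simTrans t t')

instance : Setoid (QCond κ d) where
  r p q := List.Forall₂ QBlk.Sim p.1 q.1
  iseqv :=
    { refl := fun _ => List.forall₂_same.2 fun b _ => QBlk.Sim.refl b
      symm := fun h => (h.imp fun _ _ k => QBlk.Sim.symm k).flip
      trans := fun h h' => simTrans h h' }

/-- The underlying set of `Q_E`. -/
def QPoset (κ : Ordinal.{u}) (d : ZFSet.{u}) : Type (u + 1) :=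
  Quotient (inferInstance : Setoid (QCond κ d))

open Classical in
/-- The projection of `P*_E` to `Q*_E`: it forgets `f`, `F`, and `p^γ` for `γ ≠ κ`. -/
def phiStar (c : Ordinal.{u}) (p : StarData.{u}) : QData.{u} where
  mc := p.mc
  supp := p.supp
  stem := fun γ => if γ = c then p.stem c else []
  T := p.T

/-- The projection of a block. -/
def phiBlk : Blk.{u} → QBlk.{u}
  | .full c d p => .full c d (phiStar c p)
  | .degen c s _ => .degen c s

theorem phiStar_valid {c : Ordinal.{u}} {d : ZFSet.{u}} {p : StarData.{u}} (h : p.Valid c d) :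
    (phiStar c p).Valid c d where
  supp_dom := h.supp_dom
  supp_card := h.supp_card
  zero_mem := h.zero_mem
  stem_zero := by simpa [phiStar] using h.stem_zero
  stem_ne := fun γ hγ => by simp [phiStar, hγ]
  mc_dom := h.mc_dom
  mc_ge := h.mc_ge
  T_ext := h.T_ext
  T_mem := h.T_mem

theorem phiBlk_valid {b : Blk.{u}} (h : b.Valid) : (phiBlk b).Valid := by
  cases b with
  | full c d p => exact ⟨h.1, phiStar_valid h.2⟩
  | degen c s r => exact ⟨h.1, h.2.1⟩

theorem phiBlk_below {b b' : Blk.{u}} (h : b.Below b') : (phiBlk b).Below (phiBlk b') := by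
  cases b <;> cases b' <;>
    simpa [Blk.Below, QBlk.Below, phiBlk, phiStar, Blk.c, QBlk.c, Blk.stemZero,
      QBlk.stemZero] using h

/-- The projection `Φ : P_E → Q_E`. -/
def Phi (p : PCond κ d) : QPoset κ d :=
  Quotient.mk _ ⟨p.1.map phiBlk, by
    obtain ⟨L, ⟨r, L', rfl⟩, hv, hc⟩ := p
    refine ⟨⟨phiStar κ r, L'.map phiBlk, rfl⟩, ?_, ?_⟩
    · intro b hb
      obtain ⟨a, ha, rfl⟩ := List.mem_map.1 hb
      exact phiBlk_valid (hv a ha)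
    · exact (List.isChain_map phiBlk).2 (hc.imp fun _ _ => phiBlk_below)⟩

end ExtRadin

end

/-! Conditions with the same image under `Φ` have blocks that differ only in supports, in the stems
at coordinates other than `κ`, and in `f`, `F` and `r`. The proof makes these data comparable by
direct extensions, one block at a time, and then shows that the cones below comparable conditions
are isomorphic by substitution.

Comparable means `Matched` (`exists_matched`). The two blocks get a common support, which contains
the maximal coordinate, a common measure one set and a common `F`; the values of the two `f` get
equal domains in each of the seven factors and equal collapse fields; and each `ν` is permitted to
the same coordinates on both sides. A common `F` exists because both second iterates lie in the
filter `I(E)`, which is closed under unions (`InGenE.join`); by Łoś the values of the two `F` are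
then compatible on a measure one set (`exists_big_compat`), where their union serves. The common
support is handled by diagonal intersections and the regularity of `κ`. Łoś's theorem is used for
absolute predicates only, which are the same in `V` and in every target model.

Given matched blocks `P` and `Q`, an extension of the one condition is carried to an extension of
the other by two substitutions. A stem that begins with `P.stem γ₀` is made to begin with `Q.stem
γ₀`. A condition `r ≤ P.f y` is replaced by `(r \ P.f y) ∪ Q.f y`; this is `modf`, which is inverted
by exchanging `P` and `Q`, since the domains agree. Equal collapse fields keep `Above` unchanged, so
the same one-point extensions are available on both sides.

For this to be a function of the extension, the places of the substitutions must be readable from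
it. A one-point extension by `ν` of positive length moves the stem at a permitted coordinate to the
block on `κ⁰(ν)`, but leaves behind the projection of `ν`, which names the new place. Following
these projections leads to the current place of each coordinate (`Path`). An extension by `ν` of
length `0` appends its projection to the stems, so the point `y` at which `P.f` is to be exchanged
stands right after `P.stem P.mc` at the current place of `P.mc`; this is why the maximal coordinate
is put into the support. If `P.mc = κ`, then `y` is determined by `κ⁰(ν)`. The values of `f` in
upper blocks come from the common `F` and stay unchanged.

The correspondence (`ListRel`) is a simulation for `≤*` and for one-point extensions, in both
directions, and each side determines the other (`ListRel.unique`). Such a relation is an isomorphism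
of cones (`Simulation.nonempty_iso`). Blocks of length `0` need only `modf` (`DegenRel`). -/

namespace ExtRadin

/-! ### Absolute predicates and functions -/

/-- A predicate given by one formula which is absolute for the targets of all embeddings. -/
def Abs {n : ℕ} (P : (Fin n → ZFSet.{u}) → Prop) : Prop :=
  ∃ φ : LSet.Formula (Fin n), (∀ v : Fin n → ZFSet.{u}, φ.Realize v ↔ P v) ∧
    ∀ (e : InnerEmb.{u}) (v : Fin n → e.M), φ.Realize v ↔ P fun i => (v i : ZFSet)

/-- A function whose graph is absolute. -/
def AbsF {n : ℕ} (g : (Fin n → ZFSet.{u}) → ZFSet.{u}) : Prop :=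
  Abs fun w : Fin (n + 1) → ZFSet.{u} => w 0 = g fun i => w i.succ

theorem Abs.congr {n : ℕ} {P Q : (Fin n → ZFSet.{u}) → Prop} (h : Abs P) (e : ∀ v, P v ↔ Q v) :
    Abs Q := by
  have : P = Q := funext fun v => propext (e v)
  exact this ▸ h

/-- Elementarity moves the defining formula from `V` to the target, and absoluteness reads it there
as the same predicate, so no relativisation to the target appears. -/
theorem Abs.j_iff {n : ℕ} {P : (Fin n → ZFSet.{u}) → Prop} (h : Abs P) (e : InnerEmb.{u})
    (v : Fin n → ZFSet.{u}) : P (fun i => e.j (v i)) ↔ P v := by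
  obtain ⟨φ, h1, h2⟩ := h
  rw [← h1 v, ← e.emb.map_formula φ v]
  exact (h2 e (e.emb ∘ v)).symm

/-- The version for the factor maps `i_τ : M_τ → M_E`. -/
theorem Abs.emb_iff {n : ℕ} {P : (Fin n → ZFSet.{u}) → Prop} (h : Abs P) (e e' : InnerEmb.{u})
    (i : e.M ↪ₑ[LSet] e'.M) (v : Fin n → e.M) :
    P (fun k => (i (v k) : ZFSet)) ↔ P (fun k => (v k : ZFSet)) := by
  obtain ⟨φ, h1, h2⟩ := h
  rw [← h2 e v, ← i.map_formula φ v]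
  exact (h2 e' (i ∘ v)).symm

theorem Abs.not {n : ℕ} {P : (Fin n → ZFSet.{u}) → Prop} (h : Abs P) : Abs fun v => ¬ P v := by
  obtain ⟨φ, h1, h2⟩ := h
  refine ⟨∼φ, fun v => ?_, fun e v => ?_⟩
  · exact Language.Formula.realize_not.trans (not_congr (h1 v))
  · exact Language.Formula.realize_not.trans (not_congr (h2 e v))

theorem Abs.and {n : ℕ} {P Q : (Fin n → ZFSet.{u}) → Prop} (h : Abs P) (h' : Abs Q) :
    Abs fun v => P v ∧ Q v := by
  obtain ⟨φ, h1, h2⟩ := h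
  obtain ⟨ψ, h3, h4⟩ := h'
  refine ⟨φ ⊓ ψ, fun v => ?_, fun e v => ?_⟩
  · exact Language.Formula.realize_inf.trans (and_congr (h1 v) (h3 v))
  · exact Language.Formula.realize_inf.trans (and_congr (h2 e v) (h4 e v))

theorem Abs.or {n : ℕ} {P Q : (Fin n → ZFSet.{u}) → Prop} (h : Abs P) (h' : Abs Q) :
    Abs fun v => P v ∨ Q v :=
  (h.not.and h'.not).not.congr fun v => by tauto

theorem Abs.imp {n : ℕ} {P Q : (Fin n → ZFSet.{u}) → Prop} (h : Abs P) (h' : Abs Q) :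
    Abs fun v => P v → Q v :=
  (h.and h'.not).not.congr fun v => by tauto

theorem Abs.relabel {m n : ℕ} {P : (Fin m → ZFSet.{u}) → Prop} (h : Abs P) (σ : Fin m → Fin n) :
    Abs fun v => P fun i => v (σ i) := by
  obtain ⟨φ, h1, h2⟩ := h
  refine ⟨φ.relabel σ, fun v => ?_, fun e v => ?_⟩
  · rw [Language.Formula.realize_relabel, h1]; rfl
  · rw [Language.Formula.realize_relabel, h2]; rfl

theorem Abs.weaken₁ {n : ℕ} {Q : ZFSet.{u} → (Fin n → ZFSet.{u}) → Prop}
    (h : Abs fun w : Fin (n + 1) → ZFSet.{u} => Q (w 0) fun i => w i.succ) :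
    Abs fun w : Fin (n + 2) → ZFSet.{u} => Q (w 0) fun i => w i.succ.succ :=
  let σ : Fin (n + 1) → Fin (n + 2) := Fin.cases 0 fun i => i.succ.succ
  (Abs.relabel h σ).congr fun _ => Iff.rfl

theorem abs_mem_var {n : ℕ} (i k : Fin n) : Abs fun v : Fin n → ZFSet.{u} => v i ∈ v k := by
  let R : LSet.Relations 2 := MemSymb.mem
  exact ⟨R.formula₂ (Language.Term.var i) (Language.Term.var k),
    fun v => Language.Formula.realize_rel₂, fun e v => Language.Formula.realize_rel₂⟩

theorem abs_eq_var {n : ℕ} (i k : Fin n) : Abs fun v : Fin n → ZFSet.{u} => v i = v k := by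
  refine ⟨Language.Term.equal (L := LSet) (Language.Term.var i) (Language.Term.var k),
    fun v => ?_, fun e v => ?_⟩
  · rw [Language.Formula.realize_equal]; rfl
  · rw [Language.Formula.realize_equal]; exact Subtype.ext_iff

/-- Bounded quantifiers are absolute because the targets are transitive: a witness in `v k` already
belongs to the target. -/
theorem abs_ex_mem_var {n : ℕ} (k : Fin n) {Q : ZFSet.{u} → (Fin n → ZFSet.{u}) → Prop}
    (h : Abs fun w : Fin (n + 1) → ZFSet.{u} => Q (w 0) fun i => w i.succ) :
    Abs fun v : Fin n → ZFSet.{u} => ∃ z ∈ v k, Q z v := by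
  obtain ⟨φ, h1, h2⟩ := (abs_mem_var (0 : Fin (n + 1)) k.succ).and h
  refine ⟨(φ.relabel (Fin.cases (Sum.inr ()) Sum.inl : Fin (n + 1) → Fin n ⊕ Unit)).iExs Unit,
    fun v => ?_, fun e v => ?_⟩
  · rw [Language.Formula.realize_iExs]
    simp only [Language.Formula.realize_relabel, h1]
    exact ⟨fun ⟨i, hi⟩ => ⟨i (), hi⟩, fun ⟨z, hz⟩ => ⟨fun _ => z, hz⟩⟩
  · rw [Language.Formula.realize_iExs]
    simp only [Language.Formula.realize_relabel, h2]
    exact ⟨fun ⟨i, hi⟩ => ⟨i (), hi⟩,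
      fun ⟨z, hz⟩ => ⟨fun _ => ⟨z, e.trans _ (v k).2 z hz.1⟩, hz⟩⟩

/-- The targets of embeddings are closed under absolute functions. -/
theorem AbsF.closed {n : ℕ} {g : (Fin n → ZFSet.{u}) → ZFSet.{u}} (h : AbsF g) (e : InnerEmb.{u})
    (v : Fin n → e.M) : g (fun i => (v i : ZFSet)) ∈ e.M := by
  obtain ⟨φ, h1, h2⟩ := h
  let ψ : LSet.Formula (Fin n) :=
    (φ.relabel (Fin.cases (Sum.inr ()) Sum.inl : Fin (n + 1) → Fin n ⊕ Unit)).iExs Unit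
  let χ : LSet.Formula Empty := (ψ.relabel (Sum.inr : Fin n → Empty ⊕ Fin n)).iAlls (Fin n)
  -- The sentence `∀ v ∃ y φ(y, v)` holds in `V` with `y = g v`, hence in the target. There the
  -- absoluteness of `φ` forces the witness to be `g v`.
  have hV : χ.Realize (Empty.elim : Empty → ZFSet.{u}) := by
    rw [Language.Formula.realize_iAlls]
    intro w
    rw [Language.Formula.realize_relabel, Language.Formula.realize_iExs]
    refine ⟨fun _ => g w, ?_⟩
    rw [Language.Formula.realize_relabel, h1]
    rfl
  rw [← e.emb.map_formula, Language.Formula.realize_iAlls] at hV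
  have := hV v
  rw [Language.Formula.realize_relabel, Language.Formula.realize_iExs] at this
  obtain ⟨i, hi⟩ := this
  rw [Language.Formula.realize_relabel, h2] at hi
  have h3 : ((i () : e.M) : ZFSet) = g fun i => (v i : ZFSet) := hi
  exact h3 ▸ (i ()).2

theorem AbsF.j_eq {n : ℕ} {g : (Fin n → ZFSet.{u}) → ZFSet.{u}} (h : AbsF g) (e : InnerEmb.{u})
    (v : Fin n → ZFSet.{u}) : e.j (g v) = g fun i => e.j (v i) := by
  have := (Abs.j_iff h e (Fin.cases (g v) v)).2 rfl
  exact this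

theorem AbsF.congr {n : ℕ} {g g' : (Fin n → ZFSet.{u}) → ZFSet.{u}} (h : AbsF g)
    (e : ∀ v, g v = g' v) : AbsF g' := by
  have : g = g' := funext e
  exact this ▸ h

theorem absF_var {n : ℕ} (k : Fin n) : AbsF fun v : Fin n → ZFSet.{u} => v k :=
  abs_eq_var 0 k.succ

/-- Substitution of absolute functions. -/
theorem Abs.comp {m n : ℕ} {P : (Fin m → ZFSet.{u}) → Prop} (h : Abs P)
    {t : Fin m → (Fin n → ZFSet.{u}) → ZFSet.{u}} (ht : ∀ i, AbsF (t i)) :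
    Abs fun v => P fun i => t i v := by
  have ht' := ht
  obtain ⟨φ, h1, h2⟩ := h
  choose ψ h3 h4 using ht
  -- The values of the inner functions become existentially quantified variables that are pinned
  -- down by their graphs. In a target they exist by `AbsF.closed`.
  let χ : LSet.Formula (Fin n ⊕ Fin m) :=
    (φ.relabel Sum.inr) ⊓ Language.Formula.iInf fun i =>
      (ψ i).relabel (Fin.cases (Sum.inr i) Sum.inl : Fin (n + 1) → Fin n ⊕ Fin m)
  refine ⟨χ.iExs (Fin m), fun v => ?_, fun e v => ?_⟩
  · rw [Language.Formula.realize_iExs]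
    simp only [χ, Language.Formula.realize_inf, Language.Formula.realize_relabel,
      Language.Formula.realize_iInf, h1, h3]
    constructor
    · rintro ⟨y, hy, hy'⟩
      have : y = fun i => t i v := funext fun i => hy' i
      subst this
      exact hy
    · exact fun hP => ⟨fun i => t i v, hP, fun i => rfl⟩
  · rw [Language.Formula.realize_iExs]
    simp only [χ, Language.Formula.realize_inf, Language.Formula.realize_relabel,
      Language.Formula.realize_iInf, h2, h4]
    constructor
    · rintro ⟨y, hy, hy'⟩
      have : (fun i => (y i : ZFSet)) = fun i => t i fun k => (v k : ZFSet) :=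
        funext fun i => hy' i
      rw [← this]
      exact hy
    · exact fun hP => ⟨fun i => ⟨t i fun k => (v k : ZFSet), (ht' i).closed e v⟩, hP, fun i => rfl⟩

theorem AbsF.weaken {n : ℕ} {t : (Fin n → ZFSet.{u}) → ZFSet.{u}} (h : AbsF t) :
    AbsF fun w : Fin (n + 1) → ZFSet.{u} => t fun i => w i.succ :=
  Abs.weaken₁ (Q := fun z w => z = t w) h

theorem AbsF.comp {m n : ℕ} {g : (Fin m → ZFSet.{u}) → ZFSet.{u}} (h : AbsF g)
    {t : Fin m → (Fin n → ZFSet.{u}) → ZFSet.{u}} (ht : ∀ i, AbsF (t i)) :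
    AbsF fun v => g fun i => t i v :=
  let s : Fin (m + 1) → (Fin (n + 1) → ZFSet.{u}) → ZFSet.{u} :=
    Fin.cases (fun w => w 0) fun i w => t i fun k => w k.succ
  (Abs.comp h (t := s) fun i => Fin.cases (absF_var 0) (fun i => (ht i).weaken) i).congr
    fun _ => Iff.rfl

/-! ### Closure of absolute notions under bounded quantifiers and basic set operations. -/

section comp

variable {n : ℕ} {t t₁ t₂ t₃ t₄ : (Fin n → ZFSet.{u}) → ZFSet.{u}}

theorem Abs.comp₁ {R : ZFSet.{u} → Prop} (h : Abs fun v : Fin 1 → ZFSet.{u} => R (v 0))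
    (h₁ : AbsF t₁) : Abs fun v => R (t₁ v) :=
  h.comp (t := ![t₁]) (by intro i; fin_cases i; exact h₁)

theorem Abs.comp₂ {R : ZFSet.{u} → ZFSet.{u} → Prop}
    (h : Abs fun v : Fin 2 → ZFSet.{u} => R (v 0) (v 1)) (h₁ : AbsF t₁) (h₂ : AbsF t₂) :
    Abs fun v => R (t₁ v) (t₂ v) :=
  h.comp (t := ![t₁, t₂]) (by intro i; fin_cases i; exacts [h₁, h₂])

theorem AbsF.comp₁ {g : ZFSet.{u} → ZFSet.{u}} (h : AbsF fun v : Fin 1 → ZFSet.{u} => g (v 0))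
    (h₁ : AbsF t₁) : AbsF fun v => g (t₁ v) :=
  AbsF.comp h (t := ![t₁]) (by intro i; fin_cases i; exact h₁)

theorem AbsF.comp₂ {g : ZFSet.{u} → ZFSet.{u} → ZFSet.{u}}
    (h : AbsF fun v : Fin 2 → ZFSet.{u} => g (v 0) (v 1)) (h₁ : AbsF t₁) (h₂ : AbsF t₂) :
    AbsF fun v => g (t₁ v) (t₂ v) :=
  AbsF.comp h (t := ![t₁, t₂]) (by intro i; fin_cases i; exacts [h₁, h₂])

theorem AbsF.eq (h₁ : AbsF t₁) (h₂ : AbsF t₂) : Abs fun v => t₁ v = t₂ v :=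
  Abs.comp₂ (R := fun x y => x = y) (abs_eq_var 0 1) h₁ h₂

theorem AbsF.mem (h₁ : AbsF t₁) (h₂ : AbsF t₂) : Abs fun v => t₁ v ∈ t₂ v :=
  Abs.comp₂ (R := fun x y => x ∈ y) (abs_mem_var 0 1) h₁ h₂

theorem AbsF.ex {Q : ZFSet.{u} → (Fin n → ZFSet.{u}) → Prop} (ht : AbsF t)
    (h : Abs fun w : Fin (n + 1) → ZFSet.{u} => Q (w 0) fun i => w i.succ) :
    Abs fun v : Fin n → ZFSet.{u} => ∃ z ∈ t v, Q z v := by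
  have h1 : Abs fun v : Fin (n + 1) → ZFSet.{u} => ∃ z ∈ v 0, Q z fun i => v i.succ :=
    abs_ex_mem_var (n := n + 1) (Q := fun z v => Q z fun i => v i.succ) 0
      h.weaken₁
  exact Abs.comp h1 (t := (Fin.cases t fun i v => v i :
    Fin (n + 1) → (Fin n → ZFSet.{u}) → ZFSet.{u})) fun i => Fin.cases ht absF_var i

theorem AbsF.all {Q : ZFSet.{u} → (Fin n → ZFSet.{u}) → Prop} (ht : AbsF t)
    (h : Abs fun w : Fin (n + 1) → ZFSet.{u} => Q (w 0) fun i => w i.succ) :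
    Abs fun v : Fin n → ZFSet.{u} => ∀ z ∈ t v, Q z v :=
  (AbsF.ex (Q := fun z v => ¬ Q z v) ht h.not).not.congr fun v => by push Not; rfl

theorem AbsF.subset (h₁ : AbsF t₁) (h₂ : AbsF t₂) : Abs fun v => t₁ v ⊆ t₂ v :=
  (h₁.all (Q := fun z v => z ∈ t₂ v) ((absF_var 0).mem h₂.weaken)).congr fun _ => Iff.rfl

/-- A function is absolute if membership in its values is absolute and its values are included in
the values of an absolute function. -/
theorem absF_of_mem {g : (Fin n → ZFSet.{u}) → ZFSet.{u}} (ht : AbsF t)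
    (h : Abs fun w : Fin (n + 1) → ZFSet.{u} => w 0 ∈ g fun i => w i.succ)
    (hg : ∀ v, g v ⊆ t v) : AbsF g := by
  have h1 : Abs fun w : Fin (n + 1) → ZFSet.{u} =>
      (∀ z ∈ w 0, z ∈ g fun i => w i.succ) ∧ ∀ z ∈ t (fun i => w i.succ),
        z ∈ g (fun i => w i.succ) → z ∈ w 0 :=
    ((absF_var 0).all (Q := fun z w => z ∈ g fun i => w i.succ)
      (Abs.weaken₁ (Q := fun z w => z ∈ g w) h)).and
      (ht.weaken.all (Q := fun z w => z ∈ g (fun i => w i.succ) → z ∈ w 0)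
        ((Abs.weaken₁ (Q := fun z w => z ∈ g w) h).imp (abs_mem_var 0 1)))
  refine h1.congr fun w => ?_
  constructor
  · rintro ⟨h2, h3⟩
    exact ZFSet.ext fun z => ⟨h2 z, fun hz => h3 z (hg _ hz) hz⟩
  · intro h2
    rw [← h2]
    exact ⟨fun _ h => h, fun _ _ h => h⟩

theorem AbsF.sep {Q : ZFSet.{u} → (Fin n → ZFSet.{u}) → Prop} (ht : AbsF t)
    (h : Abs fun w : Fin (n + 1) → ZFSet.{u} => Q (w 0) fun i => w i.succ) :
    AbsF fun v => ZFSet.sep (fun z => Q z v) (t v) :=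
  absF_of_mem ht ((((absF_var 0).mem ht.weaken).and h).congr fun w => by simp [ZFSet.mem_sep])
    fun v => ZFSet.sep_subset

theorem AbsF.sUnion (ht : AbsF t) : AbsF fun v => (⋃₀ t v : ZFSet) := by
  have h1 : AbsF fun v : Fin 1 → ZFSet.{u} => (⋃₀ v 0 : ZFSet) := by
    have h1 : Abs fun w : Fin 2 → ZFSet.{u} =>
        (∀ z ∈ w 0, ∃ x ∈ w 1, z ∈ x) ∧ ∀ x ∈ w 1, ∀ z ∈ x, z ∈ w 0 :=
      ((absF_var 0).all (Q := fun z w => ∃ x ∈ w 1, z ∈ x)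
        ((absF_var 2).ex (Q := fun x w => w 0 ∈ x) (abs_mem_var 1 0))).and
      ((absF_var 1).all (Q := fun x w => ∀ z ∈ x, z ∈ w 0)
        ((absF_var 0).all (Q := fun z w => z ∈ w 1) (abs_mem_var 0 2)))
    refine h1.congr fun w => ?_
    constructor
    · rintro ⟨h2, h3⟩
      ext z
      rw [ZFSet.mem_sUnion]
      exact ⟨h2 z, fun ⟨x, hx, hz⟩ => h3 x hx z hz⟩
    · intro h2
      refine ⟨fun z hz => ?_, fun x hx z hz => ?_⟩
      · rw [h2, ZFSet.mem_sUnion] at hz; exact hz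
      · rw [h2, ZFSet.mem_sUnion]; exact ⟨x, hx, hz⟩
  exact AbsF.comp₁ (g := fun x => (⋃₀ x : ZFSet)) h1 ht

theorem AbsF.upair (h₁ : AbsF t₁) (h₂ : AbsF t₂) : AbsF fun v => ({t₁ v, t₂ v} : ZFSet) := by
  have h1 : AbsF fun v : Fin 2 → ZFSet.{u} => ({v 0, v 1} : ZFSet) := by
    have h1 : Abs fun w : Fin 3 → ZFSet.{u} =>
        (∀ z ∈ w 0, z = w 1 ∨ z = w 2) ∧ w 1 ∈ w 0 ∧ w 2 ∈ w 0 :=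
      ((absF_var 0).all (Q := fun z w => z = w 1 ∨ z = w 2)
        ((abs_eq_var 0 2).or (abs_eq_var 0 3))).and ((abs_mem_var 1 0).and (abs_mem_var 2 0))
    refine h1.congr fun w => ?_
    constructor
    · rintro ⟨h2, h3, h4⟩
      ext z
      rw [ZFSet.mem_pair]
      exact ⟨h2 z, fun hz => by rcases hz with rfl | rfl <;> assumption⟩
    · intro h2
      rw [h2]
      exact ⟨fun z hz => ZFSet.mem_pair.1 hz, ZFSet.mem_pair.2 (Or.inl rfl),
        ZFSet.mem_pair.2 (Or.inr rfl)⟩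
  exact AbsF.comp₂ (g := fun x y => ({x, y} : ZFSet)) h1 h₁ h₂

theorem AbsF.pair (h₁ : AbsF t₁) (h₂ : AbsF t₂) : AbsF fun v => ZFSet.pair (t₁ v) (t₂ v) :=
  ((h₁.upair h₁).upair (h₁.upair h₂)).congr fun v => by
    simp [ZFSet.pair]

theorem AbsF.union (h₁ : AbsF t₁) (h₂ : AbsF t₂) : AbsF fun v => t₁ v ∪ t₂ v :=
  (h₁.upair h₂).sUnion

theorem absF_empty : AbsF fun _ : Fin n → ZFSet.{u} => (∅ : ZFSet) := by
  have h1 : Abs fun w : Fin (n + 1) → ZFSet.{u} => ∀ z ∈ w 0, ¬ z = z :=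
    (absF_var 0).all (Q := fun z _ => ¬ z = z) (abs_eq_var 0 0).not
  refine h1.congr fun w => ?_
  rw [ZFSet.eq_empty]
  simp

/-- The quantifier in `fst` is unbounded, but the missing component lies in the union of the pair,
so it can be bounded without changing the value. -/
theorem AbsF.fst (ht : AbsF t) : AbsF fun v => fst (t v) := by
  have h1 : AbsF fun v : Fin 1 → ZFSet.{u} => ExtRadin.fst (v 0) :=
    ((absF_var 0).sUnion.sep (Q := fun x v => ∃ y ∈ (⋃₀ v 0 : ZFSet), v 0 = ZFSet.pair x y)
      ((absF_var 1).sUnion.ex (Q := fun y v => v 1 = ZFSet.pair (v 0) y)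
        ((absF_var 2).eq ((absF_var 1).pair (absF_var 0))))).sUnion.congr fun v => by
          unfold ExtRadin.fst
          congr 2
          ext x
          constructor
          · rintro ⟨y, -, h⟩; exact ⟨y, h⟩
          · rintro ⟨y, h⟩
            exact ⟨y, by rw [h, ZFSet.pair, ZFSet.sUnion_pair]; simp, h⟩
  exact AbsF.comp₁ (g := ExtRadin.fst) h1 ht

theorem AbsF.snd (ht : AbsF t) : AbsF fun v => snd (t v) := by
  have h1 : AbsF fun v : Fin 1 → ZFSet.{u} => ExtRadin.snd (v 0) :=
    ((absF_var 0).sUnion.sep (Q := fun y v => ∃ x ∈ (⋃₀ v 0 : ZFSet), v 0 = ZFSet.pair x y)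
      ((absF_var 1).sUnion.ex (Q := fun x v => v 1 = ZFSet.pair x (v 0))
        ((absF_var 2).eq ((absF_var 0).pair (absF_var 1))))).sUnion.congr fun v => by
          unfold ExtRadin.snd
          congr 2
          ext x
          constructor
          · rintro ⟨y, -, h⟩; exact ⟨y, h⟩
          · rintro ⟨y, h⟩
            exact ⟨y, by rw [h, ZFSet.pair, ZFSet.sUnion_pair]; simp, h⟩
  exact AbsF.comp₁ (g := ExtRadin.snd) h1 ht

theorem AbsF.app (h₁ : AbsF t₁) (h₂ : AbsF t₂) : AbsF fun v => app (t₁ v) (t₂ v) :=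
  (h₁.sUnion.sUnion.sep (Q := fun y v => ZFSet.pair (t₂ v) y ∈ t₁ v)
    ((h₂.weaken.pair (absF_var 0)).mem h₁.weaken)).sUnion

end comp

/-! ### Values of functions and components of pairs -/

@[simp] theorem fst_pair (x y : ZFSet.{u}) : fst (ZFSet.pair x y) = x := by
  have : ZFSet.sep (fun x' => ∃ y', ZFSet.pair x y = ZFSet.pair x' y')
      (⋃₀ ZFSet.pair x y : ZFSet) = {x} := by
    ext z
    rw [ZFSet.mem_sep, ZFSet.mem_singleton, ZFSet.pair, ZFSet.sUnion_pair]
    constructor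
    · rintro ⟨-, y', h⟩; exact (ZFSet.pair_injective h).1.symm
    · rintro rfl; exact ⟨by simp, y, rfl⟩
  rw [fst, this, ZFSet.sUnion_singleton]

@[simp] theorem snd_pair (x y : ZFSet.{u}) : snd (ZFSet.pair x y) = y := by
  have : ZFSet.sep (fun y' => ∃ x', ZFSet.pair x y = ZFSet.pair x' y')
      (⋃₀ ZFSet.pair x y : ZFSet) = {y} := by
    ext z
    rw [ZFSet.mem_sep, ZFSet.mem_singleton, ZFSet.pair, ZFSet.sUnion_pair]
    constructor
    · rintro ⟨-, y', h⟩; exact (ZFSet.pair_injective h).2.symm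
    · rintro rfl; exact ⟨by simp, x, rfl⟩
  rw [snd, this, ZFSet.sUnion_singleton]

theorem mem_graphOn {D z : ZFSet.{u}} {g : ZFSet.{u} → ZFSet.{u}} :
    z ∈ graphOn D g ↔ ∃ x ∈ D, z = ZFSet.pair x (g x) := by
  unfold graphOn
  rw [@ZFSet.mem_image _ (Classical.allZFSetDefinable _)]
  simp [eq_comm]

theorem pair_mem_graphOn {D x y : ZFSet.{u}} {g : ZFSet.{u} → ZFSet.{u}} :
    ZFSet.pair x y ∈ graphOn D g ↔ x ∈ D ∧ y = g x := by
  rw [mem_graphOn]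
  constructor
  · rintro ⟨x', h, h'⟩
    obtain ⟨rfl, rfl⟩ := ZFSet.pair_injective h'
    exact ⟨h, rfl⟩
  · rintro ⟨h, rfl⟩; exact ⟨x, h, rfl⟩

theorem app_eq {f x y : ZFSet.{u}} (h : ∀ z, ZFSet.pair x z ∈ f ↔ z = y) : app f x = y := by
  have : ZFSet.sep (fun y => ZFSet.pair x y ∈ f) (⋃₀ (⋃₀ f : ZFSet)) = {y} := by
    ext z
    rw [ZFSet.mem_sep, ZFSet.mem_singleton, h]
    refine ⟨fun h => h.2, fun hz => ⟨?_, hz⟩⟩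
    have hp := (h z).2 hz
    refine ZFSet.mem_sUnion_of_mem (y := z) (z := {x, z}) (by simp)
      (ZFSet.mem_sUnion_of_mem ?_ hp)
    simp [ZFSet.pair]
  rw [app, this, ZFSet.sUnion_singleton]

theorem app_eq_empty {f x : ZFSet.{u}} (h : ∀ z, ZFSet.pair x z ∉ f) : app f x = ∅ := by
  have : ZFSet.sep (fun y => ZFSet.pair x y ∈ f) (⋃₀ (⋃₀ f : ZFSet)) = ∅ := by
    rw [ZFSet.eq_empty]
    intro z hz
    exact h z (ZFSet.mem_sep.1 hz).2
  rw [app, this, ZFSet.sUnion_empty]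

theorem app_graphOn {D x : ZFSet.{u}} {g : ZFSet.{u} → ZFSet.{u}} (h : x ∈ D) :
    app (graphOn D g) x = g x :=
  app_eq fun z => by rw [pair_mem_graphOn]; simp [h]

/-! ### Elementarity -/

section j

variable (e : InnerEmb.{u})

theorem Abs.j₁ {R : ZFSet.{u} → Prop} (h : Abs fun v : Fin 1 → ZFSet.{u} => R (v 0))
    (x : ZFSet.{u}) : R (e.j x) ↔ R x := h.j_iff e ![x]

theorem Abs.j₂ {R : ZFSet.{u} → ZFSet.{u} → Prop}
    (h : Abs fun v : Fin 2 → ZFSet.{u} => R (v 0) (v 1)) (x y : ZFSet.{u}) :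
    R (e.j x) (e.j y) ↔ R x y := h.j_iff e ![x, y]

theorem Abs.j₃ {R : ZFSet.{u} → ZFSet.{u} → ZFSet.{u} → Prop}
    (h : Abs fun v : Fin 3 → ZFSet.{u} => R (v 0) (v 1) (v 2)) (x y z : ZFSet.{u}) :
    R (e.j x) (e.j y) (e.j z) ↔ R x y z := h.j_iff e ![x, y, z]

theorem Abs.j₄ {R : ZFSet.{u} → ZFSet.{u} → ZFSet.{u} → ZFSet.{u} → Prop}
    (h : Abs fun v : Fin 4 → ZFSet.{u} => R (v 0) (v 1) (v 2) (v 3)) (x y z w : ZFSet.{u}) :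
    R (e.j x) (e.j y) (e.j z) (e.j w) ↔ R x y z w := h.j_iff e ![x, y, z, w]

theorem j_mem {x y : ZFSet.{u}} : e.j x ∈ e.j y ↔ x ∈ y :=
  Abs.j₂ e (R := fun x y => x ∈ y) (abs_mem_var 0 1) x y

theorem j_empty : e.j ∅ = ∅ :=
  AbsF.j_eq (n := 0) absF_empty e Fin.elim0

theorem j_pair (x y : ZFSet.{u}) : e.j (ZFSet.pair x y) = ZFSet.pair (e.j x) (e.j y) :=
  AbsF.j_eq (g := fun v : Fin 2 → ZFSet.{u} => ZFSet.pair (v 0) (v 1))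
    ((absF_var 0).pair (absF_var 1)) e ![x, y]

theorem j_app (x y : ZFSet.{u}) : e.j (app x y) = app (e.j x) (e.j y) :=
  AbsF.j_eq (g := fun v : Fin 2 → ZFSet.{u} => app (v 0) (v 1))
    ((absF_var 0).app (absF_var 1)) e ![x, y]

theorem j_subset {x y : ZFSet.{u}} : e.j x ⊆ e.j y ↔ x ⊆ y :=
  Abs.j₂ e (R := fun x y => x ⊆ y) ((absF_var 0).subset (absF_var 1)) x y

/-- Łoś's theorem, for absolute predicates. -/
theorem j_sep {n : ℕ} {Q : ZFSet.{u} → (Fin n → ZFSet.{u}) → Prop}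
    (h : Abs fun w : Fin (n + 1) → ZFSet.{u} => Q (w 0) fun i => w i.succ) (D : ZFSet.{u})
    (v : Fin n → ZFSet.{u}) :
    e.j (ZFSet.sep (fun z => Q z v) D) = ZFSet.sep (fun z => Q z fun i => e.j (v i)) (e.j D) :=
  AbsF.j_eq (g := fun w : Fin (n + 1) → ZFSet.{u} =>
      ZFSet.sep (fun z => Q z fun i => w i.succ) (w 0))
    ((absF_var 0).sep (Q := fun z w => Q z fun i => w i.succ) (Abs.weaken₁ h)) e
    (Fin.cons D v)

theorem j_mem_M (x : ZFSet.{u}) : e.j x ∈ e.M := (e.emb x).2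

end j

theorem abs_isOrdinal {n : ℕ} {t : (Fin n → ZFSet.{u}) → ZFSet.{u}} (ht : AbsF t) :
    Abs fun v => (t v).IsOrdinal := by
  have h1 : Abs fun v : Fin 1 → ZFSet.{u} => (v 0).IsOrdinal := by
    have h : Abs fun v : Fin 1 → ZFSet.{u} =>
        (∀ z ∈ v 0, z ⊆ v 0) ∧ ∀ z ∈ v 0, ∀ y ∈ z, y ⊆ z :=
      ((absF_var 0).all (Q := fun z v => z ⊆ v 0) ((absF_var 0).subset (absF_var 1))).and
        ((absF_var 0).all (Q := fun z v => ∀ y ∈ z, y ⊆ z)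
          ((absF_var 0).all (Q := fun y v => y ⊆ v 0) ((absF_var 0).subset (absF_var 1))))
    exact h.congr fun v => isOrdinal_iff_forall_mem_isTransitive.symm
  exact Abs.comp₁ (R := fun x => x.IsOrdinal) h1 ht

/-! ### The critical point belongs to its image. -/

section crit

variable {e : InnerEmb.{u}} {κ : Ordinal.{u}} (he : e.IsCrit κ)
include he

/-- The image of `κ` is an ordinal which contains every `a = j(a)` with `a < κ` and which differs
from `κ`. -/
theorem InnerEmb.IsCrit.mem_j : κ.toZFSet ∈ e.j κ.toZFSet := by
  have ho : (e.j κ.toZFSet).IsOrdinal :=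
    (Abs.j₁ e (R := fun x => x.IsOrdinal) (abs_isOrdinal (absF_var 0)) _).2 (isOrdinal_toZFSet κ)
  have hs : κ.toZFSet ⊆ e.j κ.toZFSet := by
    intro x hx
    obtain ⟨a, ha, rfl⟩ := mem_toZFSet_iff.1 hx
    rw [← he.1 a ha]
    exact (j_mem e).2 hx
  rcases ((isOrdinal_toZFSet κ).subset_iff_eq_or_mem ho).1 hs with h | h
  · exact absurd h.symm he.2
  · exact h

end crit

/-! ### Codes of extender sequences -/

@[simp] theorem fst_code (x : ESeq.{u}) : fst x.code = x.c.toZFSet := by simp [ESeq.code]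
@[simp] theorem fst_snd_code (x : ESeq.{u}) : fst (snd x.code) = x.a.toZFSet := by
  simp [ESeq.code]
@[simp] theorem snd_snd_code (x : ESeq.{u}) : snd (snd x.code) = x.d := by simp [ESeq.code]

theorem code_injective : Function.Injective ESeq.code.{u} := by
  intro x y h
  have h1 := congrArg fst h
  have h2 := congrArg (fun z => fst (snd z)) h
  have h3 := congrArg (fun z => snd (snd z)) h
  simp only [fst_code, fst_snd_code, snd_snd_code] at h1 h2 h3
  exact ESeq.ext (toZFSet_injective h1) (toZFSet_injective h2) h3

theorem rank_lt_pair_left (x y : ZFSet.{u}) : x.rank < (ZFSet.pair x y).rank :=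
  (rank_lt_of_mem (x := {x}) (y := x) (by simp)).trans (rank_lt_of_mem (by simp [ZFSet.pair]))

theorem rank_lt_pair_right (x y : ZFSet.{u}) : y.rank < (ZFSet.pair x y).rank :=
  (rank_lt_of_mem (x := {x, y}) (y := y) (by simp)).trans (rank_lt_of_mem (by simp [ZFSet.pair]))

theorem c_lt_of_code {x : ESeq.{u}} {c : Ordinal.{u}} (h : x.code ∈ V_ c) : x.c < c := by
  have := rank_lt_pair_left x.c.toZFSet (ZFSet.pair x.a.toZFSet x.d)
  rw [rank_toZFSet] at this
  exact this.trans (mem_vonNeumann.1 h)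

theorem a_lt_of_code {x : ESeq.{u}} {c : Ordinal.{u}} (h : x.code ∈ V_ c) : x.a < c := by
  have h1 := rank_lt_pair_right x.c.toZFSet (ZFSet.pair x.a.toZFSet x.d)
  have h2 := rank_lt_pair_left x.a.toZFSet x.d
  rw [rank_toZFSet] at h2
  exact (h2.trans h1).trans (mem_vonNeumann.1 h)

theorem onCodes_code (g : ESeq.{u} → ZFSet.{u}) (x : ESeq.{u}) : onCodes g x.code = g x := by
  have h : ∃ y : ESeq.{u}, y.code = x.code := ⟨x, rfl⟩
  rw [onCodes, dif_pos h, code_injective h.choose_spec]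

theorem onCodes_of_not {g : ESeq.{u} → ZFSet.{u}} {z : ZFSet.{u}} (h : ¬ ∃ x : ESeq.{u}, x.code = z) :
    onCodes g z = ∅ := dif_neg h

theorem mem_codes {c : Ordinal.{u}} {T : Set ESeq.{u}} {z : ZFSet.{u}} :
    z ∈ codes c T ↔ z ∈ V_ c ∧ ∃ x ∈ T, x.code = z := ZFSet.mem_sep

theorem len_empty : len (∅ : ZFSet.{u}) = 0 := by
  have : (0 : Ordinal.{u}) ∈ {l : Ordinal.{u} | IsFun ∅ l.toZFSet} := by
    change (∅ : ZFSet) = graphOn _ _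
    symm
    rw [ZFSet.eq_empty]
    intro y hy
    rw [mem_graphOn] at hy
    obtain ⟨x, hx, -⟩ := hy
    simp at hx
  exact le_antisymm (csInf_le' this) (zero_le)

theorem ESeq.IsExt.d_eq {x : ESeq.{u}} (h : x.IsExt) : len x.d = 0 ↔ x.d = ∅ := by
  refine ⟨fun h0 => ?_, fun h0 => by rw [h0, len_empty]⟩
  rcases h.2.2 with h1 | h1
  · exact h1.1
  · exact absurd h0 h1.pos.ne'

theorem restr_zero (d : ZFSet.{u}) : restr d 0 = ∅ := by
  rw [restr, ZFSet.eq_empty]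
  intro y hy
  rw [mem_graphOn] at hy
  obtain ⟨x, hx, -⟩ := hy
  simp at hx

theorem restr_ne_empty {d : ZFSet.{u}} {τ : Ordinal.{u}} (h : 0 < τ) : restr d τ ≠ ∅ := by
  intro h0
  have : ZFSet.pair (toZFSet 0) (app d (toZFSet 0)) ∈ restr d τ :=
    pair_mem_graphOn.2 ⟨toZFSet_mem_toZFSet_iff.2 h, rfl⟩
  rw [h0] at this
  exact ZFSet.notMem_empty _ this

/-! ### The measures of an extender sequence system -/

theorem IsSystem.isUlt {κ : Ordinal.{u}} {d : ZFSet.{u}} (h : IsSystem κ d) :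
    IsUlt κ d (Set.Iio (len d)) (ultE κ d) :=
  Classical.epsilon_spec h.ult_limit

theorem IsSystem.isUltAt {κ : Ordinal.{u}} {d : ZFSet.{u}} (h : IsSystem κ d) {τ : Ordinal.{u}}
    (hτ : τ < len d) : IsUlt κ d {τ} (ultAt κ d τ) :=
  Classical.epsilon_spec (h.ult_at τ hτ)

/-- `X` belongs to all the measures `F_α(τ)`, `τ < l`. -/
def Big (κ : Ordinal.{u}) (d : ZFSet.{u}) (α : Ordinal.{u}) (X : ZFSet.{u}) : Prop :=
  ∀ τ < len d, xpt κ d α τ ∈ (ultE κ d).j X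

section big

variable {κ : Ordinal.{u}} {d : ZFSet.{u}} {α : Ordinal.{u}}

@[simp] theorem fst_xpt (τ : Ordinal.{u}) : fst (xpt κ d α τ) = κ.toZFSet := fst_code _
@[simp] theorem fst_snd_xpt (τ : Ordinal.{u}) : fst (snd (xpt κ d α τ)) = α.toZFSet :=
  fst_snd_code _
@[simp] theorem snd_snd_xpt (τ : Ordinal.{u}) : snd (snd (xpt κ d α τ)) = restr d τ :=
  snd_snd_code _

theorem Big.mono {X Y : ZFSet.{u}} (h : Big κ d α X) (hXY : X ⊆ Y) : Big κ d α Y :=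
  fun τ hτ => (j_subset _).2 hXY (h τ hτ)

theorem Big.inter {X Y : ZFSet.{u}} (h : Big κ d α X) (h' : Big κ d α Y) :
    Big κ d α (ZFSet.sep (· ∈ Y) X) := by
  intro τ hτ
  have := j_sep (ultE κ d) (Q := fun z (v : Fin 1 → ZFSet.{u}) => z ∈ v 0) (abs_mem_var 0 1) X ![Y]
  change (ultE κ d).j (ZFSet.sep (· ∈ Y) X) = _ at this
  rw [this, ZFSet.mem_sep]
  exact ⟨h τ hτ, h' τ hτ⟩

variable (hS : IsSystem κ d) (hα : κ ≤ α) (hα' : α < cs 3 κ)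
include hS hα hα'

theorem big_univ : Big κ d α (V_ κ) := fun τ hτ => (hS.isUlt.2.1 τ hτ α hα hα').1

theorem mem_meas_iff {X : ZFSet.{u}} (hX : X ⊆ V_ κ) :
    (∀ τ < len d, X ∈ meas d τ α) ↔ Big κ d α X :=
  forall₂_congr fun τ hτ => by rw [(hS.isUlt.2.1 τ hτ α hα hα').2]; exact and_iff_right hX

/-- The working form of Łoś's theorem: a set given by an absolute predicate has measure one if the
points `E_α ↾ τ` satisfy that predicate, with the parameters moved by `j_E`. -/
theorem big_sep {n : ℕ} {Q : ZFSet.{u} → (Fin n → ZFSet.{u}) → Prop}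
    (h : Abs fun w : Fin (n + 1) → ZFSet.{u} => Q (w 0) fun i => w i.succ)
    (v : Fin n → ZFSet.{u})
    (hQ : ∀ τ < len d, Q (xpt κ d α τ) fun i => (ultE κ d).j (v i)) :
    Big κ d α (ZFSet.sep (fun z => Q z v) (V_ κ)) := by
  intro τ hτ
  rw [j_sep _ h, ZFSet.mem_sep]
  exact ⟨big_univ hS hα hα' τ hτ, hQ τ hτ⟩

omit hα hα' in
theorem j_ord {a : Ordinal.{u}} (ha : a < κ) : (ultE κ d).j a.toZFSet = a.toZFSet :=
  hS.isUlt.1.1 a ha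

/-- Diagonal intersections. -/
theorem big_diag {X : Ordinal.{u} → ZFSet.{u}} (hX : ∀ i < κ, Big κ d α (X i)) :
    Big κ d α (ZFSet.sep (fun z => ∀ i < κ, i.toZFSet ∈ fst z → z ∈ X i) (V_ κ)) := by
  have h := big_sep hS hα hα' (Q := fun z (v : Fin 1 → ZFSet.{u}) => ∀ i ∈ fst z, z ∈ app (v 0) i)
    ((absF_var 0).fst.all (Q := fun i w => w 0 ∈ app (w 1) i)
      ((absF_var 1).mem ((absF_var 2).app (absF_var 0))))
    ![graphOn κ.toZFSet fun i => X i.rank] ?_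
  · refine h.mono fun z hz => ?_
    rw [ZFSet.mem_sep] at hz ⊢
    refine ⟨hz.1, fun i hi hiz => ?_⟩
    have := hz.2 _ hiz
    change z ∈ app (graphOn κ.toZFSet fun i => X i.rank) _ at this
    rwa [app_graphOn (toZFSet_mem_toZFSet_iff.2 hi), rank_toZFSet] at this
  · intro τ hτ i hi
    rw [fst_xpt] at hi
    obtain ⟨a, ha, rfl⟩ := mem_toZFSet_iff.1 hi
    change _ ∈ app ((ultE κ d).j (graphOn κ.toZFSet fun i => X i.rank)) _
    -- Indices below `κ` are fixed by `j_E`, so the entry at such an index of the image sequence is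
    -- the image of the original entry.
    rw [← j_ord hS ha, ← j_app, app_graphOn (toZFSet_mem_toZFSet_iff.2 ha), rank_toZFSet]
    exact hX a ha τ hτ

theorem big_gt {δ : Ordinal.{u}} (hδ : δ < κ) :
    Big κ d α (ZFSet.sep (fun z => δ.toZFSet ∈ fst z) (V_ κ)) :=
  big_sep hS hα hα' (Q := fun z (v : Fin 1 → ZFSet.{u}) => v 0 ∈ fst z)
    ((absF_var 1).mem (absF_var 0).fst) ![δ.toZFSet] fun τ _ => by
      change (ultE κ d).j δ.toZFSet ∈ _
      rw [fst_xpt, j_ord hS hδ, toZFSet_mem_toZFSet_iff]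
      exact hδ

theorem big_ord : Big κ d α (ZFSet.sep (fun z => ∃ c < κ, fst z = c.toZFSet) (V_ κ)) := by
  refine (big_sep hS hα hα' (Q := fun z (v : Fin 1 → ZFSet.{u}) => fst z ∈ v 0)
    ((absF_var 0).fst.mem (absF_var 1)) ![κ.toZFSet] fun τ _ => ?_).mono fun z hz => ?_
  · rw [fst_xpt]
    exact hS.isUlt.1.mem_j
  · rw [ZFSet.mem_sep] at hz ⊢
    obtain ⟨c, hc, h⟩ := mem_toZFSet_iff.1 hz.2
    exact ⟨hz.1, c, hc, h.symm⟩

omit hα hα' in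
theorem Big.exists_mem {X : ZFSet.{u}} (h : Big κ d α X) : ∃ x, x ∈ X := by
  by_contra hc
  push Not at hc
  have := h 0 hS.pos
  rw [(ZFSet.eq_empty X).2 hc, j_empty] at this
  exact ZFSet.notMem_empty _ this

end big

/-! ### Regularity of the critical point of a system. -/

section regular

variable {κ : Ordinal.{u}} {d : ZFSet.{u}} (hS : IsSystem κ d)
include hS

omit hS in
theorem lt_cs_three (κ : Ordinal.{u}) : κ < cs 3 κ := by
  rw [cs, Cardinal.lt_ord]
  simp only [Function.iterate_succ, Function.iterate_zero, Function.comp, id]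
  exact (Order.lt_succ _).trans ((Order.lt_succ _).trans (Order.lt_succ _))

/-- Regularity of the critical point. -/
theorem IsSystem.exists_bound {δ : Ordinal.{u}} (hδ : δ < κ) (g : Ordinal.{u} → Ordinal.{u})
    (hg : ∀ i < δ, g i < κ) : ∃ η < κ, δ < η ∧ ∀ i < δ, g i < η := by
  -- The bound is `κ⁰` of any point of this diagonal intersection: it exceeds `δ`, so the diagonal
  -- condition makes it exceed every `g i` with `i < δ`.
  have h := (big_diag hS le_rfl (lt_cs_three κ) (X := fun i =>
    ZFSet.sep (fun z => (if i < δ then g i else 0).toZFSet ∈ fst z) (V_ κ)) fun i hi =>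
      big_gt hS le_rfl (lt_cs_three κ) (by
        split_ifs with h
        · exact hg i h
        · exact (zero_le).trans_lt hδ)).inter
    ((big_gt hS le_rfl (lt_cs_three κ) hδ).inter (big_ord hS le_rfl (lt_cs_three κ)))
  obtain ⟨z, hz⟩ := h.exists_mem hS
  simp only [ZFSet.mem_sep] at hz
  obtain ⟨⟨-, h1⟩, ⟨-, h2⟩, -, η, hη, h3⟩ := hz
  rw [h3, toZFSet_mem_toZFSet_iff] at h2
  refine ⟨η, hη, h2, fun i hi => ?_⟩
  have := (h1 i (hi.trans hδ) (by rw [h3, toZFSet_mem_toZFSet_iff]; exact hi.trans h2)).2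
  rwa [if_pos hi, h3, toZFSet_mem_toZFSet_iff] at this

theorem IsSystem.crit_pos : 0 < κ := by
  obtain ⟨z, hz⟩ := (big_univ hS le_rfl (lt_cs_three κ)).exists_mem hS
  exact (zero_le).trans_lt (mem_vonNeumann.1 hz)

theorem IsSystem.succ_lt {δ : Ordinal.{u}} (hδ : δ < κ) : Order.succ δ < κ := by
  obtain ⟨η, h1, h2, -⟩ := hS.exists_bound hδ (fun _ => 0) fun _ _ => hS.crit_pos
  exact (Order.succ_le_of_lt h2).trans_lt h1

theorem IsSystem.omega_le : ω ≤ κ := by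
  rw [Ordinal.omega0_le]
  intro n
  have : (n : Ordinal.{u}) < κ := by
    induction n with
    | zero => exact_mod_cast hS.crit_pos
    | succ n ih =>
      have := hS.succ_lt ih
      rwa [Order.succ_eq_add_one] at this
  exact this.le

theorem IsSystem.aleph0_le : ℵ₀ ≤ κ.card := by
  simpa using Ordinal.card_le_card hS.omega_le

theorem IsSystem.exists_bound_list (l : List Ordinal.{u}) (h : ∀ x ∈ l, x < κ) :
    ∃ η < κ, ∀ x ∈ l, x < η := by
  induction l with
  | nil => exact ⟨0, hS.crit_pos, by simp⟩
  | cons a l ih =>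
    obtain ⟨η, h1, h2⟩ := ih fun x hx => h x (List.mem_cons_of_mem _ hx)
    refine ⟨max η (Order.succ a), max_lt h1 (hS.succ_lt (h a List.mem_cons_self)), fun x hx => ?_⟩
    rcases List.mem_cons.1 hx with rfl | hx
    · exact lt_max_of_lt_right (Order.lt_succ x)
    · exact lt_max_of_lt_left (h2 x hx)

/-- The bound for `δ` is pulled back along an injection of `A` into `δ`; off the range of the
injection the auxiliary function takes the default value `0`. -/
theorem IsSystem.exists_bound_set {A : Set Ordinal.{u}} {δ : Ordinal.{u}} (hδ : δ < κ)
    (hA : #A ≤ Cardinal.lift.{u + 1} δ.card) (g : Ordinal.{u} → Ordinal.{u})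
    (hg : ∀ i ∈ A, g i < κ) : ∃ η < κ, ∀ i ∈ A, g i < η := by
  classical
  have h0 : #A ≤ #(Set.Iio δ) := by rwa [Cardinal.mk_Iio_ordinal]
  obtain ⟨f⟩ := h0
  let k : Ordinal.{u} → Ordinal.{u} := fun i => if h : ∃ a : A, (f a : Ordinal) = i then g h.choose else 0
  obtain ⟨η, h1, -, h2⟩ := hS.exists_bound hδ k fun i _ => by
    dsimp only [k]
    split_ifs with h
    · exact hg _ h.choose.2
    · exact hS.crit_pos
  refine ⟨η, h1, fun i hi => ?_⟩
  have h3 : ∃ a : A, (f a : Ordinal) = f ⟨i, hi⟩ := ⟨_, rfl⟩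
  have h4 := h2 (f ⟨i, hi⟩) (f ⟨i, hi⟩).2
  simp only [k, dif_pos h3] at h4
  have h5 : h3.choose = ⟨i, hi⟩ := f.injective (Subtype.ext h3.choose_spec)
  rwa [h5] at h4

end regular

/-! ### Seven-tuples -/

/-- The coordinates of a seven-tuple. -/
noncomputable def crd (r : ZFSet.{u}) : Fin 7 → ZFSet.{u} :=
  ![fst r, fst (snd r), fst (snd (snd r)), fst (snd (snd (snd r))), fst (snd (snd (snd (snd r)))),
    fst (snd (snd (snd (snd (snd r))))), snd (snd (snd (snd (snd (snd r)))))]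

@[simp] theorem crd_tup (x : Fin 7 → ZFSet.{u}) : crd (tup x) = x := by
  funext i
  fin_cases i <;> simp [crd, tup]

theorem rle_iff {r s : ZFSet.{u}} :
    rle r s ↔ r = tup (crd r) ∧ s = tup (crd s) ∧ ∀ i, crd s i ⊆ crd r i := by
  constructor
  · rintro ⟨x, y, rfl, rfl, h⟩
    simpa using h
  · rintro ⟨h, h', h''⟩
    exact ⟨_, _, h, h', h''⟩

theorem rle.trans {r s t : ZFSet.{u}} (h : rle r s) (h' : rle s t) : rle r t := by
  rw [rle_iff] at *
  exact ⟨h.1, h'.2.1, fun i => (h'.2.2 i).trans (h.2.2 i)⟩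

theorem mem_tupProd {X : Fin 7 → ZFSet.{u}} {r : ZFSet.{u}} :
    r ∈ tupProd X ↔ r = tup (crd r) ∧ ∀ i, crd r i ∈ X i := by
  constructor
  · intro h
    simp only [tupProd, ZFSet.mem_prod] at h
    obtain ⟨a0, h0, _, ⟨a1, h1, _, ⟨a2, h2, _, ⟨a3, h3, _, ⟨a4, h4, _, ⟨a5, h5, a6, h6, rfl⟩, rfl⟩,
      rfl⟩, rfl⟩, rfl⟩, rfl⟩ := h
    have : ZFSet.pair a0 (ZFSet.pair a1 (ZFSet.pair a2 (ZFSet.pair a3 (ZFSet.pair a4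
        (ZFSet.pair a5 a6))))) = tup ![a0, a1, a2, a3, a4, a5, a6] := rfl
    rw [this, crd_tup]
    refine ⟨rfl, fun i => ?_⟩
    fin_cases i <;> assumption
  · rintro ⟨h, h'⟩
    rw [h]
    simp only [tupProd, tup, ZFSet.pair_mem_prod]
    exact ⟨h' 0, h' 1, h' 2, h' 3, h' 4, h' 5, h' 6⟩

theorem colField_eq (r : ZFSet.{u}) : colField r = (⋃₀ (⋃₀ crd r 6 : ZFSet) : ZFSet) := rfl

/-- The coordinatewise union. -/
noncomputable def join (r s : ZFSet.{u}) : ZFSet.{u} := tup fun i => crd r i ∪ crd s i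

/-- Replace the part `g` of the condition `r` by `h`. -/
noncomputable def modf (g h r : ZFSet.{u}) : ZFSet.{u} := tup fun i => (crd r i \ crd g i) ∪ crd h i

/-! ### Partial functions -/

/-- The set `u` is single-valued. -/
def Func (u : ZFSet.{u}) : Prop := ∀ x y z, ZFSet.pair x y ∈ u → ZFSet.pair x z ∈ u → y = z

/-- The sets `u` and `v` have the same domain. -/
def SameDom (u v : ZFSet.{u}) : Prop := ∀ x, (∃ y, ZFSet.pair x y ∈ u) ↔ ∃ y, ZFSet.pair x y ∈ v

theorem SameDom.symm {u v : ZFSet.{u}} (h : SameDom u v) : SameDom v u := fun x => (h x).symm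

theorem mem_partialFns {δ : Ordinal.{u}} {X Y p : ZFSet.{u}} :
    p ∈ partialFns δ X Y ↔ p ⊆ ZFSet.prod X Y ∧ p.card < δ.card ∧ Func p := by
  rw [partialFns, ZFSet.mem_sep, ZFSet.mem_powerset]
  rfl

theorem func_empty : Func (∅ : ZFSet.{u}) := fun _ _ _ h => absurd h (ZFSet.notMem_empty _)

/-- A set of partial functions of bounded size, or the trivial poset. -/
def PF (C : ZFSet.{u}) : Prop :=
  C = {∅} ∨ ∃ δ X Y, ℵ₀ ≤ δ.card ∧ (∃ y, y ∈ Y) ∧ C = partialFns δ X Y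

theorem PF.func {C u : ZFSet.{u}} (hC : PF C) (h : u ∈ C) : Func u := by
  rcases hC with rfl | ⟨δ, X, Y, -, -, rfl⟩
  · rw [ZFSet.mem_singleton.1 h]; exact func_empty
  · exact (mem_partialFns.1 h).2.2

theorem PF.pairs {C u z : ZFSet.{u}} (hC : PF C) (h : u ∈ C) (hz : z ∈ u) :
    ∃ x y, z = ZFSet.pair x y := by
  rcases hC with rfl | ⟨δ, X, Y, -, -, rfl⟩
  · rw [ZFSet.mem_singleton.1 h] at hz; exact absurd hz (ZFSet.notMem_empty _)
  · obtain ⟨x, -, y, -, h⟩ := ZFSet.mem_prod.1 ((mem_partialFns.1 h).1 hz)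
    exact ⟨x, y, h⟩

theorem PF.union {C u v : ZFSet.{u}} (hC : PF C) (hu : u ∈ C) (hv : v ∈ C) (h : Func (u ∪ v)) :
    u ∪ v ∈ C := by
  rcases hC with rfl | ⟨δ, X, Y, h1, -, rfl⟩
  · rw [ZFSet.mem_singleton] at *
    rw [hu, hv]
    ext; simp
  · rw [mem_partialFns] at *
    refine ⟨fun z hz => ?_, ZFSet.card_union_le.trans_lt (Cardinal.add_lt_of_lt h1 hu.2.1 hv.2.1), h⟩
    rcases ZFSet.mem_union.1 hz with hz | hz
    exacts [hu.1 hz, hv.1 hz]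

theorem PF.subset {C u v : ZFSet.{u}} (hC : PF C) (hu : u ∈ C) (h : v ⊆ u) : v ∈ C := by
  rcases hC with rfl | ⟨δ, X, Y, h1, -, rfl⟩
  · rw [ZFSet.mem_singleton] at *
    subst hu
    exact (ZFSet.eq_empty _).2 fun y hy => ZFSet.notMem_empty _ (h hy)
  · rw [mem_partialFns] at *
    exact ⟨h.trans hu.1, (ZFSet.card_mono h).trans_lt hu.2.1,
      fun x y z hy hz => hu.2.2 x y z (h hy) (h hz)⟩

theorem PF.diff_disjoint {C u g h z : ZFSet.{u}} (hC : PF C) (hu : u ∈ C) (hh : h ∈ C)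
    (hgu : g ⊆ u) (hd : SameDom g h) (hz : z ∈ u) (hz' : z ∉ g) : z ∉ h := by
  intro hzh
  obtain ⟨x, y, rfl⟩ := hC.pairs hh hzh
  obtain ⟨y', hy'⟩ := (hd x).2 ⟨y, hzh⟩
  have := hC.func hu x y y' hz (hgu hy')
  exact hz' (this ▸ hy')

/-- As `g ⊆ u` has the domain of `h`, the part `u \ g` avoids the domain of `h`, so the union is
single-valued. Its size is bounded since both pieces lie in `C`. -/
theorem PF.mod {C u g h : ZFSet.{u}} (hC : PF C) (hu : u ∈ C) (hh : h ∈ C)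
    (hgu : g ⊆ u) (hd : SameDom g h) : (u \ g) ∪ h ∈ C := by
  refine hC.union (hC.subset hu fun z hz => (ZFSet.mem_sdiff.1 hz).1) hh ?_
  intro x y z hy hz
  rw [ZFSet.mem_union, ZFSet.mem_sdiff] at hy hz
  rcases hy with hy | hy <;> rcases hz with hz | hz
  · exact hC.func hu x y z hy.1 hz.1
  · obtain ⟨y', hy'⟩ := (hd x).2 ⟨z, hz⟩
    have := hC.func hu x y y' hy.1 (hgu hy')
    exact absurd (this ▸ hy') hy.2
  · obtain ⟨y', hy'⟩ := (hd x).2 ⟨y, hy⟩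
    have := hC.func hu x z y' hz.1 (hgu hy')
    exact absurd (this ▸ hy') hz.2
  · exact hC.func hh x y z hy hz

/-- `u \ g` is disjoint from `h`, so removing `h` leaves exactly `u \ g`, and adding `g` restores
`u`. This makes the substitution invertible. -/
theorem PF.mod_mod {C u g h : ZFSet.{u}} (hC : PF C) (hu : u ∈ C) (hh : h ∈ C)
    (hgu : g ⊆ u) (hd : SameDom g h) : (((u \ g) ∪ h) \ h) ∪ g = u := by
  ext z
  simp only [ZFSet.mem_union, ZFSet.mem_sdiff]
  constructor
  · rintro (⟨⟨h1, -⟩ | h1, h2⟩ | h1)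
    · exact h1
    · exact absurd h1 h2
    · exact hgu h1
  · intro hz
    by_cases hzg : z ∈ g
    · exact Or.inr hzg
    · exact Or.inl ⟨Or.inl ⟨hz, hzg⟩, hC.diff_disjoint hu hh hgu hd hz hzg⟩

/-- The image of a set under a function. -/
noncomputable def img (f : ZFSet.{u} → ZFSet.{u}) (D : ZFSet.{u}) : ZFSet.{u} :=
  @ZFSet.image f (Classical.allZFSetDefinable _) D

theorem mem_img {f : ZFSet.{u} → ZFSet.{u}} {D z : ZFSet.{u}} :
    z ∈ img f D ↔ ∃ x ∈ D, f x = z := @ZFSet.mem_image _ (Classical.allZFSetDefinable _) _ _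

theorem card_img_le (f : ZFSet.{u} → ZFSet.{u}) (D : ZFSet.{u}) : (img f D).card ≤ D.card :=
  @ZFSet.card_image_le _ _ (Classical.allZFSetDefinable _)

/-- Extend `u` to the domain of `v` by the value `y`. -/
noncomputable def extendBy (y u v : ZFSet.{u}) : ZFSet.{u} :=
  u ∪ ZFSet.sep (fun z => ∀ w, ZFSet.pair (fst z) w ∉ u) (img (fun z => ZFSet.pair (fst z) y) v)

theorem mem_extendBy {y u v x w : ZFSet.{u}} (hv : ∀ z ∈ v, ∃ x y, z = ZFSet.pair x y) :
    ZFSet.pair x w ∈ extendBy y u v ↔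
      ZFSet.pair x w ∈ u ∨ w = y ∧ (∃ t, ZFSet.pair x t ∈ v) ∧ ∀ t, ZFSet.pair x t ∉ u := by
  rw [extendBy, ZFSet.mem_union, ZFSet.mem_sep, mem_img]
  refine or_congr_right ⟨?_, ?_⟩
  · rintro ⟨⟨z, hz, h⟩, h'⟩
    obtain ⟨a, b, rfl⟩ := hv z hz
    rw [fst_pair] at h h'
    obtain ⟨rfl, rfl⟩ := ZFSet.pair_injective h
    exact ⟨rfl, ⟨b, hz⟩, h'⟩
  · rintro ⟨rfl, ⟨t, ht⟩, h⟩
    exact ⟨⟨_, ht, by simp⟩, by simpa using h⟩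

theorem sameDom_extendBy {y y' u v : ZFSet.{u}} (hu : ∀ z ∈ u, ∃ x y, z = ZFSet.pair x y)
    (hv : ∀ z ∈ v, ∃ x y, z = ZFSet.pair x y) : SameDom (extendBy y u v) (extendBy y' v u) := by
  have key : ∀ {y u v : ZFSet.{u}}, (∀ z ∈ v, ∃ x y, z = ZFSet.pair x y) → ∀ x,
      (∃ w, ZFSet.pair x w ∈ extendBy y u v) ↔ (∃ w, ZFSet.pair x w ∈ u) ∨ ∃ w, ZFSet.pair x w ∈ v := by
    intro y u v hv x
    constructor
    · rintro ⟨w, hw⟩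
      rw [mem_extendBy hv] at hw
      rcases hw with hw | hw
      · exact Or.inl ⟨w, hw⟩
      · exact Or.inr hw.2.1
    · intro h
      by_cases hx : ∃ w, ZFSet.pair x w ∈ u
      · obtain ⟨w, hw⟩ := hx
        exact ⟨w, (mem_extendBy hv).2 (Or.inl hw)⟩
      · exact ⟨y, (mem_extendBy hv).2 (Or.inr ⟨rfl, h.resolve_left hx, fun t ht => hx ⟨t, ht⟩⟩)⟩
  intro x
  rw [key hv, key hu, or_comm]

theorem extendBy_mem {δ : Ordinal.{u}} {X Y y u v : ZFSet.{u}} (hδ : ℵ₀ ≤ δ.card) (hy : y ∈ Y)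
    (hu : u ∈ partialFns δ X Y) (hv : v ∈ partialFns δ X Y) :
    extendBy y u v ∈ partialFns δ X Y := by
  have hp : ∀ w ∈ partialFns δ X Y, ∀ z ∈ w, ∃ x y, z = ZFSet.pair x y := fun w hw z hz =>
    PF.pairs (Or.inr ⟨δ, X, Y, hδ, ⟨y, hy⟩, rfl⟩) hw hz
  have hvp := hp v hv
  rw [mem_partialFns] at *
  refine ⟨fun z hz => ?_, ?_, ?_⟩
  · rw [extendBy, ZFSet.mem_union, ZFSet.mem_sep, mem_img] at hz
    rcases hz with hz | ⟨⟨t, ht, rfl⟩, -⟩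
    · exact hu.1 hz
    · obtain ⟨a, ha, b, hb, rfl⟩ := ZFSet.mem_prod.1 (hv.1 ht)
      rw [fst_pair, ZFSet.pair_mem_prod]
      exact ⟨ha, hy⟩
  · refine ZFSet.card_union_le.trans_lt (Cardinal.add_lt_of_lt hδ hu.2.1 ?_)
    exact ((ZFSet.card_mono ZFSet.sep_subset).trans (card_img_le _ _)).trans_lt hv.2.1
  · intro a b c hb hc
    rw [mem_extendBy hvp] at hb hc
    rcases hb with hb | hb <;> rcases hc with hc | hc
    · exact hu.2.2 a b c hb hc
    · exact absurd hb (hc.2.2 b)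
    · exact absurd hc (hb.2.2 c)
    · rw [hb.1, hc.1]

theorem PF.exists_sameDom {C u v : ZFSet.{u}} (hC : PF C) (hu : u ∈ C) (hv : v ∈ C) :
    ∃ u' ∈ C, ∃ v' ∈ C, u ⊆ u' ∧ v ⊆ v' ∧ SameDom u' v' := by
  have hC' := hC
  rcases hC with rfl | ⟨δ, X, Y, h1, ⟨y, hy⟩, rfl⟩
  · refine ⟨u, hu, v, hv, subset_rfl, subset_rfl, ?_⟩
    rw [ZFSet.mem_singleton.1 hu, ZFSet.mem_singleton.1 hv]
    exact fun _ => Iff.rfl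
  · exact ⟨_, extendBy_mem h1 hy hu hv, _, extendBy_mem h1 hy hv hu,
      fun z hz => ZFSet.mem_union.2 (Or.inl hz), fun z hz => ZFSet.mem_union.2 (Or.inl hz),
      sameDom_extendBy (fun z hz => hC'.pairs hu hz) fun z hz => hC'.pairs hv hz⟩

theorem exists_injOn {X Y : ZFSet.{u}} (h : X.card ≤ Y.card) :
    ∃ k : ZFSet.{u} → ZFSet.{u}, (∀ x ∈ X, k x ∈ Y) ∧ ∀ x ∈ X, ∀ y ∈ X, k x = k y → x = y := by
  classical
  have h1 : #X ≤ #Y := by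
    rw [ZFSet.cardinalMk_coe_sort, ZFSet.cardinalMk_coe_sort]
    exact Cardinal.lift_le.2 h
  obtain ⟨f⟩ := h1
  refine ⟨fun x => if hx : x ∈ X then f ⟨x, hx⟩ else ∅, fun x hx => ?_, fun x hx y hy hxy => ?_⟩
  · simp only [dif_pos hx]; exact (f ⟨x, hx⟩).2
  · simp only [dif_pos hx, dif_pos hy] at hxy
    exact congrArg Subtype.val (f.injective (Subtype.ext hxy))

theorem mem_field {u z : ZFSet.{u}} (hu : ∀ z ∈ u, ∃ x y, z = ZFSet.pair x y) :
    z ∈ (⋃₀ (⋃₀ u : ZFSet) : ZFSet) ↔ ∃ x y, ZFSet.pair x y ∈ u ∧ (z = x ∨ z = y) := by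
  simp only [ZFSet.mem_sUnion]
  constructor
  · rintro ⟨w, ⟨t, ht, hw⟩, hz⟩
    obtain ⟨x, y, rfl⟩ := hu t ht
    refine ⟨x, y, ht, ?_⟩
    rcases ZFSet.mem_pair.1 hw with rfl | rfl
    · exact Or.inl (ZFSet.mem_singleton.1 hz)
    · exact ZFSet.mem_pair.1 hz
  · rintro ⟨x, y, h, hz⟩
    exact ⟨{x, y}, ⟨_, h, by simp [ZFSet.pair]⟩, ZFSet.mem_pair.2 hz⟩

/-- Equal domains do not suffice for a collapse, since the bound of a condition also depends on the
range. Every relevant value `x` is therefore attained at a fresh argument `k x`, in the same way on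
both sides; both ranges become `X`, and filling up the domains with the value `0` does not change
this. -/
theorem exists_sameDom_sameField {δ b : Ordinal.{u}} (hδ : ℵ₀ ≤ δ.card) (hb : 0 < b)
    {u v : ZFSet.{u}} (hu : u ∈ colForcing δ b) (hv : v ∈ colForcing δ b) :
    ∃ u' ∈ colForcing δ b, ∃ v' ∈ colForcing δ b, u ⊆ u' ∧ v ⊆ v' ∧ SameDom u' v' ∧
      (⋃₀ (⋃₀ u' : ZFSet) : ZFSet) = (⋃₀ (⋃₀ v' : ZFSet) : ZFSet) := by
  have h0 : (∅ : ZFSet) ∈ b.toZFSet := by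
    rw [← toZFSet_zero]; exact toZFSet_mem_toZFSet_iff.2 hb
  have hPF : PF (colForcing δ b) := Or.inr ⟨δ, _, _, hδ, ⟨_, h0⟩, rfl⟩
  have hu' := mem_partialFns.1 hu
  have hv' := mem_partialFns.1 hv
  -- All values that may occur in the end; `∅` is the filler used by `extendBy`.
  set X : ZFSet := img snd (u ∪ v) ∪ {∅}
  set D : ZFSet := img fst (u ∪ v)
  have huv : (u ∪ v).card < δ.card :=
    ZFSet.card_union_le.trans_lt (Cardinal.add_lt_of_lt hδ hu'.2.1 hv'.2.1)
  have hX : X.card < δ.card := by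
    refine ZFSet.card_union_le.trans_lt (Cardinal.add_lt_of_lt hδ ((card_img_le _ _).trans_lt huv) ?_)
    rw [ZFSet.card_singleton]
    exact Cardinal.one_lt_aleph0.trans_le hδ
  have huvp : ∀ z ∈ u ∪ v, z ∈ ZFSet.prod δ.toZFSet b.toZFSet := fun z hz => by
    rcases ZFSet.mem_union.1 hz with hz | hz
    exacts [hu'.1 hz, hv'.1 hz]
  have hXb : X ⊆ b.toZFSet := by
    intro x hx
    rcases ZFSet.mem_union.1 hx with hx | hx
    · obtain ⟨z, hz, rfl⟩ := mem_img.1 hx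
      obtain ⟨x, hx, y, hy, rfl⟩ := ZFSet.mem_prod.1 (huvp z hz)
      rwa [snd_pair]
    · rwa [ZFSet.mem_singleton.1 hx]
  have hD : D.card < δ.card := (card_img_le _ _).trans_lt huv
  -- There is room for the fresh arguments: otherwise `δ` would be covered by two sets of size less
  -- than the infinite cardinal `|δ|`.
  have hle : X.card ≤ (δ.toZFSet \ D).card := by
    by_contra hc
    have h1 : (δ.toZFSet \ D).card < δ.card := (not_le.1 hc).trans hX
    have h2 : δ.toZFSet.card ≤ ((δ.toZFSet \ D) ∪ D).card := ZFSet.card_mono fun z hz => by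
      rw [ZFSet.mem_union, ZFSet.mem_sdiff]; tauto
    rw [card_toZFSet] at h2
    exact absurd (h2.trans ZFSet.card_union_le) (not_le.2 (Cardinal.add_lt_of_lt hδ h1 hD))
  obtain ⟨k, hk, hk'⟩ := exists_injOn hle
  set A : ZFSet := img (fun x => ZFSet.pair (k x) x) X
  have hA : A ∈ colForcing δ b := by
    refine mem_partialFns.2 ⟨fun z hz => ?_, (card_img_le _ _).trans_lt hX, ?_⟩
    · obtain ⟨x, hx, rfl⟩ := mem_img.1 hz
      rw [ZFSet.pair_mem_prod]
      exact ⟨(ZFSet.mem_sdiff.1 (hk x hx)).1, hXb hx⟩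
    · intro x y z hy hz
      obtain ⟨y', hy', h1⟩ := mem_img.1 hy
      obtain ⟨z', hz', h2⟩ := mem_img.1 hz
      obtain ⟨h3, rfl⟩ := ZFSet.pair_injective h1
      obtain ⟨h4, rfl⟩ := ZFSet.pair_injective h2
      exact hk' _ hy' _ hz' (h3.trans h4.symm)
  have hfun : ∀ w, w ∈ colForcing δ b → w ⊆ u ∪ v → w ∪ A ∈ colForcing δ b := by
    intro w hw hwuv
    refine hPF.union hw hA ?_
    have hdis : ∀ x y z, ZFSet.pair x y ∈ w → ZFSet.pair x z ∉ A := by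
      intro x y z hy hz
      obtain ⟨z', hz', h2⟩ := mem_img.1 hz
      obtain ⟨h3, rfl⟩ := ZFSet.pair_injective h2
      refine (ZFSet.mem_sdiff.1 (hk _ hz')).2 (mem_img.2 ⟨_, hwuv hy, ?_⟩)
      rw [fst_pair, h3]
    intro x y z hy hz
    rcases ZFSet.mem_union.1 hy with hy | hy <;> rcases ZFSet.mem_union.1 hz with hz | hz
    · exact hPF.func hw x y z hy hz
    · exact absurd hz (hdis x y z hy)
    · exact absurd hy (hdis x z y hz)
    · exact hPF.func hA x y z hy hz
  have h1 := hfun u hu fun z hz => ZFSet.mem_union.2 (Or.inl hz)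
  have h2 := hfun v hv fun z hz => ZFSet.mem_union.2 (Or.inr hz)
  have hp : ∀ w ∈ colForcing δ b, ∀ z ∈ w, ∃ x y, z = ZFSet.pair x y := fun w hw z hz => hPF.pairs hw hz
  have hdom := sameDom_extendBy (y := ∅) (y' := ∅) (hp _ h1) (hp _ h2)
  have hm1 := extendBy_mem hδ h0 h1 h2
  have hm2 := extendBy_mem hδ h0 h2 h1
  refine ⟨_, hm1, _, hm2, fun z hz => ?_, fun z hz => ?_, hdom, ?_⟩
  · exact ZFSet.mem_union.2 (Or.inl (ZFSet.mem_union.2 (Or.inl hz)))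
  · exact ZFSet.mem_union.2 (Or.inl (ZFSet.mem_union.2 (Or.inl hz)))
  · have key : ∀ s t s' t' : ZFSet, s' ⊆ u ∪ v → s = s' ∪ A → t = t' ∪ A → s ∈ colForcing δ b →
        t ∈ colForcing δ b → (⋃₀ (⋃₀ extendBy ∅ s t : ZFSet) : ZFSet) ⊆
          (⋃₀ (⋃₀ extendBy ∅ t s : ZFSet) : ZFSet) := by
      intro s t s' t' hs' rfl rfl hs ht z hz
      have hst := sameDom_extendBy (y := ∅) (y' := ∅) (hp _ hs) (hp _ ht)
      rw [mem_field (hp _ (extendBy_mem hδ h0 hs ht))] at hz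
      rw [mem_field (hp _ (extendBy_mem hδ h0 ht hs))]
      obtain ⟨x, y, hxy, rfl | rfl⟩ := hz
      · obtain ⟨y', hy'⟩ := (hst _).1 ⟨y, hxy⟩
        exact ⟨_, y', hy', Or.inl rfl⟩
      · have hzX : z ∈ X := by
          rw [mem_extendBy (hp _ ht)] at hxy
          rcases hxy with hxy | hxy
          · rcases ZFSet.mem_union.1 hxy with hxy | hxy
            · exact ZFSet.mem_union.2 (Or.inl (mem_img.2 ⟨_, hs' hxy, by simp⟩))
            · obtain ⟨a, ha, h⟩ := mem_img.1 hxy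
              rw [← (ZFSet.pair_injective h).2]
              exact ha
          · rw [hxy.1]
            exact ZFSet.mem_union.2 (Or.inr (ZFSet.mem_singleton.2 rfl))
        refine ⟨k z, z, ?_, Or.inr rfl⟩
        rw [mem_extendBy (hp _ hs)]
        exact Or.inl (ZFSet.mem_union.2 (Or.inr (mem_img.2 ⟨z, hzX, rfl⟩)))
    apply le_antisymm
    · exact key _ _ u v (fun z hz => ZFSet.mem_union.2 (Or.inl hz)) rfl rfl h1 h2
    · exact key _ _ v u (fun z hz => ZFSet.mem_union.2 (Or.inr hz)) rfl rfl h2 h1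

/-! ### The posets `R(a, b)` -/

/-- A product of seven posets of partial functions, the last of which is a collapse, or the trivial
poset. -/
def IsR (R : ZFSet.{u}) : Prop :=
  ∃ C : Fin 7 → ZFSet.{u}, (∀ i, PF (C i)) ∧
    (C 6 = {∅} ∨ ∃ δ b, ℵ₀ ≤ δ.card ∧ 0 < b ∧ C 6 = colForcing δ b) ∧ R = tupProd C

theorem isR_one : IsR ({rone} : ZFSet.{u}) := by
  refine ⟨fun _ => {∅}, fun _ => Or.inl rfl, Or.inl rfl, ?_⟩
  ext z
  rw [ZFSet.mem_singleton, mem_tupProd]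
  simp only [ZFSet.mem_singleton]
  constructor
  · rintro rfl
    rw [rone, crd_tup]
    exact ⟨rfl, fun _ => rfl⟩
  · rintro ⟨h, h'⟩
    rw [h, rone]
    congr 1
    funext i
    exact h' i

theorem Inacc.aleph0_le {a : Ordinal.{u}} (h : Inacc a) : ℵ₀ ≤ a.card := by
  obtain ⟨μ, hμ, rfl⟩ := h
  rw [Cardinal.card_ord]
  exact hμ.aleph0_lt.le

theorem card_cs (n : ℕ) (a : Ordinal.{u}) : (cs n a).card = Order.succ^[n] a.card := Cardinal.card_ord _

theorem card_le_card_cs (n : ℕ) (a : Ordinal.{u}) : a.card ≤ (cs n a).card := by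
  rw [card_cs]
  exact Order.le_succ_iterate n _

theorem isR_Rset (a b : Ordinal.{u}) : IsR (Rset a b) := by
  rw [Rset]
  split_ifs with h
  · have h2 : ∃ y, y ∈ Ordinal.toZFSet.{u} 2 := ⟨toZFSet 0, toZFSet_mem_toZFSet_iff.2 (by norm_num)⟩
    have hb : 0 < b := (zero_le).trans_lt h.1
    have hc : ∀ n, ℵ₀ ≤ (cs n a).card := fun n => h.2.1.aleph0_le.trans (card_le_card_cs n a)
    refine ⟨factors a b, fun i => ?_, Or.inr ⟨cs 6 a, b, hc 6, hb, rfl⟩, rfl⟩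
    have hadd : ∀ n l, PF (addForcing (cs n a) l) := fun n l => Or.inr ⟨_, _, _, hc n, h2, rfl⟩
    fin_cases i
    · exact hadd 1 _
    · exact hadd 2 _
    · exact hadd 3 _
    · exact hadd 4 _
    · exact hadd 5 _
    · exact hadd 6 _
    · have hcol : PF (colForcing (cs 6 a) b) :=
        Or.inr ⟨_, _, _, hc 6, ⟨toZFSet 0, toZFSet_mem_toZFSet_iff.2 hb⟩, rfl⟩
      exact hcol
  · exact isR_one

theorem isR_Rstem (s : List ESeq.{u}) (b : Ordinal.{u}) : IsR (Rstem s b) := by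
  cases s with
  | nil => exact isR_one
  | cons x s => exact isR_Rset _ _

/-! ### The substitution `modf` and common domains in `R(a, b)`. -/

section IsR

variable {R r s g h : ZFSet.{u}} (hR : IsR R)
include hR

theorem IsR.eq_tup (hr : r ∈ R) : r = tup (crd r) := by
  obtain ⟨C, -, -, rfl⟩ := hR
  exact (mem_tupProd.1 hr).1

theorem IsR.func (hr : r ∈ R) (i : Fin 7) : Func (crd r i) := by
  obtain ⟨C, h1, -, rfl⟩ := hR
  exact (h1 i).func ((mem_tupProd.1 hr).2 i)

theorem IsR.rle_refl (hr : r ∈ R) : rle r r :=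
  rle_iff.2 ⟨hR.eq_tup hr, hR.eq_tup hr, fun _ => subset_rfl⟩

theorem IsR.join_mem (hr : r ∈ R) (hs : s ∈ R) (h : ∀ i, Func (crd r i ∪ crd s i)) :
    join r s ∈ R := by
  obtain ⟨C, h1, -, rfl⟩ := hR
  rw [mem_tupProd, join, crd_tup]
  exact ⟨rfl, fun i => (h1 i).union ((mem_tupProd.1 hr).2 i) ((mem_tupProd.1 hs).2 i) (h i)⟩

theorem IsR.join_rle_left (hr : r ∈ R) : rle (join r s) r := by
  rw [rle_iff, join, crd_tup]
  exact ⟨rfl, hR.eq_tup hr, fun i z hz => ZFSet.mem_union.2 (Or.inl hz)⟩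

theorem IsR.join_rle_right (hs : s ∈ R) : rle (join r s) s := by
  rw [rle_iff, join, crd_tup]
  exact ⟨rfl, hR.eq_tup hs, fun i z hz => ZFSet.mem_union.2 (Or.inr hz)⟩

theorem IsR.modf_mem (hr : r ∈ R) (hh : h ∈ R) (hrg : rle r g)
    (hd : ∀ i, SameDom (crd g i) (crd h i)) : modf g h r ∈ R := by
  obtain ⟨C, h1, -, rfl⟩ := hR
  rw [mem_tupProd, modf, crd_tup]
  exact ⟨rfl, fun i => (h1 i).mod ((mem_tupProd.1 hr).2 i) ((mem_tupProd.1 hh).2 i)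
    ((rle_iff.1 hrg).2.2 i) (hd i)⟩

theorem IsR.modf_rle (hh : h ∈ R) : rle (modf g h r) h := by
  rw [rle_iff, modf, crd_tup]
  exact ⟨rfl, hR.eq_tup hh, fun i z hz => ZFSet.mem_union.2 (Or.inr hz)⟩

theorem IsR.modf_modf (hr : r ∈ R) (hh : h ∈ R) (hrg : rle r g)
    (hd : ∀ i, SameDom (crd g i) (crd h i)) : modf h g (modf g h r) = r := by
  have hr' := hR.eq_tup hr
  obtain ⟨C, h1, -, rfl⟩ := hR
  conv_rhs => rw [hr']
  rw [modf, modf, crd_tup]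
  congr 1
  funext i
  exact (h1 i).mod_mod ((mem_tupProd.1 hr).2 i) ((mem_tupProd.1 hh).2 i)
    ((rle_iff.1 hrg).2.2 i) (hd i)

theorem IsR.exists_sameDom (hr : r ∈ R) (hs : s ∈ R) : ∃ r' ∈ R, ∃ s' ∈ R, rle r' r ∧ rle s' s ∧
    (∀ i, SameDom (crd r' i) (crd s' i)) ∧ colField r' = colField s' := by
  have hr' := hR.eq_tup hr
  have hs' := hR.eq_tup hs
  obtain ⟨C, h1, h2, rfl⟩ := hR
  rw [mem_tupProd] at hr hs
  have h3 : ∀ i, ∃ u' ∈ C i, ∃ v' ∈ C i, crd r i ⊆ u' ∧ crd s i ⊆ v' ∧ SameDom u' v' ∧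
      (i = 6 → (⋃₀ (⋃₀ u' : ZFSet) : ZFSet) = (⋃₀ (⋃₀ v' : ZFSet) : ZFSet)) := by
    intro i
    -- Only the last coordinate, the collapse, carries a field that has to be equalised.
    by_cases hi : i = 6
    · subst hi
      rcases h2 with h2 | ⟨δ, b, hδ, hb, h2⟩
      · obtain ⟨u', hu, v', hv, h4, h5, h6⟩ := (h1 6).exists_sameDom (hr.2 6) (hs.2 6)
        refine ⟨u', hu, v', hv, h4, h5, h6, fun _ => ?_⟩
        rw [h2, ZFSet.mem_singleton] at hu hv
        rw [hu, hv]
      · have h3 := hr.2 6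
        have h4 := hs.2 6
        rw [h2] at h3 h4 ⊢
        obtain ⟨u', hu, v', hv, h5, h6, h7, h8⟩ := exists_sameDom_sameField hδ hb h3 h4
        exact ⟨u', hu, v', hv, h5, h6, h7, fun _ => h8⟩
    · obtain ⟨u', hu, v', hv, h4, h5, h6⟩ := (h1 i).exists_sameDom (hr.2 i) (hs.2 i)
      exact ⟨u', hu, v', hv, h4, h5, h6, fun h => absurd h hi⟩
  choose u' hu v' hv h4 h5 h6 h7 using h3
  refine ⟨tup u', ?_, tup v', ?_, ?_, ?_, ?_, ?_⟩
  · rw [mem_tupProd, crd_tup]; exact ⟨rfl, hu⟩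
  · rw [mem_tupProd, crd_tup]; exact ⟨rfl, hv⟩
  · rw [rle_iff, crd_tup]; exact ⟨rfl, hr', h4⟩
  · rw [rle_iff, crd_tup]; exact ⟨rfl, hs', h5⟩
  · rw [crd_tup, crd_tup]; exact h6
  · rw [colField_eq, colField_eq, crd_tup, crd_tup]; exact h7 6 rfl

end IsR

theorem modf_mono {g h r s : ZFSet.{u}} (hrs : rle r s) : rle (modf g h r) (modf g h s) := by
  rw [rle_iff] at *
  rw [modf, modf, crd_tup, crd_tup]
  refine ⟨rfl, rfl, fun i z hz => ?_⟩
  rw [ZFSet.mem_union, ZFSet.mem_sdiff] at *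
  exact hz.imp_left fun hz => ⟨hrs.2.2 i hz.1, hz.2⟩

/-- The collapse part of `g` is contained in that of `r`, and it is traded for a set with the same
field. -/
theorem colField_modf {g h r : ZFSet.{u}} (hrg : rle r g) (hc : colField g = colField h) :
    colField (modf g h r) = colField r := by
  rw [rle_iff] at hrg
  rw [colField_eq, colField_eq] at *
  rw [modf, crd_tup]
  have h6 := hrg.2.2 6
  have hm : ∀ {u z : ZFSet}, z ∈ (⋃₀ (⋃₀ u : ZFSet) : ZFSet) ↔ ∃ t ∈ u, ∃ w ∈ t, z ∈ w := by
    intro u z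
    simp only [ZFSet.mem_sUnion]
    exact ⟨fun ⟨w, ⟨t, ht, hw⟩, hz⟩ => ⟨t, ht, w, hw, hz⟩, fun ⟨t, ht, w, hw, hz⟩ => ⟨w, ⟨t, ht, hw⟩, hz⟩⟩
  ext z
  have hcz : z ∈ (⋃₀ (⋃₀ crd g 6 : ZFSet) : ZFSet) ↔ z ∈ (⋃₀ (⋃₀ crd h 6 : ZFSet) : ZFSet) := by rw [hc]
  rw [hm, hm] at *
  constructor
  · rintro ⟨t, ht, hz⟩
    rcases ZFSet.mem_union.1 ht with ht | ht
    · exact ⟨t, (ZFSet.mem_sdiff.1 ht).1, hz⟩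
    · obtain ⟨t', ht', hz'⟩ := hcz.2 ⟨t, ht, hz⟩
      exact ⟨t', h6 ht', hz'⟩
  · rintro ⟨t, ht, hz⟩
    by_cases htg : t ∈ crd g 6
    · obtain ⟨t', ht', hz'⟩ := hcz.1 ⟨t, htg, hz⟩
      exact ⟨t', ZFSet.mem_union.2 (Or.inr ht'), hz'⟩
    · exact ⟨t, ZFSet.mem_union.2 (Or.inl (ZFSet.mem_sdiff.2 ⟨ht, htg⟩)), hz⟩

/-! ### Absoluteness of the notions related to the forcings `R(a, b)` -/

theorem abs_forall {n : ℕ} {ι : Type} [Finite ι] {P : ι → (Fin n → ZFSet.{u}) → Prop}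
    (h : ∀ i, Abs (P i)) : Abs fun v => ∀ i, P i v := by
  choose φ h1 h2 using h
  refine ⟨Language.Formula.iInf φ, fun v => ?_, fun e v => ?_⟩
  · rw [Language.Formula.realize_iInf]; exact forall_congr' fun i => h1 i v
  · rw [Language.Formula.realize_iInf]; exact forall_congr' fun i => h2 i e v

section abs

variable {n : ℕ} {t t₁ t₂ : (Fin n → ZFSet.{u}) → ZFSet.{u}}

theorem AbsF.crd (h : AbsF t) (i : Fin 7) : AbsF fun v => crd (t v) i := by
  fin_cases i
  · exact h.fst
  · exact h.snd.fst
  · exact h.snd.snd.fst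
  · exact h.snd.snd.snd.fst
  · exact h.snd.snd.snd.snd.fst
  · exact h.snd.snd.snd.snd.snd.fst
  · exact h.snd.snd.snd.snd.snd.snd

theorem AbsF.colField (h : AbsF t) : AbsF fun v => colField (t v) :=
  h.snd.snd.snd.snd.snd.snd.sUnion.sUnion

theorem AbsF.tup {s : Fin 7 → (Fin n → ZFSet.{u}) → ZFSet.{u}} (h : ∀ i, AbsF (s i)) :
    AbsF fun v => tup fun i => s i v :=
  (h 0).pair ((h 1).pair ((h 2).pair ((h 3).pair ((h 4).pair ((h 5).pair (h 6))))))

theorem AbsF.join (h₁ : AbsF t₁) (h₂ : AbsF t₂) : AbsF fun v => join (t₁ v) (t₂ v) :=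
  AbsF.tup (s := fun i v => ExtRadin.crd (t₁ v) i ∪ ExtRadin.crd (t₂ v) i)
    fun i => (h₁.crd i).union (h₂.crd i)

theorem AbsF.isTup (h : AbsF t) : Abs fun v => t v = ExtRadin.tup (ExtRadin.crd (t v)) :=
  h.eq (AbsF.tup (s := fun i v => ExtRadin.crd (t v) i) fun i => h.crd i)

theorem AbsF.func (h : AbsF t) : Abs fun v => Func (t v) := by
  have h1 : Abs fun v : Fin 1 → ZFSet.{u} => ∀ a ∈ v 0, ∀ b ∈ v 0,
      a = ZFSet.pair (ExtRadin.fst a) (ExtRadin.snd a) →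
        b = ZFSet.pair (ExtRadin.fst b) (ExtRadin.snd b) →
          ExtRadin.fst a = ExtRadin.fst b → ExtRadin.snd a = ExtRadin.snd b :=
    (absF_var 0).all (Q := fun a v => ∀ b ∈ v 0,
      a = ZFSet.pair (ExtRadin.fst a) (ExtRadin.snd a) →
        b = ZFSet.pair (ExtRadin.fst b) (ExtRadin.snd b) →
          ExtRadin.fst a = ExtRadin.fst b → ExtRadin.snd a = ExtRadin.snd b)
      ((absF_var 1).all (Q := fun b v =>
        v 0 = ZFSet.pair (ExtRadin.fst (v 0)) (ExtRadin.snd (v 0)) →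
        b = ZFSet.pair (ExtRadin.fst b) (ExtRadin.snd b) →
          ExtRadin.fst (v 0) = ExtRadin.fst b → ExtRadin.snd (v 0) = ExtRadin.snd b)
        (((absF_var 1).eq ((absF_var 1).fst.pair (absF_var 1).snd)).imp
          (((absF_var 0).eq ((absF_var 0).fst.pair (absF_var 0).snd)).imp
            (((absF_var 1).fst.eq (absF_var 0).fst).imp ((absF_var 1).snd.eq (absF_var 0).snd)))))
  refine Abs.comp₁ (R := Func) (h1.congr fun v => ⟨fun h2 x y z hy hz => ?_, ?_⟩) h
  · simpa using h2 _ hy _ hz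
  · intro h2 a ha b hb ha' hb' hab
    rw [ha'] at ha
    rw [hb', ← hab] at hb
    exact h2 _ _ _ ha hb

theorem AbsF.rle (h₁ : AbsF t₁) (h₂ : AbsF t₂) : Abs fun v => rle (t₁ v) (t₂ v) :=
  (h₁.isTup.and (h₂.isTup.and (abs_forall fun i => (h₂.crd i).subset (h₁.crd i)))).congr
    fun _ => rle_iff.symm

end abs

/-! ### The bound of a condition -/

theorem Inacc.cs_lt {a b : Ordinal.{u}} (h : Inacc b) (hab : a < b) (n : ℕ) : cs n a < b := by
  obtain ⟨μ, hμ, rfl⟩ := h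
  rw [cs, Cardinal.ord_lt_ord]
  induction n with
  | zero => exact Cardinal.lt_ord.1 hab
  | succ n ih =>
    rw [Function.iterate_succ_apply']
    exact hμ.isSuccLimit.succ_lt ih

theorem colField_rone : colField (rone : ZFSet.{u}) = ∅ := by
  rw [colField_eq, rone, crd_tup]
  simp

/-- The collapse part has size less than `b`, and its arguments and values lie below `b`, as `a⁺⁶ <
b`; regularity of `b` gives the bound. The first alternative is for the trivial poset, where nothing
is known about `b`. -/
theorem colField_bounded {a b : Ordinal.{u}} {r : ZFSet.{u}} (hr : r ∈ Rset a b) :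
    colField r = ∅ ∨ ∃ η < b, colField r ⊆ η.toZFSet := by
  rw [Rset] at hr
  split_ifs at hr with h
  · right
    have h6 := (mem_tupProd.1 hr).2 6
    change crd r 6 ∈ colForcing (cs 6 a) b at h6
    rw [colField_eq]
    set u := crd r 6
    have hu := mem_partialFns.1 h6
    have hab := h.2.2.cs_lt h.1 6
    have hp : ∀ z ∈ u, ∃ x y, z = ZFSet.pair x y := fun z hz => by
      obtain ⟨x, -, y, -, h⟩ := ZFSet.mem_prod.1 (hu.1 hz)
      exact ⟨x, y, h⟩
    have hX : ∀ x ∈ (⋃₀ (⋃₀ u : ZFSet) : ZFSet), ∃ i < b, i.toZFSet = x := by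
      intro x hx
      obtain ⟨y, z, hyz, rfl | rfl⟩ := (mem_field hp).1 hx
      · obtain ⟨i, hi, rfl⟩ := mem_toZFSet_iff.1 (ZFSet.pair_mem_prod.1 (hu.1 hyz)).1
        exact ⟨i, hi.trans hab, rfl⟩
      · obtain ⟨i, hi, rfl⟩ := mem_toZFSet_iff.1 (ZFSet.pair_mem_prod.1 (hu.1 hyz)).2
        exact ⟨i, hi, rfl⟩
    set X := (⋃₀ (⋃₀ u : ZFSet) : ZFSet)
    obtain ⟨μ, hμ, rfl⟩ := h.2.2
    have hub : u.card < μ := by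
      refine hu.2.1.trans_le ?_
      have := Ordinal.card_le_card hab.le
      rwa [Cardinal.card_ord] at this
    have hcard : X.card < μ := by
      have : X ⊆ img fst u ∪ img snd u := by
        intro x hx
        obtain ⟨y, z, hyz, rfl | rfl⟩ := (mem_field hp).1 hx
        · exact ZFSet.mem_union.2 (Or.inl (mem_img.2 ⟨_, hyz, by simp⟩))
        · exact ZFSet.mem_union.2 (Or.inr (mem_img.2 ⟨_, hyz, by simp⟩))
      refine ((ZFSet.card_mono this).trans ZFSet.card_union_le).trans_lt
        (Cardinal.add_lt_of_lt hμ.aleph0_lt.le ?_ ?_)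
      · exact (card_img_le _ _).trans_lt hub
      · exact (card_img_le _ _).trans_lt hub
    have hlt : (⨆ x : Shrink.{u} X, Order.succ ((equivShrink X).symm x : ZFSet).rank) < μ.ord := by
      refine Ordinal.iSup_lt_of_lt_cof (by rwa [hμ.isRegular.cof_ord]) fun x => ?_
      obtain ⟨i, hi, h⟩ := hX _ ((equivShrink X).symm x).2
      rw [← h, rank_toZFSet]
      exact (Cardinal.isSuccLimit_ord hμ.aleph0_lt.le).succ_lt hi
    refine ⟨_, hlt, fun x hx => ?_⟩
    obtain ⟨i, hi, rfl⟩ := hX x hx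
    rw [toZFSet_mem_toZFSet_iff]
    have h1 := le_ciSup (Ordinal.bddAbove_of_small (s := Set.range fun x : Shrink.{u} X =>
      Order.succ ((equivShrink X).symm x : ZFSet).rank)) (equivShrink X ⟨_, hx⟩)
    simp only [Equiv.symm_apply_apply, rank_toZFSet] at h1
    exact (Order.lt_succ i).trans_le h1
  · left
    rw [ZFSet.mem_singleton.1 hr, colField_rone]

section above

variable {c : Ordinal.{u}} {d : ZFSet.{u}} {p q : StarData.{u}}

/-- `Above` sees `f` only through the collapse field of `j_E(f)` at the seed, and pointwise equality
of fields passes to the seed by elementarity. It is applied with two functions that differ by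
`modf`. -/
theorem above_congr (hS : IsSystem c d) (hmc : c ≤ p.mc ∧ p.mc < cs 3 c) (hpq : q.mc = p.mc)
    (h : ∀ x, colField (p.f x) = colField (q.f x)) (ξ : Ordinal.{u}) :
    p.Above c d ξ ↔ q.Above c d ξ := by
  have h0 := big_univ hS hmc.1 hmc.2 0 hS.pos
  have h1 := Abs.j₃ (ultE c d)
    (R := fun D f g => ∀ z ∈ D, colField (app f z) = colField (app g z))
    ((absF_var 0).all (Q := fun z v => colField (app (v 1) z) = colField (app (v 2) z))
      (((absF_var 2).app (absF_var 0)).colField.eq ((absF_var 3).app (absF_var 0)).colField))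
    (V_ c) (graphOn (V_ c) (onCodes p.f)) (graphOn (V_ c) (onCodes q.f))
  have h2 := h1.2 (fun z hz => by
    rw [app_graphOn hz, app_graphOn hz]
    by_cases hx : ∃ x : ESeq.{u}, x.code = z
    · obtain ⟨x, rfl⟩ := hx
      rw [onCodes_code, onCodes_code, h]
    · rw [onCodes_of_not hx, onCodes_of_not hx]) _ h0
  unfold StarData.Above
  rw [hpq, h2]

/-- The elements of length `0` of a measure one set. -/
theorem Big.zero {α : Ordinal.{u}} {X : ZFSet.{u}} (hS : IsSystem c d) (h : Big c d α X) :
    xpt c d α 0 ∈ (ultE c d).j (ZFSet.sep (fun z => snd (snd z) = ∅) X) := by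
  have := j_sep (ultE c d) (Q := fun z (_ : Fin 0 → ZFSet.{u}) => snd (snd z) = ∅)
    ((absF_var 0).snd.snd.eq absF_empty) X Fin.elim0
  rw [this, ZFSet.mem_sep, snd_snd_xpt, restr_zero]
  exact ⟨h 0 hS.pos, rfl⟩

theorem StarData.Valid.big (hS : IsSystem c d) (hp : p.Valid c d) : Big c d p.mc (codes c p.T) :=
  (mem_meas_iff hS hp.mc_dom.1 hp.mc_dom.2 ZFSet.sep_subset).1 hp.T_mem

/-- On points of length `0` the collapse field of `f x` is empty or bounded below `κ⁰(x)`. Łoś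
transfers this to the seed of length `0`, where `κ⁰` is the critical point. -/
theorem StarData.Valid.exists_above (hS : IsSystem c d) (hp : p.Valid c d) :
    ∃ ξ < c, p.Above c d ξ := by
  have h0 := (hp.big hS).zero hS
  have h1 := Abs.j₂ (ultE c d)
    (R := fun D f => ∀ z ∈ D, (∀ y ∈ colField (app f z), ¬ y = y) ∨
      ∃ η ∈ fst z, colField (app f z) ⊆ η)
    ((absF_var 0).all (Q := fun z v => (∀ y ∈ colField (app (v 1) z), ¬ y = y) ∨
        ∃ η ∈ fst z, colField (app (v 1) z) ⊆ η)
      ((((absF_var 2).app (absF_var 0)).colField.all (Q := fun y _ => ¬ y = y)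
        (abs_eq_var 0 0).not).or
      ((absF_var 0).fst.ex (Q := fun η v => colField (app (v 2) (v 0)) ⊆ η)
        (((absF_var 3).app (absF_var 1)).colField.subset (absF_var 0)))))
    (ZFSet.sep (fun z => snd (snd z) = ∅) (codes c p.T)) (graphOn (V_ c) (onCodes p.f))
  have h2 := h1.2 (fun z hz => by
    rw [ZFSet.mem_sep, mem_codes] at hz
    obtain ⟨⟨hz, x, hx, rfl⟩, h0⟩ := hz
    rw [snd_snd_code] at h0
    rw [app_graphOn hz, onCodes_code]
    have hf := hp.f_mem x hx ((hp.T_ext x hx).1.d_eq.2 h0)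
    have hb : colField (p.f x) = ∅ ∨ ∃ η < x.c, colField (p.f x) ⊆ η.toZFSet := by
      revert hf
      cases p.stem c with
      | nil => intro hf; left; rw [ZFSet.mem_singleton.1 hf, colField_rone]
      | cons y s => intro hf; exact colField_bounded hf
    rcases hb with hb | ⟨η, hη, hb⟩
    · left
      rw [hb]
      exact fun y hy => absurd hy (ZFSet.notMem_empty y)
    · right
      refine ⟨η.toZFSet, ?_, hb⟩
      rwa [fst_code, toZFSet_mem_toZFSet_iff]) _ h0
  rcases h2 with h2 | ⟨η, hη, h2⟩
  · exact ⟨0, hS.crit_pos, fun z hz => absurd rfl (h2 z hz)⟩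
  · rw [fst_xpt] at hη
    obtain ⟨ξ, hξ, rfl⟩ := mem_toZFSet_iff.1 hη
    refine ⟨ξ, hξ, fun z hz => ?_⟩
    obtain ⟨i, hi, rfl⟩ := mem_toZFSet_iff.1 (h2 hz)
    rwa [rank_toZFSet]

end above

/-! ### Second iterates -/

theorem j_sep_app (e : InnerEmb.{u}) {Θ : ZFSet.{u} → ZFSet.{u} → Prop}
    (hΘ : Abs fun v : Fin 2 → ZFSet.{u} => Θ (v 0) (v 1)) (D f g x : ZFSet.{u}) :
    x ∈ e.j (ZFSet.sep (fun z => Θ (app f z) (app g z)) D) ↔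
      x ∈ e.j D ∧ Θ (app (e.j f) x) (app (e.j g) x) := by
  have := j_sep e (Q := fun z (v : Fin 2 → ZFSet.{u}) => Θ (app (v 0) z) (app (v 1) z))
    (hΘ.comp₂ ((absF_var 1).app (absF_var 0)) ((absF_var 2).app (absF_var 0))) D ![f, g]
  change e.j (ZFSet.sep (fun z => Θ (app f z) (app g z)) D) = _ at this
  rw [this, ZFSet.mem_sep]
  rfl

/-- Elementarity is applied twice through `key`: for fixed `v ∈ A` to evaluate `G(v, ·)` at `x`, and
then to evaluate the resulting function of `v` at `x`. -/
theorem twoStep_rel (e : InnerEmb.{u}) {D A x : ZFSet.{u}} (hA : A ⊆ D) (hx : x ∈ e.j A)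
    {Θ : ZFSet.{u} → ZFSet.{u} → ZFSet.{u} → Prop}
    (hΘ : Abs fun v : Fin 3 → ZFSet.{u} => Θ (v 0) (v 1) (v 2))
    {G₁ G₂ G₃ : ZFSet.{u} → ZFSet.{u} → ZFSet.{u}}
    (h : ∀ v ∈ A, ∀ w ∈ A, Θ (G₁ v w) (G₂ v w) (G₃ v w)) :
    Θ (twoStep e D x G₁) (twoStep e D x G₂) (twoStep e D x G₃) := by
  have key : ∀ g₁ g₂ g₃ : ZFSet.{u}, (∀ w ∈ A, Θ (app g₁ w) (app g₂ w) (app g₃ w)) →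
      Θ (app (e.j g₁) x) (app (e.j g₂) x) (app (e.j g₃) x) := by
    intro g₁ g₂ g₃ hg
    have hΘ' : Abs fun v : Fin 5 → ZFSet.{u} =>
        Θ (app (v 2) (v 0)) (app (v 3) (v 0)) (app (v 4) (v 0)) :=
      hΘ.comp (t := ![fun v => app (v 2) (v 0), fun v => app (v 3) (v 0),
        fun v => app (v 4) (v 0)]) (by
          intro i
          fin_cases i
          exacts [(absF_var 2).app (absF_var 0), (absF_var 3).app (absF_var 0),
            (absF_var 4).app (absF_var 0)])
    exact (Abs.j₄ e (R := fun A g₁ g₂ g₃ => ∀ w ∈ A, Θ (app g₁ w) (app g₂ w) (app g₃ w))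
      ((absF_var 0).all (Q := fun w v => Θ (app (v 1) w) (app (v 2) w) (app (v 3) w)) hΘ')
      A g₁ g₂ g₃).2 hg x hx
  refine key _ _ _ fun v hv => ?_
  rw [app_graphOn (hA hv), app_graphOn (hA hv), app_graphOn (hA hv)]
  refine key _ _ _ fun w hw => ?_
  rw [app_graphOn (hA hw), app_graphOn (hA hw), app_graphOn (hA hw)]
  exact h v hv w hw

/-- Properties of `R(a, b)` which its images share. -/
def RLike (R : ZFSet.{u}) : Prop :=
  (∀ r ∈ R, r = tup (crd r) ∧ ∀ i, Func (crd r i)) ∧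
    ∀ r ∈ R, ∀ s ∈ R, (∀ i, Func (crd r i ∪ crd s i)) → join r s ∈ R

theorem abs_RLike : Abs fun v : Fin 1 → ZFSet.{u} => RLike (v 0) :=
  ((absF_var 0).all (Q := fun r _ => r = tup (crd r) ∧ ∀ i, Func (crd r i))
    ((absF_var 0).isTup.and (abs_forall fun i => ((absF_var 0).crd i).func))).and
  ((absF_var 0).all (Q := fun r v => ∀ s ∈ v 0, (∀ i, Func (crd r i ∪ crd s i)) → join r s ∈ v 0)
    ((absF_var 1).all (Q := fun s v => (∀ i, Func (crd (v 0) i ∪ crd s i)) → join (v 0) s ∈ v 1)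
      ((abs_forall fun i => (((absF_var 1).crd i).union ((absF_var 0).crd i)).func).imp
        (((absF_var 1).join (absF_var 0)).mem (absF_var 2)))))

theorem IsR.rLike {R : ZFSet.{u}} (h : IsR R) : RLike R :=
  ⟨fun _ hr => ⟨h.eq_tup hr, h.func hr⟩, fun _ hr _ hs hrs => h.join_mem hr hs hrs⟩

theorem rLike_Rult {e : InnerEmb.{u}} {κ : Ordinal.{u}} (he : e.IsCrit κ) : RLike (Rult e κ) :=
  twoStep_rel e (Θ := fun a _ _ => RLike a) subset_rfl he.mem_j
    (Abs.comp₁ (R := RLike) abs_RLike (absF_var 0))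
    (G₂ := fun _ _ => ∅) (G₃ := fun _ _ => ∅) fun _ _ _ _ => (isR_Rset _ _).rLike

/-- Hence elements of the guiding generic lie in `M_τ`, where they can be represented as `j_τ(f)(E_α
↾ τ)`. -/
theorem Rult_mem {e : InnerEmb.{u}} {κ : Ordinal.{u}} (he : e.IsCrit κ) : Rult e κ ∈ e.M := by
  have h1 : κ.toZFSet ∈ e.M := e.trans _ (j_mem_M e _) _ he.mem_j
  have := AbsF.closed (g := fun v : Fin 2 → ZFSet.{u} => app (v 0) (v 1))
    ((absF_var 0).app (absF_var 1)) e ![⟨_, j_mem_M e (graphOn κ.toZFSet fun v =>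
      app (e.j (graphOn κ.toZFSet fun w => Rset v.rank w.rank)) κ.toZFSet)⟩, ⟨_, h1⟩]
  exact this

/-- The filter `I(E)` is closed under unions. -/
theorem InGenE.join {κ : Ordinal.{u}} {d r s : ZFSet.{u}} (hS : IsSystem κ d)
    (hr : InGenE κ d r) (hs : InGenE κ d s) :
    (∀ i, Func (crd r i ∪ crd s i)) ∧ InGenE κ d (join r s) := by
  obtain ⟨hr0, τ₁, hτ₁, α₁, h1, h1', f₁, hf₁, hg₁, hle₁⟩ := hr
  obtain ⟨hs0, τ₂, hτ₂, α₂, h2, h2', f₂, hf₂, hg₂, hle₂⟩ := hs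
  have hup : ∀ {σ τ α f}, τ < len d → σ ≤ τ → κ ≤ α → α < cs 3 κ → IsFun f (V_ κ) →
      app ((ultAt κ d σ).j f) (xpt κ d α σ) ∈ gen d σ →
      app ((ultAt κ d τ).j f) (xpt κ d α σ) ∈ gen d τ := by
    intro σ τ α f hτ hστ hα hα' hf hg
    rcases hστ.eq_or_lt with rfl | hlt
    · exact hg
    · exact hS.lift τ hτ σ hlt α hα hα' f hf hg
  obtain ⟨τ, hτ, hle1, hle2⟩ : ∃ τ < len d, τ₁ ≤ τ ∧ τ₂ ≤ τ :=
    ⟨max τ₁ τ₂, max_lt hτ₁ hτ₂, le_max_left _ _, le_max_right _ _⟩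
  have hg₁' := hup hτ hle1 h1 h1' hf₁ hg₁
  have hg₂' := hup hτ hle2 h2 h2' hf₂ hg₂
  obtain ⟨hsub, -, -, hdir, -⟩ := hS.generic τ hτ
  -- Both witnesses have been lifted to the same `τ`. A common lower bound `t` in `I(τ)` is sent by
  -- `i_τ` below both `r` and `s`; this makes their union single-valued and witnesses that it
  -- belongs to `I(E)`.
  obtain ⟨t, ht, htr, hts⟩ := hdir _ hg₁' _ hg₂'
  have hult := hS.isUltAt hτ
  have htR := hsub ht
  have htM := (ultAt κ d τ).trans _ (Rult_mem hult.1) _ htR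
  obtain ⟨τ', hτ', α, hα, hα', f, hf, rfl⟩ := hult.2.2 t htM
  obtain rfl : τ' = τ := hτ'
  obtain ⟨i, hi⟩ := hS.factor τ' hτ
  obtain ⟨yt, hyt, hyt'⟩ := (hi τ' le_rfl α hα hα').2 f hf
  obtain ⟨y₁, hy₁, hy₁'⟩ := (hi τ₁ hle1 α₁ h1 h1').2 f₁ hf₁
  obtain ⟨y₂, hy₂, hy₂'⟩ := (hi τ₂ hle2 α₂ h2 h2').2 f₂ hf₂
  have hrle : ∀ y : (ultAt κ d τ').M, rle (yt : ZFSet) y → rle (i yt : ZFSet) (i y) := fun y hy =>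
    (Abs.emb_iff (P := fun v : Fin 2 → ZFSet.{u} => rle (v 0) (v 1))
      ((absF_var 0).rle (absF_var 1)) _ _ i ![yt, y]).2 hy
  have e1 : rle (i yt : ZFSet) r := (hrle y₁ (by rw [hyt, hy₁]; exact htr)).trans (by rw [hy₁']; exact hle₁)
  have e2 : rle (i yt : ZFSet) s := (hrle y₂ (by rw [hyt, hy₂]; exact hts)).trans (by rw [hy₂']; exact hle₂)
  have hfun : ∀ k, Func (crd (i yt : ZFSet) k) := fun k =>
    (Abs.emb_iff (P := fun v : Fin 1 → ZFSet.{u} => Func (crd (v 0) k))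
      ((absF_var 0).crd k).func _ _ i ![yt]).2 (by
        change Func (crd (yt : ZFSet) k)
        rw [hyt]
        exact ((rLike_Rult hult.1).1 _ htR).2 k)
  have hF : ∀ k, Func (crd r k ∪ crd s k) := fun k x y z hy hz => by
    have hsub : crd r k ∪ crd s k ⊆ crd (i yt : ZFSet) k := fun w hw => by
      rcases ZFSet.mem_union.1 hw with hw | hw
      exacts [(rle_iff.1 e1).2.2 k hw, (rle_iff.1 e2).2.2 k hw]
    exact hfun k x y z (hsub hy) (hsub hz)
  refine ⟨hF, (rLike_Rult hS.isUlt.1).2 r hr0 s hs0 hF, τ', hτ, α, hα, hα', f, hf, ht, ?_⟩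
  rw [← hyt', rle_iff]
  rw [rle_iff] at e1 e2
  rw [ExtRadin.join, crd_tup]
  refine ⟨e1.1, rfl, fun k w hw => ?_⟩
  rcases ZFSet.mem_union.1 hw with hw | hw
  exacts [e1.2.2 k hw, e2.2.2 k hw]

/-- Relations between second iterates hold on a set of measure one. -/
theorem exists_big_of_twoStep {κ α : Ordinal.{u}} {d : ZFSet.{u}} (hS : IsSystem κ d) (hα : κ ≤ α)
    (hα' : α < cs 3 κ) {Θ : ZFSet.{u} → ZFSet.{u} → Prop}
    (hΘ : Abs fun v : Fin 2 → ZFSet.{u} => Θ (v 0) (v 1))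
    {G₁ G₂ : ZFSet.{u} → ZFSet.{u} → ZFSet.{u}}
    (h : Θ (twoStep (ultE κ d) (V_ κ) (xpt κ d α 0) G₁)
      (twoStep (ultE κ d) (V_ κ) (xpt κ d α 0) G₂)) :
    ∃ X ⊆ V_ κ, Big κ d α X ∧ ∀ i k : Ordinal.{u}, ∀ z ∈ X,
      ZFSet.pair i.toZFSet (ZFSet.pair k.toZFSet ∅) ∈ X → snd (snd z) = ∅ → i.toZFSet ∈ fst z →
      k.toZFSet ∈ fst z → Θ (G₁ (ZFSet.pair i.toZFSet (ZFSet.pair k.toZFSet ∅)) z)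
        (G₂ (ZFSet.pair i.toZFSet (ZFSet.pair k.toZFSet ∅)) z) := by
  set e := ultE κ d
  set D := V_ κ
  set x := xpt κ d α 0 with hx
  have hxD : x ∈ e.j D := big_univ hS hα hα' 0 hS.pos
  set H₁ := graphOn D fun v => app (e.j (graphOn D (G₁ v))) x
  set H₂ := graphOn D fun v => app (e.j (graphOn D (G₂ v))) x
  set A := ZFSet.sep (fun z => Θ (app H₁ z) (app H₂ z)) D
  have hA : x ∈ e.j A := (j_sep_app e hΘ D H₁ H₂ x).2 ⟨hxD, h⟩
  set B : ZFSet.{u} → ZFSet.{u} := fun v =>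
    ZFSet.sep (fun z => Θ (app (graphOn D (G₁ v)) z) (app (graphOn D (G₂ v)) z)) D
  have hB : ∀ v ∈ A, x ∈ e.j (B v) := by
    intro v hv
    obtain ⟨hvD, hv⟩ := ZFSet.mem_sep.1 hv
    refine (j_sep_app e hΘ D _ _ x).2 ⟨hxD, ?_⟩
    rwa [app_graphOn hvD, app_graphOn hvD] at hv
  set H := graphOn D B
  -- A diagonal intersection of the sets `B v`, indexed by the codes `v` of length `0` whose two
  -- ordinals lie below `κ⁰(z)`. It restricts only the `z` of length `0`, so it is vacuous at the
  -- seeds with `τ > 0`.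
  have hbig := big_sep hS hα hα' (Q := fun z (v : Fin 2 → ZFSet.{u}) => snd (snd z) = ∅ →
      z ∈ v 0 ∧ ∀ i ∈ fst z, ∀ k ∈ fst z, ZFSet.pair i (ZFSet.pair k ∅) ∈ v 0 →
        z ∈ app (v 1) (ZFSet.pair i (ZFSet.pair k ∅)))
    (((absF_var 0).snd.snd.eq absF_empty).imp (((absF_var 0).mem (absF_var 1)).and
      ((absF_var 0).fst.all (Q := fun i w => ∀ k ∈ fst (w 0), ZFSet.pair i (ZFSet.pair k ∅) ∈ w 1 →
        w 0 ∈ app (w 2) (ZFSet.pair i (ZFSet.pair k ∅)))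
        ((absF_var 1).fst.all (Q := fun k w => ZFSet.pair (w 0) (ZFSet.pair k ∅) ∈ w 2 →
          w 1 ∈ app (w 3) (ZFSet.pair (w 0) (ZFSet.pair k ∅)))
          ((((absF_var 1).pair ((absF_var 0).pair absF_empty)).mem (absF_var 3)).imp
            ((absF_var 2).mem ((absF_var 4).app
              ((absF_var 1).pair ((absF_var 0).pair absF_empty)))))))))
    ![A, H] (by
      intro τ hτ hτ0
      rw [snd_snd_xpt] at hτ0
      have hτ0 : τ = 0 := by
        by_contra hne
        exact restr_ne_empty (pos_iff_ne_zero.2 hne) hτ0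
      subst hτ0
      refine ⟨hA, fun i hi k hk hik => ?_⟩
      rw [fst_xpt] at hi hk
      obtain ⟨i, hi', rfl⟩ := mem_toZFSet_iff.1 hi
      obtain ⟨k, hk', rfl⟩ := mem_toZFSet_iff.1 hk
      change _ ∈ e.j A at hik
      change x ∈ app (e.j H) _
      -- The code `v` is built from `∅` and ordinals below `κ`, so `j_E` fixes it; thus `v ∈ j_E(A)`
      -- gives `v ∈ A`.
      rw [← j_empty e, ← j_ord hS hi', ← j_ord hS hk', ← j_pair, ← j_pair] at hik ⊢
      have hvA := (j_mem e).1 hik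
      rw [← j_app, app_graphOn (ZFSet.mem_sep.1 hvA).1]
      exact hB _ hvA)
  refine ⟨_, ZFSet.sep_subset, hbig, fun i k z hz hv hz0 hi hk => ?_⟩
  obtain ⟨hzD, hz⟩ := ZFSet.mem_sep.1 hz
  obtain ⟨hvD, hv⟩ := ZFSet.mem_sep.1 hv
  have hvA := (hv (by simp)).1
  have := (hz hz0).2 _ hi _ hk hvA
  change z ∈ app H _ at this
  rw [app_graphOn hvD] at this
  have := (ZFSet.mem_sep.1 this).2
  rwa [app_graphOn hzD, app_graphOn hzD] at this

/-- The function `F` of a condition, as a function of codes. -/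
noncomputable abbrev codeF (F : ESeq.{u} → ESeq.{u} → ZFSet.{u}) : ZFSet.{u} → ZFSet.{u} → ZFSet.{u} :=
  fun v w => onCodes (fun x => onCodes (F x) w) v

theorem codeF_code (F : ESeq.{u} → ESeq.{u} → ZFSet.{u}) (x y : ESeq.{u}) :
    codeF F x.code y.code = F x y := by
  rw [codeF, onCodes_code, onCodes_code]

open Classical in
/-- The coordinatewise union of two functions `F`, on the elements of `T` of length `0`. -/
noncomputable def joinF (T : Set ESeq.{u}) (F G : ESeq.{u} → ESeq.{u} → ZFSet.{u}) :
    ESeq.{u} → ESeq.{u} → ZFSet.{u} := fun x y =>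
  if (x ∈ T ∧ len x.d = 0) ∧ y ∈ T ∧ len y.d = 0 then join (F x y) (G x y) else ∅

/-- On the points of `T` of length `0` the new function is the union of the two, so its second
iterate is the union of their second iterates, and `I(E)` is closed under unions. -/
theorem inGenE_joinF {c α : Ordinal.{u}} {d : ZFSet.{u}} (hS : IsSystem c d) {T : Set ESeq.{u}}
    (hT : Big c d α (codes c T)) {F G : ESeq.{u} → ESeq.{u} → ZFSet.{u}}
    (hF : InGenE c d (twoStep (ultE c d) (V_ c) (xpt c d α 0) (codeF F)))
    (hG : InGenE c d (twoStep (ultE c d) (V_ c) (xpt c d α 0) (codeF G))) :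
    InGenE c d (twoStep (ultE c d) (V_ c) (xpt c d α 0) (codeF (joinF T F G))) := by
  have h := twoStep_rel (ultE c d) (D := V_ c)
    (A := ZFSet.sep (fun z => snd (snd z) = ∅) (codes c T)) (Θ := fun a b r => r = join a b)
    (ZFSet.sep_subset.trans ZFSet.sep_subset) (hT.zero hS)
    ((absF_var 2).eq ((absF_var 0).join (absF_var 1))) (G₁ := codeF F) (G₂ := codeF G)
    (G₃ := codeF (joinF T F G)) (by
      intro v hv w hw
      rw [ZFSet.mem_sep, mem_codes] at hv hw
      obtain ⟨⟨-, x, hx, rfl⟩, hx0⟩ := hv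
      obtain ⟨⟨-, y, hy, rfl⟩, hy0⟩ := hw
      rw [snd_snd_code] at hx0 hy0
      rw [codeF_code, codeF_code, codeF_code, joinF, if_pos]
      rw [hx0, hy0, len_empty]
      exact ⟨⟨hx, rfl⟩, hy, rfl⟩)
  rw [h]
  exact (hF.join hS hG).2

/-- Both second iterates lie in `I(E)` and so are compatible, which reflects to a measure one set.
If `R(κ⁰(x), κ⁰(y))` is nontrivial, then `x.a < κ⁰(x)⁺³ < κ⁰(y)`, so the reflected statement covers
the pair; otherwise both values are the trivial condition. -/
theorem exists_big_compat {c : Ordinal.{u}} {d : ZFSet.{u}} {p q : StarData.{u}}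
    (hS : IsSystem c d) (hp : p.Valid c d) (hq : q.Valid c d) (hmc : q.mc = p.mc)
    (hT : q.T = p.T) :
    ∃ X ⊆ V_ c, Big c d p.mc X ∧ ∀ x ∈ p.T, ∀ y ∈ p.T, x.code ∈ X → y.code ∈ X → len x.d = 0 →
      len y.d = 0 → ∀ i, Func (crd (p.F x y) i ∪ crd (q.F x y) i) := by
  have hqF := hq.F_gen
  rw [hmc] at hqF
  obtain ⟨X, hX, hX', h⟩ := exists_big_of_twoStep hS hp.mc_dom.1 hp.mc_dom.2
    (Θ := fun a b => ∀ i, Func (crd a i ∪ crd b i))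
    (abs_forall fun i => (((absF_var 0).crd i).union ((absF_var 1).crd i)).func)
    (hp.F_gen.join hS hqF).1
  refine ⟨X, hX, hX', fun x hx y hy hxX hyX hx0 hy0 => ?_⟩
  have hFp := hp.F_mem x hx y hy hx0 hy0
  have hFq := hq.F_mem x (hT ▸ hx) y (hT ▸ hy) hx0 hy0
  have hx1 := (hp.T_ext x hx).1
  by_cases hcond : x.c < y.c ∧ Inacc x.c ∧ Inacc y.c
  · have hd : x.d = ∅ := hx1.d_eq.1 hx0
    have hcode : ZFSet.pair x.c.toZFSet (ZFSet.pair x.a.toZFSet ∅) = x.code := by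
      rw [ESeq.code, hd]
    have := h x.c x.a y.code hyX (by rwa [hcode])
      (by rw [snd_snd_code]; exact (hp.T_ext y hy).1.d_eq.1 hy0)
      (by rw [fst_code, toZFSet_mem_toZFSet_iff]; exact hcond.1)
      (by rw [fst_code, toZFSet_mem_toZFSet_iff]; exact hx1.2.1.trans (hcond.2.2.cs_lt hcond.1 3))
    rw [hcode] at this
    simpa only [onCodes_code] using this
  · have hR : Rset x.c y.c = {rone} := if_neg hcond
    rw [hR, ZFSet.mem_singleton] at hFp hFq
    rw [hFp, hFq]
    intro i
    have : crd (rone : ZFSet.{u}) i ∪ crd rone i = crd rone i := by ext; simp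
    rw [this]
    exact isR_one.func (ZFSet.mem_singleton.2 rfl) i

/-! ### Projections -/

theorem app_mem_of_funs {f X Y x : ZFSet.{u}} (hf : f ∈ ZFSet.funs X Y) (hx : x ∈ X) :
    app f x ∈ Y := by
  rw [ZFSet.mem_funs] at hf
  obtain ⟨w, hw, huniq⟩ := hf.2 x hx
  rw [app_eq (y := w) fun z => ⟨fun hz => huniq z hz, fun hz => hz ▸ hw⟩]
  exact (ZFSet.pair_mem_prod.1 (hf.1 hw)).2

section proj

variable {c : Ordinal.{u}} {d : ZFSet.{u}} (hS : IsSystem c d)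
include hS

/-- Outside `j_E(c)` the function `j_E(f)` is undefined and `app` returns its default `∅`, which is
not the positive ordinal `c`. -/
theorem mem_j_of_ge {α : Ordinal.{u}} (h : ge c d α c) : α.toZFSet ∈ (ultE c d).j c.toZFSet := by
  obtain ⟨hle, f, hf, hfα⟩ := h
  by_contra hα
  have h1 := (Abs.j₂ (ultE c d) (R := fun X f => ∀ z ∈ f, ∃ x ∈ X, fst z = x ∧ z = ZFSet.pair x (snd z))
    ((absF_var 1).all (Q := fun z v => ∃ x ∈ v 0, fst z = x ∧ z = ZFSet.pair x (snd z))
      ((absF_var 1).ex (Q := fun x v => fst (v 0) = x ∧ v 0 = ZFSet.pair x (snd (v 0)))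
        (((absF_var 1).fst.eq (absF_var 0)).and
          ((absF_var 1).eq ((absF_var 0).pair (absF_var 1).snd))))) c.toZFSet f).2 (by
    intro z hz
    obtain ⟨x, hx, y, hy, rfl⟩ := ZFSet.mem_prod.1 ((ZFSet.mem_funs.1 hf).1 hz)
    exact ⟨x, hx, by simp, by simp⟩)
  have h2 : app ((ultE c d).j f) α.toZFSet = ∅ := app_eq_empty fun z hz => by
    obtain ⟨x, hx, h3, -⟩ := h1 _ hz
    rw [fst_pair] at h3
    exact hα (h3 ▸ hx)
  rw [h2] at hfα
  have := toZFSet_mem_toZFSet_iff.2 hS.crit_pos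
  rw [← hfα] at this
  exact ZFSet.notMem_empty _ this

/-- The identity on `c` witnesses reflexivity only at `α ∈ j_E(c)`, which is why `E_α ≥ E_c` is
assumed. -/
theorem ge_refl {α : Ordinal.{u}} (h : ge c d α c) : ge c d α α := by
  refine ⟨le_rfl, graphOn c.toZFSet id, ?_, ?_⟩
  · rw [ZFSet.mem_funs]
    refine ⟨fun z hz => ?_, fun z hz => ⟨z, ?_, fun w hw => ?_⟩⟩
    · obtain ⟨x, hx, rfl⟩ := mem_graphOn.1 hz
      exact ZFSet.pair_mem_prod.2 ⟨hx, hx⟩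
    · exact pair_mem_graphOn.2 ⟨hz, rfl⟩
    · exact (pair_mem_graphOn.1 hw).2
  · exact (Abs.j₂ (ultE c d) (R := fun X f => ∀ z ∈ X, app f z = z)
      ((absF_var 0).all (Q := fun z v => app (v 1) z = z)
        (((absF_var 2).app (absF_var 0)).eq (absF_var 0))) c.toZFSet _).2
      (fun z hz => app_graphOn hz) _ (mem_j_of_ge hS h)

theorem proj_self_eq {α : Ordinal.{u}} (hα : c ≤ α) (hα' : α < cs 3 c) {ν : ESeq.{u}}
    (hν : ν.code ∈ V_ c) : proj d α α ν = ν := by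
  have : (app (projOrd d α α) ν.a.toZFSet).rank = ν.a := by
    rw [hS.proj_self α hα hα', app_graphOn (toZFSet_mem_toZFSet_iff.2 (a_lt_of_code hν)), id,
      rank_toZFSet]
  rw [proj, this]

theorem projOrd_mem {α γ : Ordinal.{u}} (hγ : c ≤ γ) (hα' : α < cs 3 c) (hge : ge c d α γ)
    {ν : ESeq.{u}} (hν : ν.code ∈ V_ c) : ∃ i < c, i.toZFSet = app (projOrd d α γ) ν.a.toZFSet :=
  mem_toZFSet_iff.1 (app_mem_of_funs (hS.proj_spec α γ hγ hα' hge).1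
    (toZFSet_mem_toZFSet_iff.2 (a_lt_of_code hν)))

theorem big_proj_ne {α β γ : Ordinal.{u}} (hα : c ≤ α) (hα' : α < cs 3 c) (hβ : c ≤ β) (hγ : c ≤ γ)
    (h : ge c d α β) (h' : ge c d α γ) (hne : β ≠ γ) :
    Big c d α (ZFSet.sep (fun z => app (projOrd d α β) (fst (snd z)) ≠
      app (projOrd d α γ) (fst (snd z))) (V_ c)) :=
  big_sep hS hα hα' (Q := fun z (v : Fin 2 → ZFSet.{u}) =>
      app (v 0) (fst (snd z)) ≠ app (v 1) (fst (snd z)))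
    (((absF_var 1).app (absF_var 0).snd.fst).eq ((absF_var 2).app (absF_var 0).snd.fst)).not
    ![projOrd d α β, projOrd d α γ] fun τ _ => by
      change app ((ultE c d).j (projOrd d α β)) _ ≠ app ((ultE c d).j (projOrd d α γ)) _
      rw [fst_snd_xpt, (hS.proj_spec α β hβ hα' h).2, (hS.proj_spec α γ hγ hα' h').2]
      exact fun h => hne (toZFSet_injective h)

theorem big_proj_zero {α : Ordinal.{u}} (hα : c ≤ α) (hα' : α < cs 3 c) (h : ge c d α c) :
    Big c d α (ZFSet.sep (fun z => app (projOrd d α c) (fst (snd z)) = fst z) (V_ c)) :=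
  big_sep hS hα hα' (Q := fun z (v : Fin 1 → ZFSet.{u}) => app (v 0) (fst (snd z)) = fst z)
    (((absF_var 1).app (absF_var 0).snd.fst).eq (absF_var 0).fst)
    ![projOrd d α c] fun τ _ => by
      change app ((ultE c d).j (projOrd d α c)) _ = _
      rw [fst_snd_xpt, fst_xpt, (hS.proj_spec α c le_rfl hα' h).2]

theorem StarData.Valid.exists_gt {p : StarData.{u}} (hp : p.Valid c d) {ξ : Ordinal.{u}}
    (hξ : ξ < c) : ∃ y ∈ p.T, ξ < y.c := by
  obtain ⟨z, hz⟩ := ((hp.big hS).inter (big_gt hS hp.mc_dom.1 hp.mc_dom.2 hξ)).exists_mem hS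
  rw [ZFSet.mem_sep, mem_codes, ZFSet.mem_sep] at hz
  obtain ⟨⟨-, y, hy, rfl⟩, -, h⟩ := hz
  rw [fst_code, toZFSet_mem_toZFSet_iff] at h
  exact ⟨y, hy, h⟩

end proj

/-! ### Direct extensions with the same maximal coordinate -/

open Classical in
/-- The stems of `p`, with the stems `⟨y_γ⟩` at the new coordinates in `Z`. -/
noncomputable def newStem (p : StarData.{u}) (Z : Set Ordinal.{u}) (y : Ordinal.{u} → ESeq.{u})
    (γ : Ordinal.{u}) : List ESeq.{u} :=
  if γ ∈ p.supp then p.stem γ else if γ ∈ Z then [y γ] else []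

theorem StarData.Above.mono {c : Ordinal.{u}} {d : ZFSet.{u}} {p : StarData.{u}} {ξ η : Ordinal.{u}}
    (h : p.Above c d ξ) (hle : ξ ≤ η) : p.Above c d η := fun z hz => (h z hz).trans_le hle

/-- Collects what has to be checked for a direct extension that keeps the maximal coordinate: its
projection is the identity on `T`, so the commutation requirements are trivial. -/
theorem valid_and_leStar_of_newStem {c : Ordinal.{u}} {d : ZFSet.{u}} {p : StarData.{u}}
    (hS : IsSystem c d) (hp : p.Valid c d) {Z : Set Ordinal.{u}} {y : Ordinal.{u} → ESeq.{u}}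
    {T : Set ESeq.{u}} {f : ESeq.{u} → ZFSet.{u}} {F : ESeq.{u} → ESeq.{u} → ZFSet.{u}}
    (hZ : p.supp ⊆ Z) (hZ' : ∀ γ ∈ Z, (c ≤ γ ∧ γ < cs 3 c) ∧ ge c d p.mc γ)
    (hcard : #Z ≤ Cardinal.lift.{u + 1} c.card)
    (hy : ∀ γ, y γ ∈ p.T ∧ p.Above c d (y γ).c ∧ ∀ x ∈ p.stem c, x.a ≤ (y γ).a)
    (hT : T ⊆ p.T) (hbig : Big c d p.mc (codes c T))
    (hperm : ∀ ν ∈ T, #{γ | γ ∈ Z ∧ Permitted ν (newStem p Z y γ)} ≤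
      Cardinal.lift.{u + 1} ν.c.card)
    (hne : ∀ β ∈ Z, ∀ γ ∈ Z, ∀ ν ∈ T, β ≠ γ → Permitted ν (newStem p Z y β) →
      Permitted ν (newStem p Z y γ) → proj d p.mc β ν ≠ proj d p.mc γ ν)
    (hf : ∀ ν ∈ T, len ν.d = 0 → f ν ∈ Rstem (p.stem c) ν.c ∧ rle (f ν) (p.f ν))
    (hf' : ∀ ν, ¬ (ν ∈ T ∧ len ν.d = 0) → f ν = ∅)
    (hF : ∀ ν₁ ∈ T, ∀ ν₂ ∈ T, len ν₁.d = 0 → len ν₂.d = 0 →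
      F ν₁ ν₂ ∈ Rset ν₁.c ν₂.c ∧ rle (F ν₁ ν₂) (p.F ν₁ ν₂))
    (hF' : ∀ ν₁ ν₂, ¬ ((ν₁ ∈ T ∧ len ν₁.d = 0) ∧ ν₂ ∈ T ∧ len ν₂.d = 0) → F ν₁ ν₂ = ∅)
    (hgen : InGenE c d (twoStep (ultE c d) (V_ c) (xpt c d p.mc 0) (codeF F))) :
    (⟨p.mc, Z, newStem p Z y, T, f, F⟩ : StarData.{u}).Valid c d ∧
      (⟨p.mc, Z, newStem p Z y, T, f, F⟩ : StarData.{u}).LeStar c d p := by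
  have h0 : newStem p Z y c = p.stem c := if_pos hp.zero_mem
  have hV : ∀ ν ∈ T, ν.code ∈ V_ c := fun ν hν => (hp.T_ext ν (hT hν)).2
  have hself : ∀ ν ∈ T, proj d p.mc p.mc ν = ν := fun ν hν =>
    proj_self_eq hS hp.mc_dom.1 hp.mc_dom.2 (hV ν hν)
  have hgeself := ge_refl hS (hp.mc_ge c hp.zero_mem)
  constructor
  · refine
    { supp_dom := fun γ hγ => (hZ' γ hγ).1
      supp_card := hcard
      zero_mem := hZ hp.zero_mem
      stem_zero := ?_
      stem_ne := ?_
      stem_off := ?_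
      stem_le := ?_
      mc_dom := hp.mc_dom
      mc_ge := fun γ hγ => (hZ' γ hγ).2
      T_ext := fun ν hν => hp.T_ext ν (hT hν)
      T_mem := (mem_meas_iff hS hp.mc_dom.1 hp.mc_dom.2 ZFSet.sep_subset).2 hbig
      permitted_card := hperm
      proj_ne := hne
      f_mem := ?_
      f_off := hf'
      F_mem := fun x hx y hy hx0 hy0 => (hF x hx y hy hx0 hy0).1
      F_off := hF'
      F_gen := hgen }
    · change IsStemZero c (newStem p Z y c)
      rw [h0]; exact hp.stem_zero
    · intro γ hγ hγc
      change newStem p Z y γ ≠ [] ∧ (∀ x ∈ newStem p Z y γ, _) ∧ (newStem p Z y γ).Pairwise _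
      unfold newStem
      split_ifs with h1
      · exact hp.stem_ne γ h1 hγc
      · refine ⟨by simp, fun x hx => ?_, by simp⟩
        rw [List.mem_singleton.1 hx]
        exact hp.T_ext _ (hy γ).1
    · intro γ hγ
      change newStem p Z y γ = []
      unfold newStem
      rw [if_neg fun h => hγ (hZ h), if_neg hγ]
    · intro γ hγ x hx
      change x ∈ newStem p Z y c at hx
      rw [h0] at hx
      change ∃ t ∈ newStem p Z y γ, _
      unfold newStem
      split_ifs with h1
      · exact hp.stem_le γ h1 x hx
      · exact ⟨y γ, by simp, (hy γ).2.2 x hx⟩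
    · intro ν hν hν0
      change f ν ∈ Rstem (newStem p Z y c) ν.c
      rw [h0]; exact (hf ν hν hν0).1
  · refine
    { supp_sub := hZ
      stem_eq := fun γ hγ => if_pos hγ
      mc_ge := hgeself
      mc_mem := fun h => absurd rfl h
      new_stem := ?_
      T_sub := fun ν hν => by
        change proj d p.mc p.mc ν ∈ p.T
        rw [hself ν hν]; exact hT hν
      comm := fun γ _ ν hν _ => by
        change proj d p.mc γ ν = proj d p.mc γ (proj d p.mc p.mc ν)
        rw [hself ν hν]
      f_le := fun ν hν h0 => by
        change rle (f ν) (p.f (proj d p.mc p.mc ν))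
        rw [hself ν hν]; exact (hf ν hν h0).2
      F_le := fun ν hν μ hμ hν0 hμ0 => by
        change rle (F ν μ) (p.F (proj d p.mc p.mc ν) (proj d p.mc p.mc μ))
        rw [hself ν hν, hself μ hμ]; exact (hF ν hν μ hμ hν0 hμ0).2 }
    intro γ hγ hγ'
    change ∃ t ∈ newStem p Z y γ, _
    refine ⟨y γ, ?_, (hy γ).2.1⟩
    unfold newStem
    rw [if_neg hγ', if_pos hγ]
    simp

/-! ### Matched pairs -/

/-- Two elements of `P*_E` with isomorphic cones: they differ only in `f` and in the stems at
coordinates other than `κ`. -/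
structure Matched (c : Ordinal.{u}) (d : ZFSet.{u}) (P Q : StarData.{u}) : Prop where
  validP : P.Valid c d
  validQ : Q.Valid c d
  mc : Q.mc = P.mc
  supp : Q.supp = P.supp
  T : Q.T = P.T
  F : Q.F = P.F
  stem_zero : Q.stem c = P.stem c
  -- The stem at the maximal coordinate will record the point at which `f` was evaluated.
  mc_mem : P.mc ∈ P.supp
  perm : ∀ γ ∈ P.supp, ∀ ν ∈ P.T, (Permitted ν (P.stem γ) ↔ Permitted ν (Q.stem γ))
  -- In an extension by `ν` of positive length this stem goes to the block on `κ⁰(ν)`, where it must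
  -- lie in `V_{κ⁰(ν)}`; this has to hold on both sides or on neither.
  inV : ∀ γ ∈ P.supp, ∀ ν ∈ P.T, Permitted ν (P.stem γ) →
    ((∀ x ∈ P.stem γ, x.code ∈ V_ ν.c) ↔ ∀ x ∈ Q.stem γ, x.code ∈ V_ ν.c)
  proj_zero : ∀ ν ∈ P.T, (proj d P.mc c ν).a = ν.c
  perm_zero : ∀ ν ∈ P.T, Permitted ν (P.stem c)
  perm_mc : ∀ ν ∈ P.T, Permitted ν (P.stem P.mc)
  dom : ∀ ν ∈ P.T, len ν.d = 0 → ∀ i, SameDom (crd (P.f ν) i) (crd (Q.f ν) i)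
  col : ∀ ν ∈ P.T, len ν.d = 0 → colField (P.f ν) = colField (Q.f ν)

theorem exists_le_of_permitted {ν : ESeq.{u}} {l : List ESeq.{u}} (h : Permitted ν l)
    (h0 : 0 < ν.c) : ∃ δ < ν.c, ∀ z ∈ l, z.c ≤ δ := by
  induction l with
  | nil => exact ⟨0, h0, by simp⟩
  | cons a l ih =>
    obtain ⟨δ, h1, h2⟩ := ih fun z hz => h z (List.mem_cons_of_mem _ hz)
    refine ⟨max δ a.c, max_lt h1 (h a List.mem_cons_self), fun z hz => ?_⟩
    rcases List.mem_cons.1 hz with rfl | hz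
    · exact le_max_right _ _
    · exact (h2 z hz).trans (le_max_left _ _)

/-- A point `ν ∈ T` with `δ < κ⁰(ν)` is permitted to all these coordinates, so there are at most
`κ⁰(ν) < c` of them and regularity applies. -/
theorem StarData.Valid.bound_of_stem_le {c : Ordinal.{u}} {d : ZFSet.{u}} {p : StarData.{u}}
    (hS : IsSystem c d) (hp : p.Valid c d) {δ : Ordinal.{u}} (hδ : δ < c)
    (g : Ordinal.{u} → Ordinal.{u}) (hg : ∀ γ ∈ p.supp, g γ < c) :
    ∃ η < c, ∀ γ ∈ p.supp, (∀ z ∈ p.stem γ, z.c ≤ δ) → g γ < η := by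
  obtain ⟨ν, hν, hδν⟩ := hp.exists_gt hS hδ
  obtain ⟨η, h1, h2⟩ := hS.exists_bound_set (c_lt_of_code (hp.T_ext ν hν).2)
    (hp.permitted_card ν hν) g fun γ hγ => hg γ hγ.1
  exact ⟨η, h1, fun γ hγ h => h2 γ ⟨hγ, fun z hz => (h z hz).trans_lt hδν⟩⟩

theorem StarData.Valid.stem_mem {c : Ordinal.{u}} {d : ZFSet.{u}} {p : StarData.{u}}
    (hp : p.Valid c d) {γ : Ordinal.{u}} {x : ESeq.{u}} (hx : x ∈ p.stem γ) :
    x.IsExt ∧ x.code ∈ V_ c := by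
  by_cases hγ : γ ∈ p.supp
  · by_cases hγc : γ = c
    · subst hγc
      rcases hp.stem_zero with h | ⟨y, h, h1, h2, -⟩
      · rw [h] at hx; simp at hx
      · rw [h, List.mem_singleton] at hx
        subst hx
        exact ⟨h1, h2⟩
    · exact (hp.stem_ne γ hγ hγc).2.1 x hx
  · rw [hp.stem_off γ hγ] at hx; simp at hx

/-- The support becomes the union of both supports and the maximal coordinate, enumerated in order
type at most `c`. `T` is shrunk so that `κ⁰(ν)` is closed under `η` and under the stem bounds `M`: a
coordinate to which `ν` is permitted on either side then has its index below `κ⁰(ν)`, and both of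
its stems lie in `V_{κ⁰(ν)}`. This yields equal permission and the cardinality bound together. -/
theorem exists_matched {c : Ordinal.{u}} {d : ZFSet.{u}} {p q : StarData.{u}} (hS : IsSystem c d)
    (hp : p.Valid c d) (hq : q.Valid c d) (hmc : q.mc = p.mc) (hT : q.T = p.T)
    (hstem : q.stem c = p.stem c) :
    ∃ P Q : StarData.{u}, P.LeStar c d p ∧ Q.LeStar c d q ∧ Matched c d P Q := by
  classical
  obtain ⟨α, hαdef⟩ : ∃ α, α = p.mc := ⟨_, rfl⟩
  have hα := hp.mc_dom
  rw [← hαdef] at hα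
  have hαc := hp.mc_ge c hp.zero_mem
  rw [← hαdef] at hαc
  have hgeself := ge_refl hS hαc
  set Z : Set Ordinal.{u} := p.supp ∪ q.supp ∪ {α} with hZdef
  have hpZ : p.supp ⊆ Z := fun γ h => Or.inl (Or.inl h)
  have hqZ : q.supp ⊆ Z := fun γ h => Or.inl (Or.inr h)
  have hαZ : α ∈ Z := Or.inr rfl
  have hZ : ∀ γ ∈ Z, (c ≤ γ ∧ γ < cs 3 c) ∧ ge c d α γ := by
    rintro γ ((h | h) | rfl)
    · exact ⟨hp.supp_dom γ h, hαdef ▸ hp.mc_ge γ h⟩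
    · exact ⟨hq.supp_dom γ h, by rw [hαdef, ← hmc]; exact hq.mc_ge γ h⟩
    · exact ⟨hα, hgeself⟩
  have haleph : ℵ₀ ≤ Cardinal.lift.{u + 1} c.card := by
    rw [Cardinal.aleph0_le_lift]; exact hS.aleph0_le
  have hcard : #Z ≤ Cardinal.lift.{u + 1} c.card := by
    refine (Cardinal.mk_union_le _ _).trans (Cardinal.add_le_of_le haleph
      ((Cardinal.mk_union_le _ _).trans (Cardinal.add_le_of_le haleph hp.supp_card hq.supp_card)) ?_)
    rw [Cardinal.mk_singleton]
    exact Cardinal.one_le_aleph0.trans haleph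
  -- new stems
  obtain ⟨ξp, hξp, hpA⟩ := hp.exists_above hS
  obtain ⟨ξq, hξq, hqA⟩ := hq.exists_above hS
  -- The new entry at `γ` lies above the bounds of `p` and `q`, above `κ(p^0)`, and above the old
  -- stems at `γ`, so a point permitted to `[y γ]` is permitted to the old stem of the other side.
  have hy : ∀ γ, ∃ y ∈ p.T, ξp < y.c ∧ ξq < y.c ∧ (∀ z ∈ p.stem γ, z.c < y.c) ∧
      (∀ z ∈ q.stem γ, z.c < y.c) ∧ ∀ x ∈ p.stem c, x.a < y.c := by
    intro γ
    obtain ⟨η, hη, h⟩ := hS.exists_bound_list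
      (ξp :: ξq :: ((p.stem γ).map ESeq.c ++ (q.stem γ).map ESeq.c ++ (p.stem c).map ESeq.a)) (by
        intro x hx
        simp only [List.mem_cons, List.mem_append, List.mem_map] at hx
        rcases hx with rfl | rfl | (⟨z, hz, rfl⟩ | ⟨z, hz, rfl⟩) | ⟨z, hz, rfl⟩
        · exact hξp
        · exact hξq
        · exact c_lt_of_code (hp.stem_mem hz).2
        · exact c_lt_of_code (hq.stem_mem hz).2
        · exact a_lt_of_code (hp.stem_mem hz).2)
    obtain ⟨y, hyT, hyη⟩ := hp.exists_gt hS hη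
    refine ⟨y, hyT, (h _ ?_).trans hyη, (h _ ?_).trans hyη, fun z hz => (h _ ?_).trans hyη,
      fun z hz => (h _ ?_).trans hyη, fun z hz => (h _ ?_).trans hyη⟩
    · simp
    · simp
    · exact List.mem_cons_of_mem _ (List.mem_cons_of_mem _ (List.mem_append_left _
        (List.mem_append_left _ (List.mem_map_of_mem hz))))
    · exact List.mem_cons_of_mem _ (List.mem_cons_of_mem _ (List.mem_append_left _
        (List.mem_append_right _ (List.mem_map_of_mem hz))))
    · exact List.mem_cons_of_mem _ (List.mem_cons_of_mem _ (List.mem_append_right _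
        (List.mem_map_of_mem hz)))
  choose y hyT hyp hyq hyps hyqs hya using hy
  set sP := newStem p Z y with hsP
  set sQ := newStem q Z y with hsQ
  have hsPV : ∀ γ, ∀ z ∈ sP γ, z.code ∈ V_ c := by
    intro γ z hz
    simp only [hsP, newStem] at hz
    split_ifs at hz
    · exact (hp.stem_mem hz).2
    · rw [List.mem_singleton.1 hz]; exact (hp.T_ext _ (hyT γ)).2
    · simp at hz
  have hsQV : ∀ γ, ∀ z ∈ sQ γ, z.code ∈ V_ c := by
    intro γ z hz
    simp only [hsQ, newStem] at hz
    split_ifs at hz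
    · exact (hq.stem_mem hz).2
    · rw [List.mem_singleton.1 hz]; exact (hp.T_ext _ (hyT γ)).2
    · simp at hz
  have hM : ∀ γ, ∃ η < c, (∀ z ∈ sP γ, z.code.rank < η) ∧ ∀ z ∈ sQ γ, z.code.rank < η := by
    intro γ
    obtain ⟨η, hη, h⟩ := hS.exists_bound_list
      ((sP γ).map (fun z => z.code.rank) ++ (sQ γ).map fun z => z.code.rank) (by
        intro x hx
        simp only [List.mem_append, List.mem_map] at hx
        rcases hx with ⟨z, hz, rfl⟩ | ⟨z, hz, rfl⟩
        · exact mem_vonNeumann.1 (hsPV γ z hz)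
        · exact mem_vonNeumann.1 (hsQV γ z hz))
    exact ⟨η, hη, fun z hz => h _ (List.mem_append_left _ (List.mem_map.2 ⟨z, hz, rfl⟩)),
      fun z hz => h _ (List.mem_append_right _ (List.mem_map.2 ⟨z, hz, rfl⟩))⟩
  choose M hMc hMP hMQ using hM
  -- an enumeration of the support
  have hidx : ∃ idx en : Ordinal.{u} → Ordinal.{u}, (∀ γ ∈ Z, idx γ < c ∧ en (idx γ) = γ) ∧
      ∀ i, en i ∈ Z := by
    have h0 : #Z ≤ #(Set.Iio c) := by rwa [Cardinal.mk_Iio_ordinal]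
    obtain ⟨f⟩ := h0
    refine ⟨fun γ => if h : γ ∈ Z then f ⟨γ, h⟩ else 0,
      fun i => if h : ∃ a : Z, (f a : Ordinal) = i then h.choose else α, fun γ hγ => ?_, fun i => ?_⟩
    · simp only [dif_pos hγ]
      have h3 : ∃ a : Z, (f a : Ordinal) = f ⟨γ, hγ⟩ := ⟨_, rfl⟩
      rw [dif_pos h3]
      have h5 : h3.choose = ⟨γ, hγ⟩ := f.injective (Subtype.ext h3.choose_spec)
      exact ⟨(f ⟨γ, hγ⟩).2, congrArg Subtype.val h5⟩
    · dsimp only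
      split_ifs with h
      · exact h.choose.2
      · exact hαZ
  obtain ⟨idx, en, hidx, hen⟩ := hidx
  have hη : ∀ δ, ∃ η, (δ < c → η < c) ∧ ∀ γ ∈ Z, (∀ z ∈ sP γ, z.c ≤ δ) ∨ (∀ z ∈ sQ γ, z.c ≤ δ) →
      idx γ < η := by
    intro δ
    by_cases hδ : δ < c
    · obtain ⟨η₁, h1, h1'⟩ := hp.bound_of_stem_le hS hδ idx fun γ hγ => (hidx γ (hpZ hγ)).1
      obtain ⟨η₂, h2, h2'⟩ := hq.bound_of_stem_le hS hδ idx fun γ hγ => (hidx γ (hqZ hγ)).1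
      -- The maximal coordinate may lie in neither support, so its index is added separately. For
      -- the others, a new stem `[y γ]` below `δ` forces the old stem at `γ` below `δ`.
      refine ⟨max (Order.succ (idx α)) (max η₁ η₂), fun _ => max_lt (hS.succ_lt (hidx α hαZ).1)
        (max_lt h1 h2), fun γ hγ hor => ?_⟩
      by_cases hγα : γ = α
      · subst hγα
        exact lt_max_of_lt_left (Order.lt_succ _)
      · refine lt_max_of_lt_right ?_
        rw [lt_max_iff]
        have hγ' : γ ∈ p.supp ∨ γ ∈ q.supp := hγ.resolve_right hγα
        by_cases hγp : γ ∈ p.supp <;> by_cases hγq : γ ∈ q.supp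
        · simp only [hsP, hsQ, newStem, if_pos hγp, if_pos hγq] at hor
          exact hor.imp (h1' γ hγp) (h2' γ hγq)
        · simp only [hsP, hsQ, newStem, if_pos hγp, if_neg hγq, if_pos hγ] at hor
          refine Or.inl (h1' γ hγp ?_)
          rcases hor with hor | hor
          · exact hor
          · exact fun z hz => (hyps γ z hz).le.trans (hor _ (by simp))
        · simp only [hsP, hsQ, newStem, if_neg hγp, if_pos hγq, if_pos hγ] at hor
          refine Or.inr (h2' γ hγq ?_)
          rcases hor with hor | hor
          · exact fun z hz => (hyqs γ z hz).le.trans (hor _ (by simp))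
          · exact hor
        · exact absurd hγ' (by tauto)
    -- A default for `δ ≥ c`: any value above all indices serves.
    · refine ⟨max (Order.succ (⨆ γ : {γ // idx γ < c}, idx γ)) c, fun h => absurd h hδ,
        fun γ hγ _ => lt_max_of_lt_right (hidx γ hγ).1⟩
  choose η hηc hη using hη
  -- a set of measure one
  obtain ⟨X₀, hX₀, hX₀big, hX₀compat⟩ := exists_big_compat hS hp hq hmc hT
  rw [← hαdef] at hX₀big
  -- Points above `δ₀` are permitted to the stem at `c` and to both stems at the maximal coordinate.
  obtain ⟨δ₀, hδ₀, hδ₀'⟩ := hS.exists_bound_list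
    ((sP c).map ESeq.c ++ (sP α).map ESeq.c ++ (sQ α).map ESeq.c) (by
      intro x hx
      simp only [List.mem_append, List.mem_map] at hx
      rcases hx with (⟨z, hz, rfl⟩ | ⟨z, hz, rfl⟩) | ⟨z, hz, rfl⟩
      · exact c_lt_of_code (hsPV _ z hz)
      · exact c_lt_of_code (hsPV _ z hz)
      · exact c_lt_of_code (hsQV _ z hz))
  have hB1 := big_gt hS hα.1 hα.2 hδ₀
  have hB2 := big_proj_zero hS hα.1 hα.2 hαc
  have hB3 := big_diag hS hα.1 hα.2
    (X := fun i => ZFSet.sep (fun z => (η i).toZFSet ∈ fst z) (V_ c)) fun i hi =>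
      big_gt hS hα.1 hα.2 (hηc i hi)
  have hB4 := big_diag hS hα.1 hα.2
    (X := fun i => ZFSet.sep (fun z => (M (en i)).toZFSet ∈ fst z) (V_ c)) fun i _ =>
      big_gt hS hα.1 hα.2 (hMc (en i))
  -- A double diagonal intersection: distinct coordinates with indices below `κ⁰(ν)` receive
  -- distinct projections of `ν`.
  have hB5 := big_diag hS hα.1 hα.2
    (X := fun i => ZFSet.sep (fun z => ∀ k < c, k.toZFSet ∈ fst z →
      z ∈ if en i = en k then V_ c else ZFSet.sep (fun z => app (projOrd d α (en i)) (fst (snd z)) ≠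
        app (projOrd d α (en k)) (fst (snd z))) (V_ c)) (V_ c)) fun i _ =>
      big_diag hS hα.1 hα.2 fun k _ => by
        split_ifs with h
        · exact big_univ hS hα.1 hα.2
        · exact big_proj_ne hS hα.1 hα.2 (hZ _ (hen i)).1.1 (hZ _ (hen k)).1.1 (hZ _ (hen i)).2
            (hZ _ (hen k)).2 h
  have hBig := (((((hp.big hS).inter (hαdef ▸ hX₀big)).inter (hαdef ▸ hB1)).inter
    (hαdef ▸ hB2)).inter (hαdef ▸ hB3)).inter (hαdef ▸ (hB4.inter hB5))
  rw [← hαdef] at hBig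
  set T : Set ESeq.{u} := {ν | ν ∈ p.T ∧ ν.code ∈ X₀ ∧ δ₀ < ν.c ∧
    app (projOrd d α c) ν.a.toZFSet = ν.c.toZFSet ∧ (∀ i < ν.c, η i < ν.c) ∧
    (∀ i < ν.c, M (en i) < ν.c) ∧ ∀ i < ν.c, ∀ k < ν.c, en i ≠ en k →
      app (projOrd d α (en i)) ν.a.toZFSet ≠ app (projOrd d α (en k)) ν.a.toZFSet} with hTdef
  have hTbig : Big c d α (codes c T) := by
    refine hBig.mono fun z hz => ?_
    simp only [ZFSet.mem_sep] at hz
    obtain ⟨⟨⟨⟨⟨hz, hz0⟩, hz1⟩, hz2⟩, hz3⟩, hz4, hz5⟩ := hz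
    obtain ⟨hzV, ν, hν, rfl⟩ := mem_codes.1 hz
    simp only [fst_code, fst_snd_code, toZFSet_mem_toZFSet_iff] at hz1 hz2 hz3 hz4 hz5
    have hνc := c_lt_of_code hzV
    refine mem_codes.2 ⟨hzV, ν, ⟨hν, hz0, hz1.2, hz2.2, fun i hi => (hz3.2 i (hi.trans hνc) hi).2,
      fun i hi => (hz4.2 i (hi.trans hνc) hi).2, fun i hi k hk hik => ?_⟩, rfl⟩
    have := (hz5.2 i (hi.trans hνc) hi).2 k (hk.trans hνc) hk
    rw [if_neg hik, ZFSet.mem_sep, fst_snd_code] at this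
    exact this.2
  have hTsub : T ⊆ p.T := fun ν hν => hν.1
  have hTV : ∀ ν ∈ T, ν.code ∈ V_ c := fun ν hν => (hp.T_ext ν hν.1).2
  -- From permission on one side: the finite stem is bounded by some `δ < κ⁰(ν)`, closure under `η`
  -- bounds the index of `γ`, and closure under `M` bounds both stems.
  have hkey : ∀ ν ∈ T, ∀ γ ∈ Z, (Permitted ν (sP γ) ∨ Permitted ν (sQ γ)) →
      idx γ < ν.c ∧ (∀ z ∈ sP γ, z.code ∈ V_ ν.c) ∧ ∀ z ∈ sQ γ, z.code ∈ V_ ν.c := by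
    intro ν hν γ hγ hor
    obtain ⟨-, -, h1, -, h3, h4, -⟩ := hν
    have h0 : 0 < ν.c := (zero_le).trans_lt h1
    have hi : idx γ < ν.c := by
      rcases hor with h | h
      · obtain ⟨δ, hδ, h⟩ := exists_le_of_permitted h h0
        exact (hη δ γ hγ (Or.inl h)).trans (h3 δ hδ)
      · obtain ⟨δ, hδ, h⟩ := exists_le_of_permitted h h0
        exact (hη δ γ hγ (Or.inr h)).trans (h3 δ hδ)
    have hMν := h4 _ hi
    rw [(hidx γ hγ).2] at hMν
    exact ⟨hi, fun z hz => mem_vonNeumann.2 ((hMP γ z hz).trans hMν),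
      fun z hz => mem_vonNeumann.2 ((hMQ γ z hz).trans hMν)⟩
  have hpermP : ∀ ν ∈ T, ∀ γ ∈ Z, (Permitted ν (sP γ) ∨ Permitted ν (sQ γ)) →
      Permitted ν (sP γ) ∧ Permitted ν (sQ γ) := fun ν hν γ hγ h =>
    ⟨fun z hz => c_lt_of_code ((hkey ν hν γ hγ h).2.1 z hz),
      fun z hz => c_lt_of_code ((hkey ν hν γ hγ h).2.2 z hz)⟩
  have hcardS : ∀ ν ∈ T, ∀ s : Ordinal.{u} → List ESeq.{u},
      (∀ γ, Permitted ν (s γ) → Permitted ν (sP γ) ∨ Permitted ν (sQ γ)) →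
      #{γ | γ ∈ Z ∧ Permitted ν (s γ)} ≤ Cardinal.lift.{u + 1} ν.c.card := by
    intro ν hν s hs
    rw [← Cardinal.mk_Iio_ordinal]
    refine Cardinal.mk_le_of_injective (f := fun γ => (⟨idx γ.1,
      (hkey ν hν γ.1 γ.2.1 (hs _ γ.2.2)).1⟩ : Set.Iio ν.c)) fun a b hab => ?_
    have h1 : idx a.1 = idx b.1 := congrArg Subtype.val hab
    have h2 := (hidx a.1 a.2.1).2
    rw [h1, (hidx b.1 b.2.1).2] at h2
    exact Subtype.ext h2.symm
  have hprojne : ∀ β ∈ Z, ∀ γ ∈ Z, ∀ ν ∈ T, β ≠ γ → (Permitted ν (sP β) ∨ Permitted ν (sQ β)) →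
      (Permitted ν (sP γ) ∨ Permitted ν (sQ γ)) → proj d α β ν ≠ proj d α γ ν := by
    intro β hβ γ hγ ν hν hne h1 h2 heq
    have h3 := hν.2.2.2.2.2.2 _ (hkey ν hν β hβ h1).1 _ (hkey ν hν γ hγ h2).1
    rw [(hidx β hβ).2, (hidx γ hγ).2] at h3
    refine h3 hne ?_
    obtain ⟨i, -, hi⟩ := projOrd_mem hS (hZ β hβ).1.1 hα.2 (hZ β hβ).2 (hTV ν hν)
    obtain ⟨k, -, hk⟩ := projOrd_mem hS (hZ γ hγ).1.1 hα.2 (hZ γ hγ).2 (hTV ν hν)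
    have h4 := congrArg ESeq.a heq
    simp only [proj] at h4
    rw [← hi, ← hk, rank_toZFSet, rank_toZFSet] at h4
    rw [← hi, ← hk, h4]
  -- the functions `f`
  have hf : ∀ ν, ∃ r s : ZFSet.{u}, (ν ∈ T ∧ len ν.d = 0 → r ∈ Rstem (p.stem c) ν.c ∧
      s ∈ Rstem (p.stem c) ν.c ∧ rle r (p.f ν) ∧ rle s (q.f ν) ∧
      (∀ i, SameDom (crd r i) (crd s i)) ∧ colField r = colField s) ∧
      (¬ (ν ∈ T ∧ len ν.d = 0) → r = ∅ ∧ s = ∅) := by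
    intro ν
    by_cases h : ν ∈ T ∧ len ν.d = 0
    · obtain ⟨r, hr, s, hs, h1⟩ := (isR_Rstem (p.stem c) ν.c).exists_sameDom
        (hp.f_mem ν h.1.1 h.2) (hstem ▸ hq.f_mem ν (hT ▸ h.1.1) h.2)
      exact ⟨r, s, fun _ => ⟨hr, hs, h1⟩, fun h' => absurd h h'⟩
    · exact ⟨∅, ∅, fun h' => absurd h' h, fun _ => ⟨rfl, rfl⟩⟩
  choose fP fQ hfPQ hfoff using hf
  -- the function `F`
  have hF : ∀ ν₁ ∈ T, ∀ ν₂ ∈ T, len ν₁.d = 0 → len ν₂.d = 0 →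
      joinF T p.F q.F ν₁ ν₂ ∈ Rset ν₁.c ν₂.c ∧ rle (joinF T p.F q.F ν₁ ν₂) (p.F ν₁ ν₂) ∧
        rle (joinF T p.F q.F ν₁ ν₂) (q.F ν₁ ν₂) := by
    intro x hx z hz hx0 hz0
    have hR := isR_Rset x.c z.c
    have h1 := hp.F_mem x hx.1 z hz.1 hx0 hz0
    have h2 := hq.F_mem x (hT ▸ hx.1) z (hT ▸ hz.1) hx0 hz0
    rw [joinF, if_pos ⟨⟨hx, hx0⟩, hz, hz0⟩]
    exact ⟨hR.join_mem h1 h2 (hX₀compat x hx.1 z hz.1 hx.2.1 hz.2.1 hx0 hz0),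
      hR.join_rle_left h1, hR.join_rle_right h2⟩
  have hF' : ∀ ν₁ ν₂, ¬ ((ν₁ ∈ T ∧ len ν₁.d = 0) ∧ ν₂ ∈ T ∧ len ν₂.d = 0) →
      joinF T p.F q.F ν₁ ν₂ = ∅ := fun ν₁ ν₂ h => if_neg h
  have hqgen := hq.F_gen
  rw [hmc] at hqgen
  have hgen := inGenE_joinF hS (hαdef ▸ hTbig) hp.F_gen hqgen
  obtain ⟨hPv, hPle⟩ := valid_and_leStar_of_newStem hS hp (Z := Z) (y := y) (T := T) (f := fP)
    (F := joinF T p.F q.F) hpZ (by rw [← hαdef]; exact hZ) hcard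
    (fun γ => ⟨hyT γ, hpA.mono (hyp γ).le, fun x hx =>
      (hya γ x hx).le.trans (hp.T_ext _ (hyT γ)).1.1⟩) hTsub (by rw [← hαdef]; exact hTbig)
    (fun ν hν => hcardS ν hν sP fun _ => Or.inl)
    (fun β hβ γ hγ ν hν hne h1 h2 => by
      rw [← hαdef]; exact hprojne β hβ γ hγ ν hν hne (Or.inl h1) (Or.inl h2))
    (fun ν hν h0 => ⟨(hfPQ ν ⟨hν, h0⟩).1, (hfPQ ν ⟨hν, h0⟩).2.2.1⟩)
    (fun ν h => ((hfoff ν) h).1)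
    (fun x hx z hz hx0 hz0 => ⟨(hF x hx z hz hx0 hz0).1, (hF x hx z hz hx0 hz0).2.1⟩) hF' hgen
  obtain ⟨hQv, hQle⟩ := valid_and_leStar_of_newStem hS hq (Z := Z) (y := y) (T := T) (f := fQ)
    (F := joinF T p.F q.F) hqZ (by rw [hmc, ← hαdef]; exact hZ) hcard
    (fun γ => ⟨hT ▸ hyT γ, hqA.mono (hyq γ).le, fun x hx =>
      (hya γ x (hstem ▸ hx)).le.trans (hp.T_ext _ (hyT γ)).1.1⟩) (hT ▸ hTsub)
    (by rw [hmc, ← hαdef]; exact hTbig)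
    (fun ν hν => hcardS ν hν sQ fun _ => Or.inr)
    (fun β hβ γ hγ ν hν hne h1 h2 => by
      rw [hmc, ← hαdef]; exact hprojne β hβ γ hγ ν hν hne (Or.inr h1) (Or.inr h2))
    (fun ν hν h0 => ⟨hstem ▸ (hfPQ ν ⟨hν, h0⟩).2.1, (hfPQ ν ⟨hν, h0⟩).2.2.2.1⟩)
    (fun ν h => ((hfoff ν) h).2)
    (fun x hx z hz hx0 hz0 => ⟨(hF x hx z hz hx0 hz0).1, (hF x hx z hz hx0 hz0).2.2⟩) hF'
    (by rw [hmc]; exact hgen)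
  have hsPc : sP c = p.stem c := if_pos hp.zero_mem
  have hsQc : sQ c = p.stem c := (if_pos hq.zero_mem).trans hstem
  refine ⟨_, _, hPle, hQle, ⟨hPv, hQv, hmc, rfl, rfl, rfl, hsQc.trans hsPc.symm,
    by rw [← hαdef]; exact hαZ, fun γ hγ ν hν => ⟨fun h => (hpermP ν hν γ hγ (Or.inl h)).2,
      fun h => (hpermP ν hν γ hγ (Or.inr h)).1⟩, fun γ hγ ν hν h => ?_, fun ν hν => ?_,
    fun ν hν z hz => ?_, fun ν hν z hz => ?_, fun ν hν h0 => (hfPQ ν ⟨hν, h0⟩).2.2.2.2.1,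
    fun ν hν h0 => (hfPQ ν ⟨hν, h0⟩).2.2.2.2.2⟩⟩
  · have := hkey ν hν γ hγ (Or.inl h)
    exact ⟨fun _ => this.2.2, fun _ => this.2.1⟩
  · change (proj d p.mc c ν).a = ν.c
    simp only [proj]
    rw [← hαdef, hν.2.2.2.1, rank_toZFSet]
  · refine (hδ₀' _ ?_).trans hν.2.2.1
    exact List.mem_append_left _ (List.mem_append_left _ (List.mem_map_of_mem hz))
  · refine (hδ₀' _ ?_).trans hν.2.2.1
    change z ∈ sP p.mc at hz
    rw [← hαdef] at hz
    exact List.mem_append_left _ (List.mem_append_right _ (List.mem_map_of_mem hz))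

/-! ### Matched elements of `P*` along a system of tracked coordinates -/

theorem permitted_append {ν : ESeq.{u}} {l l' : List ESeq.{u}} :
    Permitted ν (l ++ l') ↔ Permitted ν l ∧ Permitted ν l' := List.forall_mem_append

theorem permitted_singleton {ν y : ESeq.{u}} : Permitted ν [y] ↔ y.c < ν.c := List.forall_mem_singleton

theorem Matched.symm {c : Ordinal.{u}} {d : ZFSet.{u}} {P Q : StarData.{u}} (h : Matched c d P Q) :
    Matched c d Q P where
  validP := h.validQ
  validQ := h.validP
  mc := h.mc.symm
  supp := h.supp.symm
  T := h.T.symm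
  F := h.F.symm
  stem_zero := h.stem_zero.symm
  mc_mem := by rw [h.mc, h.supp]; exact h.mc_mem
  perm := fun γ hγ ν hν => (h.perm γ (h.supp ▸ hγ) ν (h.T ▸ hν)).symm
  inV := fun γ hγ ν hν hp => (h.inV γ (h.supp ▸ hγ) ν (h.T ▸ hν)
    ((h.perm γ (h.supp ▸ hγ) ν (h.T ▸ hν)).2 hp)).symm
  proj_zero := fun ν hν => by rw [h.mc]; exact h.proj_zero ν (h.T ▸ hν)
  perm_zero := fun ν hν => by rw [h.stem_zero]; exact h.perm_zero ν (h.T ▸ hν)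
  perm_mc := fun ν hν => by
    rw [h.mc]
    exact (h.perm _ h.mc_mem ν (h.T ▸ hν)).1 (h.perm_mc ν (h.T ▸ hν))
  dom := fun ν hν h0 i => (h.dom ν (h.T ▸ hν) h0 i).symm
  col := fun ν hν h0 => (h.col ν (h.T ▸ hν) h0).symm

/-- `s` and `s'` are elements of `P*` of the system given by `d` on `c` which occur in
corresponding extensions of `P` and `Q`. The coordinate `γ₀` of `P` and `Q` is now found at the
coordinate `t γ₀`, which consists of a critical point and of an index. -/
structure StarRel (c₀ : Ordinal.{u}) (P Q : StarData.{u})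
    (t : Ordinal.{u} → Ordinal.{u} × Ordinal.{u}) (c : Ordinal.{u}) (d : ZFSet.{u})
    (s s' : StarData.{u}) : Prop where
  sys : IsSystem c d
  valid : s.Valid c d
  valid' : s'.Valid c d
  mc : s'.mc = s.mc
  supp : s'.supp = s.supp
  T : s'.T = s.T
  F : s'.F = s.F
  zero : s'.stem c = s.stem c
  perm : ∀ γ ∈ s.supp, ∀ ν ∈ s.T, (Permitted ν (s.stem γ) ↔ Permitted ν (s'.stem γ))
  inV : ∀ γ ∈ s.supp, ∀ ν ∈ s.T, Permitted ν (s.stem γ) →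
    ((∀ x ∈ s.stem γ, x.code ∈ V_ ν.c) ↔ ∀ x ∈ s'.stem γ, x.code ∈ V_ ν.c)
  proj_zero : ∀ ν ∈ s.T, Permitted ν (s.stem c) → (proj d s.mc c ν).a = ν.c
  -- The tail `w` consists of later additions and is the same on both sides.
  tracked : ∀ γ₀ ∈ P.supp, γ₀ ≠ c₀ → ∀ γ, t γ₀ = (c, γ) → γ ∈ s.supp ∧ γ ≠ c ∧
    ∃ w, s.stem γ = P.stem γ₀ ++ w ∧ s'.stem γ = Q.stem γ₀ ++ w
  untracked : ∀ γ, (∀ γ₀ ∈ P.supp, γ₀ ≠ c₀ → t γ₀ ≠ (c, γ)) → s'.stem γ = s.stem γ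
  -- While `p^0` is still that of `P`, the values of `f` lie below those of `P.f`, evaluated along
  -- the projection to `δ`, the current place of `P.mc`.
  active : s.stem c = P.stem c₀ → ∃ δ ∈ s.supp, (P.mc = c₀ → δ = c) ∧
    (P.mc ≠ c₀ → t P.mc = (c, δ)) ∧ s.stem δ = P.stem P.mc ∧ s'.stem δ = Q.stem P.mc ∧
    (∀ ν ∈ s.T, Permitted ν (s.stem δ)) ∧ ∀ x ∈ s.T, len x.d = 0 → proj d s.mc δ x ∈ P.T ∧
      rle (s.f x) (P.f (proj d s.mc δ x)) ∧
      s'.f x = modf (P.f (proj d s.mc δ x)) (Q.f (proj d s.mc δ x)) (s.f x)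
  -- Once `p^0` has been replaced, `f` stems from the common `F`.
  passive : s.stem c ≠ P.stem c₀ → s'.f = s.f ∧ ∃ x, s.stem c = [x] ∧ ∀ z ∈ P.stem c₀, z.c < x.c

/-! ### Symmetry and direct extensions of corresponding elements. -/

section

variable {c₀ c : Ordinal.{u}} {d₀ d : ZFSet.{u}} {P Q s s' : StarData.{u}}
  {t : Ordinal.{u} → Ordinal.{u} × Ordinal.{u}}

theorem Matched.f_mem (hM : Matched c₀ d₀ P Q) {y : ESeq.{u}} (hy : y ∈ P.T) (h0 : len y.d = 0) :
    P.f y ∈ Rstem (P.stem c₀) y.c ∧ Q.f y ∈ Rstem (P.stem c₀) y.c :=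
  ⟨hM.validP.f_mem y hy h0, hM.stem_zero ▸ hM.validQ.f_mem y (hM.T ▸ hy) h0⟩

theorem StarRel.col (hM : Matched c₀ d₀ P Q) (h : StarRel c₀ P Q t c d s s') (x : ESeq.{u}) :
    colField (s.f x) = colField (s'.f x) := by
  by_cases ha : s.stem c = P.stem c₀
  · by_cases hx : x ∈ s.T ∧ len x.d = 0
    · obtain ⟨δ, -, -, -, -, -, -, h2⟩ := h.active ha
      obtain ⟨h3, h4, h5⟩ := h2 x hx.1 hx.2
      rw [h5, colField_modf h4 (hM.col _ h3 hx.2)]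
    · rw [h.valid.f_off x hx, h.valid'.f_off x (by rwa [h.T])]
  · rw [(h.passive ha).1]

theorem StarRel.above_iff (hM : Matched c₀ d₀ P Q) (h : StarRel c₀ P Q t c d s s')
    (ξ : Ordinal.{u}) : s.Above c d ξ ↔ s'.Above c d ξ :=
  above_congr h.sys h.valid.mc_dom h.mc (h.col hM) ξ

theorem StarRel.symm (hM : Matched c₀ d₀ P Q) (h : StarRel c₀ P Q t c d s s') :
    StarRel c₀ Q P t c d s' s where
  sys := h.sys
  valid := h.valid'
  valid' := h.valid
  mc := h.mc.symm
  supp := h.supp.symm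
  T := h.T.symm
  F := h.F.symm
  zero := h.zero.symm
  perm := fun γ hγ ν hν => (h.perm γ (h.supp ▸ hγ) ν (h.T ▸ hν)).symm
  inV := fun γ hγ ν hν hp => (h.inV γ (h.supp ▸ hγ) ν (h.T ▸ hν)
    ((h.perm γ (h.supp ▸ hγ) ν (h.T ▸ hν)).2 hp)).symm
  proj_zero := fun ν hν hp => by
    rw [h.mc]; exact h.proj_zero ν (h.T ▸ hν) (by rwa [h.zero] at hp)
  tracked := fun γ₀ h₀ hne γ hγ => by
    obtain ⟨h1, h4, w, h2, h3⟩ := h.tracked γ₀ (hM.supp ▸ h₀) hne γ hγ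
    exact ⟨h.supp ▸ h1, h4, w, h3, h2⟩
  untracked := fun γ hγ => (h.untracked γ fun γ₀ h₀ => hγ γ₀ (hM.supp ▸ h₀)).symm
  active := fun ha => by
    rw [h.zero, hM.stem_zero] at ha
    obtain ⟨δ, h1, h2, h3, h4, h5, h6, h7⟩ := h.active ha
    rw [hM.mc, h.supp, h.T, h.mc, hM.T]
    refine ⟨δ, h1, h2, h3, h5, h4, fun ν hν => (h.perm δ h1 ν hν).1 (h6 ν hν), fun x hx h0 => ?_⟩
    obtain ⟨h8, h9, h10⟩ := h7 x hx h0
    obtain ⟨hP, hQ⟩ := hM.f_mem h8 h0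
    have hR := isR_Rstem (P.stem c₀) x.c
    have hs := h.valid.f_mem x hx h0
    rw [ha] at hs
    rw [h10]
    exact ⟨h8, hR.modf_rle hQ, (hR.modf_modf hs hQ h9 (hM.dom _ h8 h0)).symm⟩
  passive := fun ha => by
    rw [h.zero, hM.stem_zero] at ha
    obtain ⟨h1, x, h2, h3⟩ := h.passive ha
    exact ⟨h1.symm, x, h.zero.trans h2, by rwa [hM.stem_zero]⟩

/-- In the active case the value at `x` is modified at the projection of `x` to `δ`. Every `x` is
permitted at `δ`, so projecting directly or through the old maximal coordinate gives the same point
of `P.T`; hence `modf` with the same parameters is applied to both conditions and its monotonicity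
gives the order. -/
theorem StarRel.exists_f (hM : Matched c₀ d₀ P Q) (h : StarRel c₀ P Q t c d s s')
    {r : StarData.{u}} (hr : r.Valid c d) (hle : r.LeStar c d s) :
    ∃ f' : ESeq.{u} → ZFSet.{u},
      (∀ ν ∈ r.T, len ν.d = 0 → f' ν ∈ Rstem (r.stem c) ν.c) ∧
      (∀ ν ∈ r.T, len ν.d = 0 → rle (f' ν) (s'.f (proj d r.mc s.mc ν))) ∧
      (∀ ν, ¬ (ν ∈ r.T ∧ len ν.d = 0) → f' ν = ∅) ∧
      (s.stem c = P.stem c₀ → ∃ δ ∈ s.supp, (P.mc = c₀ → δ = c) ∧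
        (P.mc ≠ c₀ → t P.mc = (c, δ)) ∧ s.stem δ = P.stem P.mc ∧ s'.stem δ = Q.stem P.mc ∧
        (∀ ν ∈ r.T, Permitted ν (s.stem δ)) ∧ ∀ x ∈ r.T, len x.d = 0 → proj d r.mc δ x ∈ P.T ∧
        rle (r.f x) (P.f (proj d r.mc δ x)) ∧
        f' x = modf (P.f (proj d r.mc δ x)) (Q.f (proj d r.mc δ x)) (r.f x)) ∧
      (s.stem c ≠ P.stem c₀ → f' = r.f) := by
  classical
  by_cases ha : s.stem c = P.stem c₀
  · obtain ⟨δ, h1, h2, h3, h4, h5, h6, h7⟩ := h.active ha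
    have hrc : r.stem c = P.stem c₀ := (hle.stem_eq c h.valid.zero_mem).trans ha
    have hperm : ∀ ν ∈ r.T, Permitted ν (s.stem δ) := fun ν hν => h6 (proj d r.mc s.mc ν) (hle.T_sub ν hν)
    have hkey : ∀ x ∈ r.T, len x.d = 0 → proj d r.mc δ x ∈ P.T ∧
        rle (r.f x) (P.f (proj d r.mc δ x)) ∧ s'.f (proj d r.mc s.mc x) =
          modf (P.f (proj d r.mc δ x)) (Q.f (proj d r.mc δ x)) (s.f (proj d r.mc s.mc x)) := by
      intro x hx h0
      have h8 := hle.comm δ h1 x hx (by rw [hle.stem_eq δ h1]; exact hperm x hx)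
      obtain ⟨h9, h10, h11⟩ := h7 _ (hle.T_sub x hx) h0
      rw [← h8] at h9 h10 h11
      exact ⟨h9, (hle.f_le x hx h0).trans h10, h11⟩
    refine ⟨fun x => if x ∈ r.T ∧ len x.d = 0 then
      modf (P.f (proj d r.mc δ x)) (Q.f (proj d r.mc δ x)) (r.f x) else ∅, ?_, ?_, ?_, ?_, ?_⟩
    · intro x hx h0
      simp only [if_pos (And.intro hx h0)]
      obtain ⟨h9, h10, -⟩ := hkey x hx h0
      obtain ⟨hP, hQ⟩ := hM.f_mem h9 h0
      have hs := hr.f_mem x hx h0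
      rw [hrc] at hs ⊢
      exact (isR_Rstem _ _).modf_mem hs hQ h10 (hM.dom _ h9 h0)
    · intro x hx h0
      simp only [if_pos (And.intro hx h0)]
      rw [(hkey x hx h0).2.2]
      exact modf_mono (hle.f_le x hx h0)
    · intro x hx
      exact if_neg hx
    · refine fun _ => ⟨δ, h1, h2, h3, h4, h5, hperm, fun x hx h0 => ?_⟩
      obtain ⟨h9, h10, -⟩ := hkey x hx h0
      exact ⟨h9, h10, if_pos ⟨hx, h0⟩⟩
    · exact fun h => absurd ha h
  · refine ⟨r.f, hr.f_mem, fun ν hν h0 => ?_, hr.f_off, fun h => absurd h ha, fun _ => rfl⟩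
    rw [(h.passive ha).1]
    exact hle.f_le ν hν h0

/-- The partner of `r` takes the stems of `s'` at the old coordinates and those of `r` at the new
ones. -/
theorem StarRel.exists_leStar (hM : Matched c₀ d₀ P Q) (h : StarRel c₀ P Q t c d s s')
    {r : StarData.{u}} (hr : r.Valid c d) (hle : r.LeStar c d s) :
    ∃ r', r'.LeStar c d s' ∧ StarRel c₀ P Q t c d r r' := by
  classical
  obtain ⟨f', hf1, hf2, hf3, hf4, hf5⟩ := h.exists_f hM hr hle
  have hrc := hle.stem_eq c h.valid.zero_mem
  set st : Ordinal.{u} → List ESeq.{u} :=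
    fun γ => if γ ∈ s.supp then s'.stem γ else r.stem γ with hst
  have hpos : ∀ γ ∈ s.supp, st γ = s'.stem γ := fun γ hγ => if_pos hγ
  have hneg : ∀ γ, γ ∉ s.supp → st γ = r.stem γ := fun γ hγ => if_neg hγ
  have hstc : st c = r.stem c := (hpos c h.valid.zero_mem).trans (h.zero.trans hrc.symm)
  have hperm : ∀ γ, ∀ ν ∈ r.T, (Permitted ν (r.stem γ) ↔ Permitted ν (st γ)) := by
    intro γ ν hν
    by_cases hγ : γ ∈ s.supp
    · rw [hpos γ hγ, hle.stem_eq γ hγ]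
      exact h.perm γ hγ (proj d r.mc s.mc ν) (hle.T_sub ν hν)
    · rw [hneg γ hγ]
  have hvalid : (⟨r.mc, r.supp, st, r.T, f', r.F⟩ : StarData.{u}).Valid c d :=
    { supp_dom := hr.supp_dom
      supp_card := hr.supp_card
      zero_mem := hr.zero_mem
      stem_zero := by
        change IsStemZero c (st c)
        rw [hstc]; exact hr.stem_zero
      stem_ne := fun γ hγ hγc => by
        change st γ ≠ [] ∧ (∀ x ∈ st γ, _) ∧ (st γ).Pairwise _
        by_cases hγs : γ ∈ s.supp
        · rw [hpos γ hγs]; exact h.valid'.stem_ne γ (h.supp ▸ hγs) hγc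
        · rw [hneg γ hγs]; exact hr.stem_ne γ hγ hγc
      stem_off := fun γ hγ => (hneg γ fun h' => hγ (hle.supp_sub h')).trans (hr.stem_off γ hγ)
      stem_le := fun γ hγ x hx => by
        change x ∈ st c at hx
        change ∃ y ∈ st γ, _
        by_cases hγs : γ ∈ s.supp
        · rw [hpos γ hγs]
          rw [hpos c h.valid.zero_mem] at hx
          exact h.valid'.stem_le γ (h.supp ▸ hγs) x hx
        · rw [hneg γ hγs]
          exact hr.stem_le γ hγ x (hstc ▸ hx)
      mc_dom := hr.mc_dom
      mc_ge := hr.mc_ge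
      T_ext := hr.T_ext
      T_mem := hr.T_mem
      permitted_card := fun ν hν => by
        change #{γ | γ ∈ r.supp ∧ Permitted ν (st γ)} ≤ _
        simp only [← hperm _ ν hν]
        exact hr.permitted_card ν hν
      proj_ne := fun β hβ γ hγ ν hν hne h1 h2 =>
        hr.proj_ne β hβ γ hγ ν hν hne ((hperm β ν hν).2 h1) ((hperm γ ν hν).2 h2)
      f_mem := fun ν hν h0 => by
        change f' ν ∈ Rstem (st c) ν.c
        rw [hstc]; exact hf1 ν hν h0
      f_off := hf3
      F_mem := hr.F_mem
      F_off := hr.F_off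
      F_gen := hr.F_gen }
  refine ⟨⟨r.mc, r.supp, st, r.T, f', r.F⟩, ?_, ?_⟩
  · exact
    { supp_sub := h.supp ▸ hle.supp_sub
      stem_eq := fun γ hγ => hpos γ (h.supp ▸ hγ)
      mc_ge := h.mc ▸ hle.mc_ge
      mc_mem := h.mc ▸ hle.mc_mem
      new_stem := fun γ hγ hγ' => by
        rw [h.supp] at hγ'
        obtain ⟨y, hy, h1⟩ := hle.new_stem γ hγ hγ'
        exact ⟨y, by rw [← hneg γ hγ'] at hy; exact hy, (h.above_iff hM _).1 h1⟩
      T_sub := h.mc ▸ h.T ▸ hle.T_sub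
      comm := fun γ hγ ν hν h1 => by
        rw [h.supp] at hγ
        rw [h.mc]
        exact hle.comm γ hγ ν hν ((hperm γ ν hν).2 h1)
      f_le := fun ν hν h0 => by rw [h.mc]; exact hf2 ν hν h0
      F_le := by rw [h.mc, h.F]; exact hle.F_le }
  · exact
    { sys := h.sys
      valid := hr
      valid' := hvalid
      mc := rfl
      supp := rfl
      T := rfl
      F := rfl
      zero := hstc
      perm := fun γ _ ν hν => hperm γ ν hν
      inV := fun γ hγ ν hν h1 => by
        change _ ↔ ∀ x ∈ st γ, _
        by_cases hγs : γ ∈ s.supp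
        · rw [hpos γ hγs]
          rw [hle.stem_eq γ hγs] at h1 ⊢
          exact h.inV γ hγs (proj d r.mc s.mc ν) (hle.T_sub ν hν) h1
        · rw [hneg γ hγs]
      proj_zero := fun ν hν h1 => by
        rw [hle.comm c h.valid.zero_mem ν hν h1]
        rw [hrc] at h1
        exact h.proj_zero _ (hle.T_sub ν hν) h1
      tracked := fun γ₀ h₀ hne γ hγ => by
        obtain ⟨h1, h4, w, h2, h3⟩ := h.tracked γ₀ h₀ hne γ hγ
        exact ⟨hle.supp_sub h1, h4, w, (hle.stem_eq γ h1).trans h2, (hpos γ h1).trans h3⟩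
      untracked := fun γ hγ => by
        change st γ = _
        by_cases hγs : γ ∈ s.supp
        · rw [hpos γ hγs, hle.stem_eq γ hγs, h.untracked γ hγ]
        · rw [hneg γ hγs]
      active := fun ha => by
        obtain ⟨δ, h1, h2, h3, h4, h5, h6, h7⟩ := hf4 (hrc.symm.trans ha)
        exact ⟨δ, hle.supp_sub h1, h2, h3, (hle.stem_eq δ h1).trans h4, (hpos δ h1).trans h5,
          fun ν hν => by rw [hle.stem_eq δ h1]; exact h6 ν hν, h7⟩
      passive := fun ha => by
        rw [hrc] at ha ⊢
        exact ⟨hf5 ha, (h.passive ha).2⟩ }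

end

/-! ### One-point extensions of matched elements of `P*` -/

/-- The coordinates of `p` to which `ν` is permitted. -/
def StarData.permSet (p : StarData.{u}) (ν : ESeq.{u}) : Set Ordinal.{u} :=
  {γ | γ ∈ p.supp ∧ Permitted ν (p.stem γ)}

/-- The part of `p.T` above `ν`. -/
def StarData.tUpper (p : StarData.{u}) (ν : ESeq.{u}) : Set ESeq.{u} :=
  {x | x ∈ p.T ∧ x.code ∉ V_ ν.c}

/-- The part of `p.T` below `ν`. -/
def StarData.tLower (p : StarData.{u}) (ν : ESeq.{u}) : Set ESeq.{u} :=
  {x | x ∈ p.T ∧ x.code ∈ V_ ν.c}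

open Classical in
/-- The upper part of the one-point extension of `p` by `ν`. -/
noncomputable def StarData.upper (c : Ordinal.{u}) (d : ZFSet.{u}) (p : StarData.{u})
    (ν : ESeq.{u}) : StarData.{u} where
  mc := p.mc
  supp := p.supp
  stem := fun γ => if γ ∈ p.permSet ν then
      (if 0 < len ν.d ∨ γ = c then [proj d p.mc γ ν] else p.stem γ ++ [proj d p.mc γ ν])
    else p.stem γ
  T := p.tUpper ν
  f := fun x => if x ∈ p.tUpper ν ∧ len x.d = 0 then
    p.F ⟨ν.c, ν.a, ∅⟩ x else ∅
  F := fun x y => if x ∈ p.tUpper ν ∧ y ∈ p.tUpper ν then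
    p.F x y else ∅

open Classical in
/-- `p₁` is the lower part of the one-point extension of `p` by the sequence `ν` of positive
length. -/
structure StarData.IsLower (d : ZFSet.{u}) (p : StarData.{u}) (ν : ESeq.{u})
    (p₁ : StarData.{u}) : Prop where
  mc : p₁.mc = ν.a
  supp : p₁.supp = (fun γ => (proj d p.mc γ ν).a) '' p.permSet ν
  stem : ∀ γ ∈ p.permSet ν, p₁.stem (proj d p.mc γ ν).a = p.stem γ
  T : p₁.T = p.tLower ν
  f : ∀ x, p₁.f x = if x ∈ p.tLower ν then p.f x else ∅
  F : ∀ x y, p₁.F x y = if x ∈ p.tLower ν ∧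
    y ∈ p.tLower ν then p.F x y else ∅
  comm : ∀ γ ∈ p.permSet ν, ∀ x ∈ p.tLower ν, Permitted x (p.stem γ) →
    proj ν.d ν.a (proj d p.mc γ ν).a x = proj d p.mc γ x

theorem isOnePoint_iff {c : Ordinal.{u}} {d : ZFSet.{u}} {p : StarData.{u}} {ν : ESeq.{u}}
    {b₁ b₀ : Blk.{u}} : IsOnePoint c d p ν b₁ b₀ ↔ ν ∈ p.T ∧ p.Above c d ν.c ∧
      Permitted ν (p.stem c) ∧ b₁.Valid ∧ b₀.Valid ∧ b₀ = .full c d (p.upper c d ν) ∧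
      (0 < len ν.d → ∃ p₁ : StarData.{u}, b₁ = .full ν.c ν.d p₁ ∧ p.IsLower d ν p₁) ∧
      (len ν.d = 0 → b₁ = .degen ν.c (p.stem c) (p.f ν)) := by
  constructor
  · rintro ⟨h1, h2, h3, h4, h5, h6, h7, h8⟩
    refine ⟨h1, h2, h3, h4, h5, by unfold StarData.upper; convert h6 <;> rfl, fun h => ?_, h8⟩
    obtain ⟨p₁, h9, k1, k2, k3, k4, k5, k6, k7⟩ := h7 h
    exact ⟨p₁, h9, k1, k2, k3, k4, fun x => by convert k5 x; rfl, fun x y => by convert k6 x y <;> rfl, k7⟩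
  · rintro ⟨h1, h2, h3, h4, h5, h6, h7, h8⟩
    refine ⟨h1, h2, h3, h4, h5, by unfold StarData.upper at h6; convert h6 <;> rfl, fun h => ?_, h8⟩
    obtain ⟨p₁, h9, k1, k2, k3, k4, k5, k6, k7⟩ := h7 h
    exact ⟨p₁, h9, k1, k2, k3, k4, fun x => by convert k5 x; rfl, fun x y => by convert k6 x y <;> rfl, k7⟩

open Classical in
/-- The place to which the place `e` moves in the one-point extension by `ν`. -/
noncomputable def reloc (c : Ordinal.{u}) (d : ZFSet.{u}) (s : StarData.{u}) (ν : ESeq.{u})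
    (e : Ordinal.{u} × Ordinal.{u}) : Ordinal.{u} × Ordinal.{u} :=
  if e.1 = c ∧ e.2 ∈ s.permSet ν ∧ 0 < len ν.d then (ν.c, (proj d s.mc e.2 ν).a) else e

section

variable {c₀ c : Ordinal.{u}} {d₀ d : ZFSet.{u}} {P Q s s' : StarData.{u}}
  {t : Ordinal.{u} → Ordinal.{u} × Ordinal.{u}} {ν : ESeq.{u}}

theorem reloc_of_ne {e : Ordinal.{u} × Ordinal.{u}} (h : e.1 ≠ c) : reloc c d s ν e = e :=
  if_neg fun h' => h h'.1

theorem reloc_of_mem {γ : Ordinal.{u}} (hγ : γ ∈ s.permSet ν) (h0 : 0 < len ν.d) :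
    reloc c d s ν (c, γ) = (ν.c, (proj d s.mc γ ν).a) := if_pos ⟨rfl, hγ, h0⟩

theorem reloc_of_not {γ : Ordinal.{u}} (h : ¬ (γ ∈ s.permSet ν ∧ 0 < len ν.d)) :
    reloc c d s ν (c, γ) = (c, γ) := if_neg fun h' => h h'.2

theorem eq_of_reloc {e : Ordinal.{u} × Ordinal.{u}} {γ : Ordinal.{u}} (hνc : ν.c ≠ c)
    (h : reloc c d s ν e = (c, γ)) : e = (c, γ) ∧ ¬ (γ ∈ s.permSet ν ∧ 0 < len ν.d) := by
  by_cases h' : e.1 = c ∧ e.2 ∈ s.permSet ν ∧ 0 < len ν.d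
  · rw [reloc, if_pos h'] at h
    exact absurd (congrArg Prod.fst h) hνc
  · rw [reloc, if_neg h'] at h
    subst h
    exact ⟨rfl, fun h => h' ⟨rfl, h⟩⟩

theorem exists_of_reloc {e : Ordinal.{u} × Ordinal.{u}} {δ : Ordinal.{u}} (he : e.1 ≠ ν.c)
    (h : reloc c d s ν e = (ν.c, δ)) :
    ∃ γ ∈ s.permSet ν, 0 < len ν.d ∧ e = (c, γ) ∧ δ = (proj d s.mc γ ν).a := by
  by_cases h' : e.1 = c ∧ e.2 ∈ s.permSet ν ∧ 0 < len ν.d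
  · rw [reloc, if_pos h'] at h
    exact ⟨e.2, h'.2.1, h'.2.2, Prod.ext h'.1 rfl, (congrArg Prod.snd h).symm⟩
  · rw [reloc, if_neg h'] at h
    exact absurd (congrArg Prod.fst h) he

theorem StarRel.permSet_eq (h : StarRel c₀ P Q t c d s s') (hν : ν ∈ s.T) :
    s'.permSet ν = s.permSet ν := by
  ext γ
  constructor
  · rintro ⟨h1, h2⟩
    rw [h.supp] at h1
    exact ⟨h1, (h.perm γ h1 ν hν).2 h2⟩
  · rintro ⟨h1, h2⟩
    exact ⟨h.supp ▸ h1, (h.perm γ h1 ν hν).1 h2⟩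

theorem StarRel.reloc_eq (h : StarRel c₀ P Q t c d s s') (hν : ν ∈ s.T) :
    reloc c d s' ν = reloc c d s ν := by
  funext e
  rw [reloc, reloc, h.permSet_eq hν, h.mc]

/-- Distinct permitted coordinates stay distinct in the lower block, so stems can be transported
along this map. -/
theorem StarData.Valid.proj_a_injOn (hs : s.Valid c d) (hν : ν ∈ s.T) :
    Set.InjOn (fun γ => (proj d s.mc γ ν).a) (s.permSet ν) := by
  intro β hβ γ hγ h
  by_contra hne
  exact hs.proj_ne β hβ.1 γ hγ.1 ν hν hne hβ.2 hγ.2 (ESeq.ext rfl h rfl)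

theorem upper_stem_of_mem {γ : Ordinal.{u}} (hγ : γ ∈ s.permSet ν) (h : 0 < len ν.d ∨ γ = c) :
    (s.upper c d ν).stem γ = [proj d s.mc γ ν] := (if_pos hγ).trans (if_pos h)

theorem upper_stem_of_mem' {γ : Ordinal.{u}} (hγ : γ ∈ s.permSet ν) (h : ¬ (0 < len ν.d ∨ γ = c)) :
    (s.upper c d ν).stem γ = s.stem γ ++ [proj d s.mc γ ν] := (if_pos hγ).trans (if_neg h)

theorem upper_stem_of_notMem {γ : Ordinal.{u}} (hγ : γ ∉ s.permSet ν) :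
    (s.upper c d ν).stem γ = s.stem γ := if_neg hγ

/-- A case distinction for the stems of the upper part of a one-point extension. -/
theorem StarRel.upper_stem (h : StarRel c₀ P Q t c d s s') (hν : ν ∈ s.T) (γ : Ordinal.{u}) :
    (γ ∈ s.permSet ν ∧ (0 < len ν.d ∨ γ = c) ∧ (s.upper c d ν).stem γ = [proj d s.mc γ ν] ∧
      (s'.upper c d ν).stem γ = [proj d s.mc γ ν]) ∨
    (γ ∈ s.permSet ν ∧ ¬ (0 < len ν.d ∨ γ = c) ∧
      (s.upper c d ν).stem γ = s.stem γ ++ [proj d s.mc γ ν] ∧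
      (s'.upper c d ν).stem γ = s'.stem γ ++ [proj d s.mc γ ν]) ∨
    (γ ∉ s.permSet ν ∧ (s.upper c d ν).stem γ = s.stem γ ∧
      (s'.upper c d ν).stem γ = s'.stem γ) := by
  have hS := h.permSet_eq hν
  by_cases hγ : γ ∈ s.permSet ν
  · have hγ' := hγ
    rw [← hS] at hγ'
    rw [← h.mc]
    by_cases h0 : 0 < len ν.d ∨ γ = c
    · left
      refine ⟨hγ, h0, ?_, upper_stem_of_mem hγ' h0⟩
      rw [h.mc]; exact upper_stem_of_mem hγ h0
    · right; left
      refine ⟨hγ, h0, ?_, upper_stem_of_mem' hγ' h0⟩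
      rw [h.mc]; exact upper_stem_of_mem' hγ h0
  · have hγ' := hγ
    rw [← hS] at hγ'
    exact Or.inr (Or.inr ⟨hγ, upper_stem_of_notMem hγ, upper_stem_of_notMem hγ'⟩)

-- The upper part is passive: its `p^0` is the projection of `ν`, above all of `P.stem c₀`, and its
-- `f` is read off the common `F`. A tracked coordinate stays only if its stem was kept or had the
-- projection of `ν` appended, which lengthens `w` equally on both sides.
open Classical in
theorem StarRel.upper (h : StarRel c₀ P Q t c d s s') (hν : ν ∈ s.T)
    (hν0 : Permitted ν (s.stem c)) (hPν : ∀ z ∈ P.stem c₀, z.c < ν.c)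
    (hv : (s.upper c d ν).Valid c d) :
    StarRel c₀ P Q (fun γ => reloc c d s ν (t γ)) c d (s.upper c d ν) (s'.upper c d ν) := by
  have hνc : ν.c ≠ c := (c_lt_of_code (h.valid.T_ext ν hν).2).ne
  have hcS : c ∈ s.permSet ν := ⟨h.valid.zero_mem, hν0⟩
  have hstem := h.upper_stem hν
  have hc1 : (s.upper c d ν).stem c = [proj d s.mc c ν] := upper_stem_of_mem hcS (Or.inr rfl)
  have hc2 : (s'.upper c d ν).stem c = [proj d s.mc c ν] := by
    rw [← h.mc]
    exact upper_stem_of_mem (by rw [h.permSet_eq hν]; exact hcS) (Or.inr rfl)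
  have hT' : s'.tUpper ν = s.tUpper ν := by rw [StarData.tUpper, StarData.tUpper, h.T]
  have hT : (s'.upper c d ν).T = (s.upper c d ν).T := hT'
  have hm : ∀ x, x ∈ s'.tUpper ν ↔ x ∈ s.tUpper ν := fun x => by rw [hT']
  have hf : (s'.upper c d ν).f = (s.upper c d ν).f := by
    simp only [StarData.upper, h.F]
    funext x
    exact if_congr (and_congr (hm x) Iff.rfl) rfl rfl
  have hF : (s'.upper c d ν).F = (s.upper c d ν).F := by
    simp only [StarData.upper, h.F]
    funext x y
    exact if_congr (and_congr (hm x) (hm y)) rfl rfl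
  have hsub : ∀ x ∈ (s.upper c d ν).T, x ∈ s.T := fun x hx => hx.1
  have hperm : ∀ γ ∈ s.supp, ∀ x ∈ (s.upper c d ν).T,
      (Permitted x ((s.upper c d ν).stem γ) ↔ Permitted x ((s'.upper c d ν).stem γ)) := by
    intro γ hγ x hx
    rcases hstem γ with ⟨-, -, h1, h2⟩ | ⟨-, -, h1, h2⟩ | ⟨-, h1, h2⟩
    · rw [h1, h2]
    · rw [h1, h2, permitted_append, permitted_append, h.perm γ hγ x (hsub x hx)]
    · rw [h1, h2, h.perm γ hγ x (hsub x hx)]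
  have hpr : ∀ γ ∈ s.permSet ν, (proj d s.mc γ ν).IsExt ∧ (proj d s.mc γ ν).code ∈ V_ c := by
    intro γ hγ
    refine hv.stem_mem (γ := γ) ?_
    rcases hstem γ with ⟨-, -, h1, -⟩ | ⟨-, -, h1, -⟩ | ⟨h1, -⟩
    · rw [h1]; simp
    · rw [h1]; simp
    · exact absurd hγ h1
  have hvalid : (s'.upper c d ν).Valid c d :=
    { supp_dom := h.valid'.supp_dom
      supp_card := h.valid'.supp_card
      zero_mem := h.valid'.zero_mem
      stem_zero := by rw [hc2, ← hc1]; exact hv.stem_zero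
      stem_ne := fun γ hγ hγc => by
        have hγ' : γ ∈ s'.supp := hγ
        rw [h.supp] at hγ'
        rcases hstem γ with ⟨-, -, h1, h2⟩ | ⟨h0, -, h1, h2⟩ | ⟨-, h1, h2⟩
        · rw [h2, ← h1]; exact hv.stem_ne γ hγ' hγc
        · rw [h2]
          obtain ⟨h3, h4, h5⟩ := h.valid'.stem_ne γ hγ hγc
          refine ⟨by simp, fun x hx => ?_, List.pairwise_append.2 ⟨h5, by simp, fun x hx y hy => ?_⟩⟩
          · rcases List.mem_append.1 hx with hx | hx
            · exact h4 x hx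
            · rw [List.mem_singleton.1 hx]; exact hpr γ h0
          · rw [List.mem_singleton.1 hy]
            exact (h.perm γ hγ' ν hν).1 h0.2 x hx
        · rw [h2]; exact h.valid'.stem_ne γ hγ hγc
      stem_off := fun γ hγ => by
        have hγ' : γ ∉ s'.supp := hγ
        rw [upper_stem_of_notMem fun h => hγ' h.1]
        exact h.valid'.stem_off γ hγ
      -- Here `κ(p^0) = κ⁰(ν)`. A permitted coordinate contains a projection of `ν`, whose first
      -- entry is at least `κ⁰(ν)`; a coordinate that is not permitted has an entry with `κ⁰` at
      -- least `κ⁰(ν)`.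
      stem_le := fun γ hγ x hx => by
        have hγ' : γ ∈ s'.supp := hγ
        rw [h.supp] at hγ'
        rw [hc2, List.mem_singleton] at hx
        have hxa : x.a = ν.c := by rw [hx]; exact h.proj_zero ν hν hν0
        rw [hxa]
        by_cases hγS : γ ∈ s.permSet ν
        · refine ⟨proj d s.mc γ ν, ?_, (hpr γ hγS).1.1⟩
          rcases hstem γ with ⟨-, -, -, h2⟩ | ⟨-, -, -, h2⟩ | ⟨h1, -⟩
          · rw [h2]; simp
          · rw [h2]; simp
          · exact absurd hγS h1
        · rw [upper_stem_of_notMem (by rwa [h.permSet_eq hν])]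
          have h1 : ¬ Permitted ν (s'.stem γ) := fun h' =>
            hγS ⟨hγ', (h.perm γ hγ' ν hν).2 h'⟩
          simp only [Permitted, not_forall, not_lt] at h1
          obtain ⟨y, hy, h1⟩ := h1
          exact ⟨y, hy, h1.trans (h.valid'.stem_mem hy).1.1⟩
      mc_dom := h.valid'.mc_dom
      mc_ge := h.valid'.mc_ge
      T_ext := fun x hx => hv.T_ext x (hT ▸ hx)
      T_mem := by
        rw [hT]
        change ∀ τ < len d, _ ∈ meas d τ s'.mc
        rw [h.mc]; exact hv.T_mem
      permitted_card := fun x hx => by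
        rw [hT] at hx
        refine le_trans (Cardinal.mk_le_mk_of_subset fun γ hγ => ?_) (hv.permitted_card x hx)
        have hγ1 : γ ∈ s'.supp := hγ.1
        rw [h.supp] at hγ1
        exact ⟨hγ1, (hperm γ hγ1 x hx).2 hγ.2⟩
      proj_ne := fun β hβ γ hγ x hx hne h1 h2 => by
        rw [hT] at hx
        have hβ' : β ∈ s'.supp := hβ
        have hγ' : γ ∈ s'.supp := hγ
        rw [h.supp] at hβ' hγ'
        change proj d s'.mc β x ≠ proj d s'.mc γ x
        rw [h.mc]
        exact hv.proj_ne β hβ' γ hγ' x hx hne ((hperm β hβ' x hx).2 h1) ((hperm γ hγ' x hx).2 h2)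
      f_mem := by rw [hT, hf, hc2, ← hc1]; exact hv.f_mem
      f_off := by rw [hT, hf]; exact hv.f_off
      F_mem := by rw [hT, hF]; exact hv.F_mem
      F_off := by rw [hT, hF]; exact hv.F_off
      F_gen := by
        have := hv.F_gen
        rw [hF]
        change InGenE c d (twoStep (ultE c d) (V_ c) (xpt c d s'.mc 0) _)
        rw [h.mc]; exact this }
  exact
  { sys := h.sys
    valid := hv
    valid' := hvalid
    mc := h.mc
    supp := h.supp
    T := hT
    F := hF
    zero := hc2.trans hc1.symm
    perm := hperm
    inV := fun γ hγ x hx hp => by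
      rcases hstem γ with ⟨-, -, h1, h2⟩ | ⟨-, -, h1, h2⟩ | ⟨-, h1, h2⟩
      · rw [h1, h2]
      · rw [h1] at hp
        rw [h1, h2, List.forall_mem_append, List.forall_mem_append,
          h.inV γ hγ x (hsub x hx) (permitted_append.1 hp).1]
      · rw [h1] at hp
        rw [h1, h2, h.inV γ hγ x (hsub x hx) hp]
    proj_zero := fun x hx hp => by
      rw [hc1, permitted_singleton] at hp
      exact h.proj_zero x (hsub x hx) fun z hz => (hν0 z hz).trans hp
    tracked := fun γ₀ h₀ hne γ hγ => by
      obtain ⟨h1, h2⟩ := eq_of_reloc hνc hγ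
      obtain ⟨h3, h4, w, h5, h6⟩ := h.tracked γ₀ h₀ hne γ h1
      refine ⟨h3, h4, ?_⟩
      rcases hstem γ with ⟨k0, k1, -⟩ | ⟨-, -, k1, k2⟩ | ⟨-, k1, k2⟩
      · exact absurd (k1.resolve_right h4) fun h => h2 ⟨k0, h⟩
      · refine ⟨w ++ [proj d s.mc γ ν], ?_, ?_⟩
        · rw [k1, h5, List.append_assoc]
        · rw [k2, h6, List.append_assoc]
      · exact ⟨w, k1.trans h5, k2.trans h6⟩
    untracked := fun γ hγ => by
      have h0 : ¬ (γ ∈ s.permSet ν ∧ 0 < len ν.d) → s'.stem γ = s.stem γ := fun hn =>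
        h.untracked γ fun γ₀ h₀ hne ht => hγ γ₀ h₀ hne (by
          rw [ht, reloc_of_not hn])
      rcases hstem γ with ⟨-, -, k1, k2⟩ | ⟨-, h3, k1, k2⟩ | ⟨h3, k1, k2⟩
      · rw [k1, k2]
      · rw [k1, k2, h0 fun h' => h3 (Or.inl h'.2)]
      · rw [k1, k2, h0 fun h' => h3 h'.1]
    active := fun ha => by
      rw [hc1] at ha
      exact absurd (hPν (proj d s.mc c ν) (by rw [← ha]; simp)) (lt_irrefl _)
    passive := fun _ => ⟨hf, _, hc1, hPν⟩ }

-- The lower part keeps `p^0` and `f`, so an active block stays active, with `δ` moved along the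
-- projection of `ν`. The partner carries the stems of `s'` to the same new coordinates; `inV` puts
-- them into `V_{κ⁰(ν)}`, and the agreement of projections required of `ν` carries over the rest.
open Classical in
theorem StarRel.lower (h : StarRel c₀ P Q t c d s s') (hν : ν ∈ s.T)
    (hν0 : Permitted ν (s.stem c)) (hlen : 0 < len ν.d)
    (ht : ∀ γ₀ ∈ P.supp, γ₀ ≠ c₀ → (t γ₀).1 ≠ ν.c) {p₁ : StarData.{u}}
    (hsys : IsSystem ν.c ν.d) (hv : p₁.Valid ν.c ν.d) (hl : s.IsLower d ν p₁) :
    ∃ p₁', s'.IsLower d ν p₁' ∧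
      StarRel c₀ P Q (fun γ => reloc c d s ν (t γ)) ν.c ν.d p₁ p₁' := by
  have hinj := h.valid.proj_a_injOn hν
  have hT' : s'.tLower ν = s.tLower ν := by rw [StarData.tLower, StarData.tLower, h.T]
  have hcS : c ∈ s.permSet ν := ⟨h.valid.zero_mem, hν0⟩
  have hprc : (proj d s.mc c ν).a = ν.c := h.proj_zero ν hν hν0
  have hS := h.permSet_eq hν
  set st : Ordinal.{u} → List ESeq.{u} := fun δ =>
    if h : ∃ γ, γ ∈ s.permSet ν ∧ (proj d s.mc γ ν).a = δ then s'.stem h.choose else [] with hst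
  have hst1 : ∀ γ ∈ s.permSet ν, st (proj d s.mc γ ν).a = s'.stem γ := by
    intro γ hγ
    have hex : ∃ γ', γ' ∈ s.permSet ν ∧ (proj d s.mc γ' ν).a = (proj d s.mc γ ν).a := ⟨γ, hγ, rfl⟩
    rw [hst]
    dsimp only
    rw [dif_pos hex]
    congr 1
    exact hinj hex.choose_spec.1 hγ hex.choose_spec.2
  have hst2 : ∀ δ, δ ∉ p₁.supp → st δ = [] := by
    intro δ hδ
    rw [hl.supp] at hδ
    exact dif_neg hδ
  have hsupp : ∀ δ ∈ p₁.supp, ∃ γ ∈ s.permSet ν, (proj d s.mc γ ν).a = δ := by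
    intro δ hδ
    rw [hl.supp] at hδ
    exact hδ
  have hT : ∀ x ∈ p₁.T, x ∈ s.T ∧ x.code ∈ V_ ν.c := by
    intro x hx
    rw [hl.T] at hx
    exact hx
  have hz1 : p₁.stem ν.c = s.stem c := by rw [← hprc]; exact hl.stem c hcS
  have hz2 : st ν.c = s.stem c := by rw [← hprc, hst1 c hcS, h.zero]
  have hperm : ∀ δ ∈ p₁.supp, ∀ x ∈ p₁.T, (Permitted x (p₁.stem δ) ↔ Permitted x (st δ)) := by
    intro δ hδ x hx
    obtain ⟨γ, hγ, rfl⟩ := hsupp δ hδ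
    rw [hl.stem γ hγ, hst1 γ hγ]
    exact h.perm γ hγ.1 x (hT x hx).1
  set f' : ESeq.{u} → ZFSet.{u} := fun x => if x ∈ p₁.T then s'.f x else ∅ with hf'
  have hvalid : (⟨p₁.mc, p₁.supp, st, p₁.T, f', p₁.F⟩ : StarData.{u}).Valid ν.c ν.d :=
    { supp_dom := hv.supp_dom
      supp_card := hv.supp_card
      zero_mem := hv.zero_mem
      stem_zero := by
        have := hv.stem_zero
        change IsStemZero ν.c (st ν.c)
        rwa [hz2, ← hz1]
      stem_ne := fun δ hδ hδc => by
        obtain ⟨γ, hγ, rfl⟩ := hsupp δ hδ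
        change st _ ≠ [] ∧ (∀ x ∈ st _, _) ∧ (st _).Pairwise _
        rw [hst1 γ hγ]
        have hγc : γ ≠ c := fun h' => hδc (by rw [h', hprc])
        obtain ⟨h1, h2, h3⟩ := h.valid'.stem_ne γ (h.supp ▸ hγ.1) hγc
        have h4 := (hv.stem_ne _ hδ hδc).2.1
        rw [hl.stem γ hγ] at h4
        exact ⟨h1, fun x hx => ⟨(h2 x hx).1,
          (h.inV γ hγ.1 ν hν hγ.2).1 (fun x hx => (h4 x hx).2) x hx⟩, h3⟩
      stem_off := hst2
      stem_le := fun δ hδ x hx => by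
        obtain ⟨γ, hγ, rfl⟩ := hsupp δ hδ
        change x ∈ st ν.c at hx
        rw [hz2, ← h.zero] at hx
        change ∃ y ∈ st _, _
        rw [hst1 γ hγ]
        exact h.valid'.stem_le γ (h.supp ▸ hγ.1) x hx
      mc_dom := hv.mc_dom
      mc_ge := hv.mc_ge
      T_ext := hv.T_ext
      T_mem := hv.T_mem
      permitted_card := fun x hx => by
        refine le_trans (Cardinal.mk_le_mk_of_subset fun γ hγ => ?_) (hv.permitted_card x hx)
        exact ⟨hγ.1, (hperm γ hγ.1 x hx).2 hγ.2⟩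
      proj_ne := fun β hβ γ hγ x hx hne h1 h2 =>
        hv.proj_ne β hβ γ hγ x hx hne ((hperm β hβ x hx).2 h1) ((hperm γ hγ x hx).2 h2)
      f_mem := fun x hx h0 => by
        change f' x ∈ Rstem (st ν.c) x.c
        rw [hf']
        dsimp only
        rw [if_pos hx, hz2, ← h.zero]
        exact h.valid'.f_mem x (h.T ▸ (hT x hx).1) h0
      f_off := fun x hx => by
        change f' x = ∅
        rw [hf']
        dsimp only
        split_ifs with h1
        · exact h.valid'.f_off x fun h2 => hx ⟨h1, h2.2⟩
        · rfl
      F_mem := hv.F_mem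
      F_off := hv.F_off
      F_gen := hv.F_gen }
  refine ⟨⟨p₁.mc, p₁.supp, st, p₁.T, f', p₁.F⟩, ?_, ?_⟩
  · exact
    { mc := hl.mc
      supp := by rw [hS, h.mc]; exact hl.supp
      stem := fun γ hγ => by rw [hS] at hγ; rw [h.mc]; exact hst1 γ hγ
      T := by rw [hT']; exact hl.T
      f := fun x => by rw [hT']; simp only [hf', hl.T]
      F := fun x y => by rw [hT', h.F]; exact hl.F x y
      comm := fun γ hγ x hx hp => by
        rw [hS] at hγ
        rw [hT'] at hx
        rw [h.mc]
        exact hl.comm γ hγ x hx ((h.perm γ hγ.1 x hx.1).2 hp) }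
  · exact
    { sys := hsys
      valid := hv
      valid' := hvalid
      mc := rfl
      supp := rfl
      T := rfl
      F := rfl
      zero := hz2.trans hz1.symm
      perm := hperm
      inV := fun δ hδ x hx hp => by
        obtain ⟨γ, hγ, rfl⟩ := hsupp δ hδ
        change _ ↔ ∀ y ∈ st _, _
        rw [hl.stem γ hγ] at hp ⊢
        rw [hst1 γ hγ]
        exact h.inV γ hγ.1 x (hT x hx).1 hp
      proj_zero := fun x hx hp => by
        rw [hz1] at hp
        have h1 := hl.comm c hcS x (hT x hx) hp
        rw [hprc] at h1
        rw [hl.mc, h1]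
        exact h.proj_zero x (hT x hx).1 hp
      tracked := fun γ₀ h₀ hne δ hδ => by
        obtain ⟨γ, hγ, -, h1, rfl⟩ := exists_of_reloc (ht γ₀ h₀ hne) hδ
        obtain ⟨-, h2, w, h3, h4⟩ := h.tracked γ₀ h₀ hne γ h1
        refine ⟨by rw [hl.supp]; exact ⟨γ, hγ, rfl⟩, fun h5 => h2 ?_, w, ?_, ?_⟩
        · exact hinj hγ hcS (h5.trans hprc.symm)
        · rw [hl.stem γ hγ, h3]
        · exact (hst1 γ hγ).trans h4
      untracked := fun δ hδ => by
        change st δ = _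
        by_cases hδs : δ ∈ p₁.supp
        · obtain ⟨γ, hγ, rfl⟩ := hsupp δ hδs
          rw [hst1 γ hγ, hl.stem γ hγ]
          refine h.untracked γ fun γ₀ h₀ hne h1 => hδ γ₀ h₀ hne ?_
          rw [h1, reloc_of_mem hγ hlen]
        · rw [hst2 δ hδs, hv.stem_off δ hδs]
      active := fun ha => by
        rw [hz1] at ha
        obtain ⟨δ, h1, h2, h3, h4, h5, h6, h7⟩ := h.active ha
        have hδ : δ ∈ s.permSet ν := ⟨h1, h6 ν hν⟩
        refine ⟨(proj d s.mc δ ν).a, by rw [hl.supp]; exact ⟨δ, hδ, rfl⟩, fun h8 => ?_,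
          fun h8 => ?_, (hl.stem δ hδ).trans h4, (hst1 δ hδ).trans h5, fun x hx => ?_,
          fun x hx hx0 => ?_⟩
        · rw [h2 h8, hprc]
        · rw [h3 h8, reloc_of_mem hδ hlen]
        · rw [hl.stem δ hδ]; exact h6 x (hT x hx).1
        · have hx' := hT x hx
          rw [hl.mc, hl.comm δ hδ x hx' (h6 x hx'.1)]
          obtain ⟨h8, h9, h10⟩ := h7 x hx'.1 hx0
          have h11 : p₁.f x = s.f x := (hl.f x).trans (if_pos hx')
          rw [h11]
          exact ⟨h8, h9, (if_pos hx).trans h10⟩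
      passive := fun ha => by
        rw [hz1] at ha ⊢
        obtain ⟨h1, h2⟩ := h.passive ha
        refine ⟨?_, h2⟩
        funext x
        rw [hl.f x]
        simp only [hf', hl.T, h1] }

end

/-! ### Tracking a coordinate through the blocks of a condition -/

/-- The block on `e.1` has the stem `l` at the coordinate `e.2 ≠ e.1`. Only the blocks on the
critical points in `I` are considered. -/
def StemAt (I : Ordinal.{u} → Prop) (L : List Blk.{u}) (e : Ordinal.{u} × Ordinal.{u})
    (l : List ESeq.{u}) : Prop :=
  I e.1 ∧ ∃ d s, Blk.full e.1 d s ∈ L ∧ e.2 ∈ s.supp ∧ e.2 ≠ e.1 ∧ s.stem e.2 = l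

/-- A stem which begins with `y₀` has moved from `e` to `e'`: whenever the stem at a coordinate
has been moved downwards, the extender sequence left at that coordinate tells the new place. -/
inductive Path (A : Ordinal.{u} × Ordinal.{u} → List ESeq.{u} → Prop) (y₀ : ESeq.{u}) :
    Ordinal.{u} × Ordinal.{u} → Ordinal.{u} × Ordinal.{u} → Prop
  | here {e : Ordinal.{u} × Ordinal.{u}} {w : List ESeq.{u}} (h : A e (y₀ :: w)) : Path A y₀ e e
  | next {e e' : Ordinal.{u} × Ordinal.{u}} {y : ESeq.{u}} {w : List ESeq.{u}} (h : A e (y :: w))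
      (hy : y₀.c < y.c) (hp : Path A y₀ (y.c, y.a) e') : Path A y₀ e e'

section Path

variable {A A' : Ordinal.{u} × Ordinal.{u} → List ESeq.{u} → Prop} {y₀ : ESeq.{u}}
  {e e' e'' : Ordinal.{u} × Ordinal.{u}}

theorem Path.mono (h : ∀ e l, A e l → A' e l) (hp : Path A y₀ e e') : Path A' y₀ e e' := by
  induction hp with
  | here hA => exact .here (h _ _ hA)
  | next hA hy _ ih => exact .next (h _ _ hA) hy ih

/-- The first entry of the stem decides: `here` requires `y₀`, while `next` requires an entry with
`κ⁰` strictly above that of `y₀`. -/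
theorem Path.unique (hA : ∀ e l l', A e l → A e l' → l = l') (hp : Path A y₀ e e')
    (hp' : Path A y₀ e e'') : e' = e'' := by
  induction hp with
  | here h =>
    cases hp' with
    | here _ => rfl
    | next h' hy _ =>
      obtain ⟨rfl, -⟩ := List.cons.inj (hA _ _ _ h h')
      exact absurd hy (lt_irrefl _)
  | next h hy _ ih =>
    cases hp' with
    | here h' =>
      obtain ⟨rfl, -⟩ := List.cons.inj (hA _ _ _ h h')
      exact absurd hy (lt_irrefl _)
    | next h' _ hp' =>
      obtain ⟨rfl, -⟩ := List.cons.inj (hA _ _ _ h h')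
      exact ih hp'

theorem Path.endpoint (hp : Path A y₀ e e') : ∃ w, A e' (y₀ :: w) := by
  induction hp with
  | here h => exact ⟨_, h⟩
  | next _ _ _ ih => exact ih

/-- A moved stem leaves `[y]` behind, where `y` names the new place and lies above the moved stem,
so the path is lengthened by one step at that place. Entries appended to a stem are absorbed by `w`.
-/
theorem Path.relocate {ρ : Ordinal.{u} × Ordinal.{u} → Ordinal.{u} × Ordinal.{u}}
    (h₁ : ∀ e l, A e l → ∃ w, A' (ρ e) (l ++ w))
    (h₂ : ∀ e l, A e l → ρ e = e ∨ ∃ y, A' e [y] ∧ ρ e = (y.c, y.a) ∧ ∀ z ∈ l, z.c < y.c)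
    (hp : Path A y₀ e e') : Path A' y₀ e (ρ e') := by
  induction hp with
  | @here e w h =>
    obtain ⟨w', h'⟩ := h₁ _ _ h
    have h3 : Path A' y₀ (ρ e) (ρ e) := .here (w := w ++ w') h'
    rcases h₂ _ _ h with h4 | ⟨y, h4, h5, h6⟩
    · rw [h4] at h3 ⊢; exact h3
    · refine .next h4 (h6 _ List.mem_cons_self) ?_
      rw [← h5]; exact h3
  | @next e e' y w h hy hp ih =>
    obtain ⟨w', h'⟩ := h₁ _ _ h
    have h3 : Path A' y₀ (ρ e) (ρ e') := .next (w := w ++ w') h' hy ih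
    rcases h₂ _ _ h with h4 | ⟨y', h4, h5, h6⟩
    · rw [h4] at h3; exact h3
    · refine .next h4 (hy.trans (h6 _ List.mem_cons_self)) ?_
      rw [← h5]; exact h3

end Path

/-! ### Corresponding blocks -/

/-- The blocks on `c` may come from a block on `c₀` with `p^0 = z`. -/
def Between (c₀ : Ordinal.{u}) (z : List ESeq.{u}) (c : Ordinal.{u}) : Prop :=
  c ≤ c₀ ∧ ∀ x ∈ z, x.c < c

/-- `b` and `b'` occur in corresponding extensions of `P` and `Q`. -/
inductive BlkRel (c₀ : Ordinal.{u}) (P Q : StarData.{u})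
    (A A' : Ordinal.{u} × Ordinal.{u} → List ESeq.{u} → Prop)
    (t : Ordinal.{u} → Ordinal.{u} × Ordinal.{u}) : Blk.{u} → Blk.{u} → Prop
  | outside {b b' : Blk.{u}} (hi : ¬ Between c₀ (P.stem c₀) b.c) (h : b' = b) :
      BlkRel c₀ P Q A A' t b b'
  | full {c : Ordinal.{u}} {d : ZFSet.{u}} {s s' : StarData.{u}}
      (hi : Between c₀ (P.stem c₀) c) (h : StarRel c₀ P Q t c d s s') :
      BlkRel c₀ P Q A A' t (.full c d s) (.full c d s')
  | active {c : Ordinal.{u}} {z : List ESeq.{u}} {y : ESeq.{u}} {r r' : ZFSet.{u}}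
      (hi : Between c₀ (P.stem c₀) c) (hz : z = P.stem c₀) (hy : y ∈ P.T) (h0 : len y.d = 0)
      (hc : y.c = c) (hmc : P.mc = c₀ → y = ⟨c, c, ∅⟩)
      (hA : P.mc ≠ c₀ → ∃ w, A (t P.mc) (P.stem P.mc ++ y :: w))
      (hA' : P.mc ≠ c₀ → ∃ w, A' (t P.mc) (Q.stem P.mc ++ y :: w))
      (hr : rle r (P.f y)) (hR : r ∈ Rstem z c) (hr' : r' = modf (P.f y) (Q.f y) r) :
      BlkRel c₀ P Q A A' t (.degen c z r) (.degen c z r')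
  | passive {c : Ordinal.{u}} {z : List ESeq.{u}} {x : ESeq.{u}} {r r' : ZFSet.{u}}
      (hi : Between c₀ (P.stem c₀) c) (hz : z = [x]) (hx : ∀ v ∈ P.stem c₀, v.c < x.c)
      (hr' : r' = r) : BlkRel c₀ P Q A A' t (.degen c z r) (.degen c z r')

section BlkRel

variable {c₀ c : Ordinal.{u}} {d₀ d : ZFSet.{u}} {P Q s s' : StarData.{u}}
  {A A' A₁ A₁' A₂' : Ordinal.{u} × Ordinal.{u} → List ESeq.{u} → Prop}
  {t t' : Ordinal.{u} → Ordinal.{u} × Ordinal.{u}} {b b' b'' : Blk.{u}}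

theorem BlkRel.c_eq (h : BlkRel c₀ P Q A A' t b b') : b'.c = b.c := by
  cases h with
  | outside _ h => rw [h]
  | _ => rfl

theorem BlkRel.stemZero_eq (h : BlkRel c₀ P Q A A' t b b') : b'.stemZero = b.stemZero := by
  cases h with
  | outside _ h => rw [h]
  | full _ h => exact h.zero
  | _ => rfl

theorem BlkRel.valid (hM : Matched c₀ d₀ P Q) (h : BlkRel c₀ P Q A A' t b b') (hb : b.Valid) :
    b'.Valid := by
  cases h with
  | outside _ h => rwa [h]
  | full _ h => exact ⟨h.sys, h.valid'⟩
  | active hi hz hy h0 hc _ _ _ hr hR hr' =>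
    refine ⟨hb.1, hb.2.1, ?_⟩
    subst hc
    rw [hz] at hR ⊢
    rw [hr']
    exact (isR_Rstem _ _).modf_mem hR (hM.f_mem hy h0).2 hr (hM.dom _ hy h0)
  | passive _ _ _ hr' => rwa [hr']

theorem BlkRel.mono (hA : ∀ e l, A e l → A₁ e l) (hA' : ∀ e l, A' e l → A₁' e l)
    (h : BlkRel c₀ P Q A A' t b b') : BlkRel c₀ P Q A₁ A₁' t b b' := by
  cases h with
  | outside hi h => exact .outside hi h
  | full hi h => exact .full hi h
  | active hi hz hy h0 hc hmc h1 h2 hr hR hr' =>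
    exact .active hi hz hy h0 hc hmc (fun h => (h1 h).imp fun _ => hA _ _)
      (fun h => (h2 h).imp fun _ => hA' _ _) hr hR hr'
  | passive hi hz hx hr' => exact .passive hi hz hx hr'

theorem BlkRel.symm (hM : Matched c₀ d₀ P Q) (h : BlkRel c₀ P Q A A' t b b') :
    BlkRel c₀ Q P A' A t b' b := by
  cases h with
  | outside hi h =>
    subst h
    exact .outside (by rwa [hM.stem_zero]) rfl
  | full hi h => exact .full (by rwa [hM.stem_zero]) (h.symm hM)
  | active hi hz hy h0 hc hmc h1 h2 hr hR hr' =>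
    subst hc
    have hR' := hR
    rw [hz] at hR'
    have hd := hM.dom _ hy h0
    have hQ := (hM.f_mem hy h0).2
    have h3 := isR_Rstem (P.stem c₀) ‹ESeq›.c
    refine .active (y := ‹_›) (by rwa [hM.stem_zero]) (by rw [hz, hM.stem_zero]) (hM.T ▸ hy) h0 rfl
      (by rw [hM.mc]; exact hmc) (by rw [hM.mc]; exact h2) (by rw [hM.mc]; exact h1) ?_ ?_ ?_
    · rw [hr']; exact h3.modf_rle hQ
    · rw [hr', hz]; exact h3.modf_mem hR' hQ hr hd
    · rw [hr', h3.modf_modf hR' hQ hr hd]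
  | passive hi hz hx hr' =>
    exact .passive (by rwa [hM.stem_zero]) hz (by rwa [hM.stem_zero]) hr'.symm

theorem StarRel.congr (hM : Matched c₀ d₀ P Q) (h : StarRel c₀ P Q t c d s s')
    (ht : ∀ γ₀ ∈ P.supp, γ₀ ≠ c₀ → ∀ γ, t' γ₀ = (c, γ) ↔ t γ₀ = (c, γ)) :
    StarRel c₀ P Q t' c d s s' :=
  { h with
    tracked := fun γ₀ h₀ hne γ hγ => h.tracked γ₀ h₀ hne γ ((ht γ₀ h₀ hne γ).1 hγ)
    untracked := fun γ hγ => h.untracked γ fun γ₀ h₀ hne h' =>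
      hγ γ₀ h₀ hne ((ht γ₀ h₀ hne γ).2 h')
    active := fun ha => by
      obtain ⟨δ, h1, h2, h3, h4⟩ := h.active ha
      exact ⟨δ, h1, h2, fun hne => (ht _ hM.mc_mem hne δ).2 (h3 hne), h4⟩ }

/-- At a tracked coordinate the tail `w` is recovered from `s` by cancelling `P.stem γ₀`; the other
stems are copies. The coordinate `δ`, and with it `f`, is fixed by the place of `P.mc`. -/
theorem StarRel.unique (hM : Matched c₀ d₀ P Q) {s₁ s₂ : StarData.{u}}
    (h₁ : StarRel c₀ P Q t c d s s₁) (h₂ : StarRel c₀ P Q t' c d s s₂)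
    (ht : ∀ γ₀ ∈ P.supp, γ₀ ≠ c₀ → t γ₀ = t' γ₀) : s₁ = s₂ := by
  have hstem : s₁.stem = s₂.stem := by
    funext γ
    by_cases hγ : ∃ γ₀ ∈ P.supp, γ₀ ≠ c₀ ∧ t γ₀ = (c, γ)
    · obtain ⟨γ₀, h₀, hne, hγ⟩ := hγ
      obtain ⟨-, -, w, h3, h4⟩ := h₁.tracked γ₀ h₀ hne γ hγ
      obtain ⟨-, -, w', h5, h6⟩ := h₂.tracked γ₀ h₀ hne γ ((ht γ₀ h₀ hne).symm.trans hγ)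
      rw [h3] at h5
      rw [h4, h6, List.append_cancel_left h5]
    · push Not at hγ
      rw [h₁.untracked γ hγ, h₂.untracked γ fun γ₀ h₀ hne => by
        rw [← ht γ₀ h₀ hne]; exact hγ γ₀ h₀ hne]
  have hf : s₁.f = s₂.f := by
    by_cases ha : s.stem c = P.stem c₀
    · obtain ⟨δ, -, h3, h4, -, -, -, h5⟩ := h₁.active ha
      obtain ⟨δ', -, h6, h7, -, -, -, h8⟩ := h₂.active ha
      have hδ : δ = δ' := by
        by_cases hmc : P.mc = c₀
        · rw [h3 hmc, h6 hmc]
        · have := (h4 hmc).symm.trans ((ht _ hM.mc_mem hmc).trans (h7 hmc))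
          exact congrArg Prod.snd this
      subst hδ
      funext x
      by_cases hx : x ∈ s.T ∧ len x.d = 0
      · rw [(h5 x hx.1 hx.2).2.2, (h8 x hx.1 hx.2).2.2]
      · rw [h₁.valid'.f_off x (by rwa [h₁.T]), h₂.valid'.f_off x (by rwa [h₂.T])]
    · rw [(h₁.passive ha).1, (h₂.passive ha).1]
  have h1 := h₁.mc.trans h₂.mc.symm
  have h2 := h₁.supp.trans h₂.supp.symm
  have h3 := h₁.T.trans h₂.T.symm
  have h4 := h₁.F.trans h₂.F.symm
  obtain ⟨a1, a2, a3, a4, a5, a6⟩ := s₁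
  obtain ⟨b1, b2, b3, b4, b5, b6⟩ := s₂
  simp only at hstem hf h1 h2 h3 h4
  subst hstem hf h1 h2 h3 h4
  rfl

theorem BlkRel.unique (hM : Matched c₀ d₀ P Q) (hA : ∀ e l l', A e l → A e l' → l = l')
    (h₁ : BlkRel c₀ P Q A A' t b b') (h₂ : BlkRel c₀ P Q A A₂' t' b b'')
    (ht : ∀ γ₀ ∈ P.supp, γ₀ ≠ c₀ → t γ₀ = t' γ₀) : b' = b'' := by
  cases h₁ with
  | outside hi h =>
    cases h₂ with
    | outside _ h' => rw [h, h']
    | full hi' _ => exact absurd hi' hi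
    | active hi' => exact absurd hi' hi
    | passive hi' => exact absurd hi' hi
  | full hi h =>
    cases h₂ with
    | outside hi' _ => exact absurd hi hi'
    | full _ h' => rw [h.unique hM h' ht]
  | active hi hz hy h0 hc hmc h1 h2 hr hR hr' =>
    cases h₂ with
    | outside hi' _ => exact absurd hi hi'
    | active _ _ _ _ _ hmc' h1' _ _ _ hr'' =>
      rw [hr', hr'']
      -- The point `y` is recovered: it is `⟨c, c, ∅⟩` if the maximal coordinate is `c₀`, and
      -- otherwise the entry that follows `P.stem P.mc` at the place of `P.mc`.
      by_cases h : P.mc = c₀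
      · rw [hmc h, hmc' h]
      · obtain ⟨w, h3⟩ := h1 h
        obtain ⟨w', h4⟩ := h1' h
        rw [← ht _ hM.mc_mem h] at h4
        obtain ⟨rfl, -⟩ := List.cons.inj (List.append_cancel_left (hA _ _ _ h3 h4))
        rfl
    | passive _ hz' hx _ =>
      rw [← hz, hz'] at hx
      exact absurd (hx _ List.mem_cons_self) (lt_irrefl _)
  | passive hi hz hx hr =>
    cases h₂ with
    | outside hi' _ => exact absurd hi hi'
    | active _ hz' =>
      rw [← hz', hz] at hx
      exact absurd (hx _ List.mem_cons_self) (lt_irrefl _)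
    | passive _ _ _ hr' => rw [hr, hr']

theorem leStar_degen {c : Ordinal.{u}} {z : List ESeq.{u}} {r r' : ZFSet.{u}} (h : rle r r') :
    (Blk.degen c z r).LeStar (.degen c z r') := ⟨rfl, rfl, h⟩

theorem BlkRel.exists_leStar (hM : Matched c₀ d₀ P Q) (h : BlkRel c₀ P Q A A' t b b')
    {a : Blk.{u}} (ha : a.Valid) (hle : a.LeStar b) :
    ∃ a', a'.LeStar b' ∧ BlkRel c₀ P Q A A' t a a' := by
  cases h with
  | outside hi h =>
    subst h
    refine ⟨a, hle, .outside ?_ rfl⟩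
    cases a <;> cases b' <;> simp only [Blk.LeStar] at hle
    · rwa [Blk.c, hle.1]
    · rwa [Blk.c, hle.1]
  | full hi h =>
    cases a <;> simp only [Blk.LeStar] at hle
    obtain ⟨rfl, rfl, hle⟩ := hle
    obtain ⟨r', h1, h2⟩ := h.exists_leStar hM ha.2 hle
    exact ⟨.full _ _ r', ⟨rfl, rfl, h1⟩, .full hi h2⟩
  | active hi hz hy h0 hc hmc h1 h2 hr hR hr' =>
    cases a <;> simp only [Blk.LeStar] at hle
    obtain ⟨rfl, rfl, hle⟩ := hle
    subst hr'
    exact ⟨_, leStar_degen (modf_mono hle),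
      .active hi hz hy h0 hc hmc h1 h2 (hle.trans hr) ha.2.2 rfl⟩
  | passive hi hz hx hr' =>
    cases a <;> simp only [Blk.LeStar] at hle
    obtain ⟨rfl, rfl, hle⟩ := hle
    subst hr'
    exact ⟨_, leStar_degen hle, .passive hi hz hx rfl⟩

end BlkRel

/-! ### Corresponding conditions -/

/-- `t` tells where the coordinates of `P` are in the condition `L`. -/
def Tracks (c₀ : Ordinal.{u}) (P : StarData.{u}) (t : Ordinal.{u} → Ordinal.{u} × Ordinal.{u})
    (A : Ordinal.{u} × Ordinal.{u} → List ESeq.{u} → Prop) : Prop :=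
  ∀ γ₀ ∈ P.supp, γ₀ ≠ c₀ → ∃ y w, P.stem γ₀ = y :: w ∧ Path A y (c₀, γ₀) (t γ₀)

/-- `L` and `L'` are corresponding extensions of conditions with the blocks `P` and `Q` on `c₀`. -/
structure ListRel (c₀ : Ordinal.{u}) (P Q : StarData.{u}) (L L' : List Blk.{u})
    (t : Ordinal.{u} → Ordinal.{u} × Ordinal.{u}) : Prop where
  tracksP : Tracks c₀ P t (StemAt (Between c₀ (P.stem c₀)) L)
  tracksQ : Tracks c₀ Q t (StemAt (Between c₀ (P.stem c₀)) L')
  rel : List.Forall₂ (BlkRel c₀ P Q (StemAt (Between c₀ (P.stem c₀)) L)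
    (StemAt (Between c₀ (P.stem c₀)) L') t) L L'
  base : ∃ b ∈ L, b.c = c₀

theorem forall₂_exists_left {α β : Type*} {R : α → β → Prop} {l : List α} {l' : List β}
    (h : List.Forall₂ R l l') {b : β} (hb : b ∈ l') : ∃ a ∈ l, R a b := by
  induction h with
  | nil => simp at hb
  | cons h _ ih =>
    rcases List.mem_cons.1 hb with rfl | hb
    · exact ⟨_, List.mem_cons_self, h⟩
    · obtain ⟨a, ha, h'⟩ := ih hb
      exact ⟨a, List.mem_cons_of_mem _ ha, h'⟩

theorem StemAt.of_leStar {I : Ordinal.{u} → Prop} {L L' : List Blk.{u}}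
    (h : List.Forall₂ Blk.LeStar L' L) (e : Ordinal.{u} × Ordinal.{u}) (l : List ESeq.{u})
    (he : StemAt I L e l) : StemAt I L' e l := by
  obtain ⟨hI, d, s, hs, h1, h2, h3⟩ := he
  obtain ⟨b, hb, hle⟩ := forall₂_exists_left h hs
  cases b <;> simp only [Blk.LeStar] at hle
  obtain ⟨rfl, rfl, hle⟩ := hle
  exact ⟨hI, _, _, hb, hle.supp_sub h1, h2, (hle.stem_eq _ h1).trans h3⟩

theorem eq_of_c_eq {L : List Blk.{u}} (hL : L.Pairwise Blk.Below) {b b' : Blk.{u}} (hb : b ∈ L)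
    (hb' : b' ∈ L) (h : b.c = b'.c) : b = b' := by
  by_contra hne
  induction hL with
  | nil => simp at hb
  | cons h1 _ ih =>
    rcases List.mem_cons.1 hb with rfl | hb <;> rcases List.mem_cons.1 hb' with rfl | hb'
    · exact hne rfl
    · exact (h1 _ hb').1.ne h.symm
    · exact (h1 _ ‹_›).1.ne h
    · exact ih hb hb'

theorem StemAt.unique {I : Ordinal.{u} → Prop} {L : List Blk.{u}} (hL : L.Pairwise Blk.Below)
    (e : Ordinal.{u} × Ordinal.{u}) (l l' : List ESeq.{u}) (h : StemAt I L e l)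
    (h' : StemAt I L e l') : l = l' := by
  obtain ⟨-, d, s, hs, -, -, h3⟩ := h
  obtain ⟨-, d', s', hs', -, -, h3'⟩ := h'
  have := eq_of_c_eq hL hs hs' rfl
  injection this with _ _ h4
  rw [← h3, ← h3', h4]

section ListRel

variable {c₀ : Ordinal.{u}} {d₀ : ZFSet.{u}} {P Q : StarData.{u}} {L L' L'' : List Blk.{u}}
  {t t' : Ordinal.{u} → Ordinal.{u} × Ordinal.{u}}

theorem ListRel.symm (hM : Matched c₀ d₀ P Q) (h : ListRel c₀ P Q L L' t) :
    ListRel c₀ Q P L' L t where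
  tracksP := by rw [hM.stem_zero]; exact h.tracksQ
  tracksQ := by rw [hM.stem_zero]; exact h.tracksP
  rel := by
    rw [hM.stem_zero]
    exact (h.rel.imp fun _ _ h => h.symm hM).flip
  base := by
    obtain ⟨b, hb, hc⟩ := h.base
    obtain ⟨b', hb', h'⟩ := forall₂_exists_left h.rel.flip hb
    exact ⟨b', hb', h'.c_eq.trans hc⟩

theorem ListRel.unique (hM : Matched c₀ d₀ P Q) (hL : L.Pairwise Blk.Below)
    (h : ListRel c₀ P Q L L' t) (h' : ListRel c₀ P Q L L'' t') : L' = L'' := by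
  have hA := StemAt.unique (I := Between c₀ (P.stem c₀)) hL
  -- The places are the endpoints of paths in `L` alone, so they do not depend on the partner.
  have ht : ∀ γ₀ ∈ P.supp, γ₀ ≠ c₀ → t γ₀ = t' γ₀ := by
    intro γ₀ h₀ hne
    obtain ⟨y, w, h1, h2⟩ := h.tracksP γ₀ h₀ hne
    obtain ⟨y', w', h1', h2'⟩ := h'.tracksP γ₀ h₀ hne
    obtain ⟨rfl, -⟩ := List.cons.inj (h1.symm.trans h1')
    exact h2.unique hA h2'
  have key : ∀ {l l₁ l₂ : List Blk.{u}},
      List.Forall₂ (BlkRel c₀ P Q (StemAt (Between c₀ (P.stem c₀)) L)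
        (StemAt (Between c₀ (P.stem c₀)) L') t) l l₁ →
      List.Forall₂ (BlkRel c₀ P Q (StemAt (Between c₀ (P.stem c₀)) L)
        (StemAt (Between c₀ (P.stem c₀)) L'') t') l l₂ → l₁ = l₂ := by
    intro l l₁ l₂ h1 h2
    induction h1 generalizing l₂ with
    | nil => cases h2; rfl
    | cons hb _ ih =>
      cases h2 with
      | cons hb' hl => rw [hb.unique hM hA hb' ht, ih hl]
  exact key h.rel h'.rel

theorem ListRel.exists_leStar (hM : Matched c₀ d₀ P Q) (h : ListRel c₀ P Q L L' t)
    {K : List Blk.{u}} (hK : ∀ b ∈ K, b.Valid) (hle : List.Forall₂ Blk.LeStar K L) :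
    ∃ K', List.Forall₂ Blk.LeStar K' L' ∧ ListRel c₀ P Q K K' t := by
  have key : ∀ {A A' : Ordinal.{u} × Ordinal.{u} → List ESeq.{u} → Prop} {l l' k : List Blk.{u}},
      List.Forall₂ (BlkRel c₀ P Q A A' t) l l' → List.Forall₂ Blk.LeStar k l →
      (∀ b ∈ k, b.Valid) →
      ∃ k', List.Forall₂ Blk.LeStar k' l' ∧ List.Forall₂ (BlkRel c₀ P Q A A' t) k k' := by
    intro A A' l l' k h1 h2 hk
    induction h1 generalizing k with
    | nil => cases h2; exact ⟨[], .nil, .nil⟩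
    | cons hb _ ih =>
      cases h2 with
      | cons ha hl =>
        obtain ⟨a', h3, h4⟩ := hb.exists_leStar hM (hk _ List.mem_cons_self) ha
        obtain ⟨k', h5, h6⟩ := ih hl fun b hb => hk b (List.mem_cons_of_mem _ hb)
        exact ⟨a' :: k', .cons h3 h5, .cons h4 h6⟩
  obtain ⟨K', h1, h2⟩ := key h.rel hle hK
  have hA := StemAt.of_leStar (I := Between c₀ (P.stem c₀)) hle
  have hA' := StemAt.of_leStar (I := Between c₀ (P.stem c₀)) h1
  refine ⟨K', h1, ?_, ?_, h2.imp fun _ _ h => h.mono hA hA', ?_⟩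
  · intro γ₀ h₀ hne
    obtain ⟨y, w, h3, h4⟩ := h.tracksP γ₀ h₀ hne
    exact ⟨y, w, h3, h4.mono hA⟩
  · intro γ₀ h₀ hne
    obtain ⟨y, w, h3, h4⟩ := h.tracksQ γ₀ h₀ hne
    exact ⟨y, w, h3, h4.mono hA'⟩
  · obtain ⟨b, hb, hc⟩ := h.base
    obtain ⟨a, ha, h3⟩ := forall₂_exists_left hle hb
    refine ⟨a, ha, ?_⟩
    cases a <;> cases b <;> simp only [Blk.LeStar] at h3
    · exact h3.1.trans hc
    · exact h3.1.trans hc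

end ListRel

/-! ### One-point extensions of corresponding conditions -/

section

variable {c₀ c : Ordinal.{u}} {d₀ d : ZFSet.{u}} {P Q s s' : StarData.{u}}
  {t : Ordinal.{u} → Ordinal.{u} × Ordinal.{u}} {ν : ESeq.{u}} {L₀ L₁ : List Blk.{u}}
  {b b₀ b₁ : Blk.{u}} {I : Ordinal.{u} → Prop}

theorem mem_split {b' : Blk.{u}} (hb : b ∈ L₀ ∨ b ∈ L₁) : b ∈ L₀ ++ b₀ :: b' :: L₁ := by
  rcases hb with hb | hb
  · exact List.mem_append_left _ hb
  · exact List.mem_append_right _ (List.mem_cons_of_mem _ (List.mem_cons_of_mem _ hb))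

theorem c_ne_of_mem (hL : (L₀ ++ Blk.full c d s :: L₁).Pairwise Blk.Below)
    (hb : b ∈ L₀ ∨ b ∈ L₁) : b.c ≠ c := by
  rw [List.pairwise_append, List.pairwise_cons] at hL
  rcases hb with hb | hb
  · exact (hL.2.2 b hb _ List.mem_cons_self).1.ne'
  · exact (hL.2.1.1 b hb).1.ne

/-- The critical point of an added block is new: it is below `c`, and it is above `p^0`, which
bounds all lower blocks. -/
theorem c_ne_of_permitted (hL : (L₀ ++ Blk.full c d s :: L₁).Pairwise Blk.Below) (hνc : ν.c < c)
    (hν0 : Permitted ν (s.stem c)) (hb : b ∈ L₀ ++ Blk.full c d s :: L₁) : b.c ≠ ν.c := by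
  rw [List.pairwise_append, List.pairwise_cons] at hL
  rcases List.mem_append.1 hb with hb | hb
  · exact (hνc.trans (hL.2.2 b hb _ List.mem_cons_self).1).ne'
  · rcases List.mem_cons.1 hb with rfl | hb
    · exact hνc.ne'
    · obtain ⟨-, x, hx, hle⟩ := hL.2.1.1 b hb
      refine (hle.trans_lt (hν0 x ?_)).ne
      change s.stem c = [x] at hx
      rw [hx]; exact List.mem_cons_self

theorem StemAt.split (hL : (L₀ ++ Blk.full c d s :: L₁).Pairwise Blk.Below)
    {e : Ordinal.{u} × Ordinal.{u}} {l : List ESeq.{u}} {b' : Blk.{u}}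
    (h : StemAt I (L₀ ++ Blk.full c d s :: L₁) e l) :
    (e.1 ≠ c ∧ StemAt I (L₀ ++ b₀ :: b' :: L₁) e l) ∨
      (e.1 = c ∧ e.2 ∈ s.supp ∧ e.2 ≠ c ∧ s.stem e.2 = l) := by
  obtain ⟨hI, d', s', hs, h1, h2, h3⟩ := h
  by_cases he : e.1 = c
  · right
    have := eq_of_c_eq hL hs (b' := Blk.full c d s) (by simp) he
    injection this with _ _ h4
    subst h4
    exact ⟨he, h1, he ▸ h2, h3⟩
  · left
    refine ⟨he, hI, d', s', mem_split ?_, h1, h2, h3⟩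
    rcases List.mem_append.1 hs with hs | hs
    · exact Or.inl hs
    · rcases List.mem_cons.1 hs with hs | hs
      · injection hs with h4
        exact absurd h4 he
      · exact Or.inr hs

/-- The lower part `b₁` of the one-point extension of `s` by `ν`. -/
def LowerBlk (c : Ordinal.{u}) (d : ZFSet.{u}) (s : StarData.{u}) (ν : ESeq.{u}) (b₁ : Blk.{u}) :
    Prop :=
  (0 < len ν.d → ∃ p₁ : StarData.{u}, b₁ = .full ν.c ν.d p₁ ∧ s.IsLower d ν p₁) ∧
    (len ν.d = 0 → b₁ = .degen ν.c (s.stem c) (s.f ν))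

/-- With `StemAt.reloc_next`, this provides the hypotheses of `Path.relocate` for a one-point
extension. -/
theorem StemAt.reloc_le (hL : (L₀ ++ Blk.full c d s :: L₁).Pairwise Blk.Below)
    (hs : s.Valid c d) (hν : ν ∈ s.T) (hν0 : Permitted ν (s.stem c))
    (hprc : (proj d s.mc c ν).a = ν.c) (hI : I ν.c) (hlow : LowerBlk c d s ν b₁)
    (e : Ordinal.{u} × Ordinal.{u}) (l : List ESeq.{u})
    (h : StemAt I (L₀ ++ Blk.full c d s :: L₁) e l) :
    ∃ w, StemAt I (L₀ ++ Blk.full c d (s.upper c d ν) :: b₁ :: L₁) (reloc c d s ν e) (l ++ w) := by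
  have hIc := h.1
  rcases h.split hL (b₀ := Blk.full c d (s.upper c d ν)) (b' := b₁) with
    ⟨he, h⟩ | ⟨he, h1, h2, h3⟩
  · exact ⟨[], by rw [reloc_of_ne he, List.append_nil]; exact h⟩
  · obtain ⟨e1, γ⟩ := e
    dsimp only at he h1 h2 h3 hIc
    subst he
    by_cases hγ : γ ∈ s.permSet ν ∧ 0 < len ν.d
    · rw [reloc_of_mem hγ.1 hγ.2]
      obtain ⟨p₁, rfl, hl⟩ := hlow.1 hγ.2
      refine ⟨[], hI, ν.d, p₁, by simp, ?_, fun h4 => h2 ?_, ?_⟩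
      · rw [hl.supp]; exact ⟨γ, hγ.1, rfl⟩
      · exact hs.proj_a_injOn hν hγ.1 ⟨hs.zero_mem, hν0⟩ (h4.trans hprc.symm)
      · rw [hl.stem γ hγ.1, h3, List.append_nil]
    · rw [reloc_of_not hγ]
      by_cases hγ' : γ ∈ s.permSet ν
      · refine ⟨[proj d s.mc γ ν], hIc, d, s.upper e1 d ν, by simp, h1, h2, ?_⟩
        rw [← h3]; exact upper_stem_of_mem' hγ' fun h' => h'.elim (fun h' => hγ ⟨hγ', h'⟩) h2
      · refine ⟨[], hIc, d, s.upper e1 d ν, by simp, h1, h2, ?_⟩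
        rw [← h3, List.append_nil]; exact upper_stem_of_notMem hγ'

theorem StemAt.reloc_next (hL : (L₀ ++ Blk.full c d s :: L₁).Pairwise Blk.Below)
    (e : Ordinal.{u} × Ordinal.{u}) (l : List ESeq.{u})
    (h : StemAt I (L₀ ++ Blk.full c d s :: L₁) e l) :
    reloc c d s ν e = e ∨
      ∃ y, StemAt I (L₀ ++ Blk.full c d (s.upper c d ν) :: b₁ :: L₁) e [y] ∧
        reloc c d s ν e = (y.c, y.a) ∧ ∀ z ∈ l, z.c < y.c := by
  have hIc := h.1
  rcases h.split hL (b₀ := Blk.full c d (s.upper c d ν)) (b' := b₁) with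
    ⟨he, h⟩ | ⟨he, h1, h2, h3⟩
  · exact Or.inl (reloc_of_ne he)
  · obtain ⟨e1, γ⟩ := e
    dsimp only at he h1 h2 h3 hIc
    subst he
    by_cases hγ : γ ∈ s.permSet ν ∧ 0 < len ν.d
    · refine Or.inr ⟨proj d s.mc γ ν, ⟨hIc, d, s.upper e1 d ν, by simp, h1, h2, ?_⟩, reloc_of_mem hγ.1 hγ.2, ?_⟩
      · exact upper_stem_of_mem hγ.1 (Or.inl hγ.2)
      · rw [← h3]; exact hγ.1.2
    · exact Or.inl (reloc_of_not hγ)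

theorem Tracks.relocate {z : List ESeq.{u}}
    (h : Tracks c₀ P t (StemAt (Between c₀ z) (L₀ ++ Blk.full c d s :: L₁)))
    (hL : (L₀ ++ Blk.full c d s :: L₁).Pairwise Blk.Below)
    (hs : s.Valid c d) (hν : ν ∈ s.T) (hν0 : Permitted ν (s.stem c))
    (hprc : (proj d s.mc c ν).a = ν.c) (hI : Between c₀ z ν.c) (hlow : LowerBlk c d s ν b₁) :
    Tracks c₀ P (fun γ => reloc c d s ν (t γ)) (StemAt (Between c₀ z)
      (L₀ ++ Blk.full c d (s.upper c d ν) :: b₁ :: L₁)) := by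
  intro γ₀ h₀ hne
  obtain ⟨y, w, h1, h2⟩ := h γ₀ h₀ hne
  exact ⟨y, w, h1, h2.relocate (StemAt.reloc_le hL hs hν hν0 hprc hI hlow)
    (StemAt.reloc_next hL)⟩

/-- A block on a critical point other than `c` and `κ⁰(ν)` neither gains nor loses tracked
coordinates. Only the recorded `y` of an active block of length `0` has to be followed to its new
place. -/
theorem BlkRel.relocate {L₀' L₁' : List Blk.{u}} {b₁' b' : Blk.{u}} (hM : Matched c₀ d₀ P Q)
    (hL : (L₀ ++ Blk.full c d s :: L₁).Pairwise Blk.Below)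
    (hL' : (L₀' ++ Blk.full c d s' :: L₁').Pairwise Blk.Below)
    (hR : StarRel c₀ P Q t c d s s') (hν : ν ∈ s.T) (hν0 : Permitted ν (s.stem c))
    (hI : Between c₀ (P.stem c₀) ν.c) (hlow : LowerBlk c d s ν b₁) (hlow' : LowerBlk c d s' ν b₁')
    (hbc : b.c ≠ c) (hbν : b.c ≠ ν.c)
    (h : BlkRel c₀ P Q (StemAt (Between c₀ (P.stem c₀)) (L₀ ++ Blk.full c d s :: L₁))
      (StemAt (Between c₀ (P.stem c₀)) (L₀' ++ Blk.full c d s' :: L₁')) t b b') :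
    BlkRel c₀ P Q
      (StemAt (Between c₀ (P.stem c₀)) (L₀ ++ Blk.full c d (s.upper c d ν) :: b₁ :: L₁))
      (StemAt (Between c₀ (P.stem c₀)) (L₀' ++ Blk.full c d (s'.upper c d ν) :: b₁' :: L₁'))
      (fun γ => reloc c d s ν (t γ)) b b' := by
  cases h with
  | outside hi h => exact .outside hi h
  | @full c' d' u u' hi h =>
    refine .full hi (h.congr hM fun γ₀ h₀ hne γ => ?_)
    by_cases h' : (t γ₀).1 = c ∧ (t γ₀).2 ∈ s.permSet ν ∧ 0 < len ν.d
    · rw [reloc, if_pos h']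
      constructor
      · intro h1
        exact absurd (congrArg Prod.fst h1).symm hbν
      · intro h1
        rw [h1] at h'
        exact absurd h'.1 hbc
    · rw [reloc, if_neg h']
  | active hi hz hy h0 hc hmc h1 h2 hr hR' hr' =>
    refine .active hi hz hy h0 hc hmc (fun h => ?_) (fun h => ?_) hr hR' hr'
    · obtain ⟨w, hw⟩ := h1 h
      obtain ⟨w', hw'⟩ := StemAt.reloc_le hL hR.valid hν hν0 (hR.proj_zero ν hν hν0) hI hlow _ _ hw
      exact ⟨w ++ w', by rwa [List.append_assoc, List.cons_append] at hw'⟩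
    · obtain ⟨w, hw⟩ := h2 h
      obtain ⟨w', hw'⟩ := StemAt.reloc_le hL' hR.valid' (hR.T ▸ hν) (by rwa [hR.zero])
        (by rw [hR.mc]; exact hR.proj_zero ν hν hν0) hI hlow' _ _ hw
      rw [hR.reloc_eq hν] at hw'
      exact ⟨w ++ w', by rwa [List.append_assoc, List.cons_append] at hw'⟩
  | passive hi hz hx hr' => exact .passive hi hz hx hr'

theorem forall₂_split {α β : Type*} {R : α → β → Prop} {l₀ l₁ : List α} {a : α} {l' : List β}
    (h : List.Forall₂ R (l₀ ++ a :: l₁) l') : ∃ l₀' b l₁', l' = l₀' ++ b :: l₁' ∧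
      List.Forall₂ R l₀ l₀' ∧ R a b ∧ List.Forall₂ R l₁ l₁' := by
  induction l₀ generalizing l' with
  | nil =>
    cases h with
    | cons h t => exact ⟨[], _, _, rfl, .nil, h, t⟩
  | cons x l₀ ih =>
    cases h with
    | cons h t =>
      obtain ⟨l₀', b, l₁', rfl, h1, h2, h3⟩ := ih t
      exact ⟨_ :: l₀', b, l₁', rfl, .cons h h1, h2, h3⟩

theorem forall₂_append {α β : Type*} {R : α → β → Prop} {l₀ l₁ : List α} {l₀' l₁' : List β}
    (h : List.Forall₂ R l₀ l₀') (h' : List.Forall₂ R l₁ l₁') :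
    List.Forall₂ R (l₀ ++ l₁) (l₀' ++ l₁') := by
  induction h with
  | nil => exact h'
  | cons h _ ih => exact .cons h ih

theorem forall₂_imp_mem {α β : Type*} {R S : α → β → Prop} {l : List α} {l' : List β}
    (h : List.Forall₂ R l l') (hi : ∀ a ∈ l, ∀ b, R a b → S a b) : List.Forall₂ S l l' := by
  induction h with
  | nil => exact .nil
  | cons h _ ih =>
    exact .cons (hi _ List.mem_cons_self _ h) (ih fun a ha => hi a (List.mem_cons_of_mem _ ha))

/-- If `c > c₀`, the block on `c₀` lies below the one on `c`, hence at or below its `p^0`, so `κ⁰(ν)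
> c₀`. If `c` is not above all of `P.stem c₀`, neither is the smaller `κ⁰(ν)`. -/
theorem not_between_of_split {z : List ESeq.{u}}
    (hL : (L₀ ++ Blk.full c d s :: L₁).Pairwise Blk.Below)
    (hbase : ∃ b ∈ L₀ ++ Blk.full c d s :: L₁, b.c = c₀) (hνc : ν.c < c)
    (hν0 : Permitted ν (s.stem c)) (hi : ¬ Between c₀ z c) : ¬ Between c₀ z ν.c := by
  rintro ⟨h1, h2⟩
  refine hi ⟨?_, fun x hx => (h2 x hx).trans hνc⟩
  by_contra hc
  rw [not_le] at hc
  obtain ⟨b, hb, hbc⟩ := hbase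
  rw [List.pairwise_append, List.pairwise_cons] at hL
  rcases List.mem_append.1 hb with hb | hb
  · have := (hL.2.2 b hb _ List.mem_cons_self).1
    rw [hbc] at this
    exact this.not_gt hc
  · rcases List.mem_cons.1 hb with rfl | hb
    · exact hc.ne' hbc
    · obtain ⟨-, x, hx, hle⟩ := hL.2.1.1 b hb
      change s.stem c = [x] at hx
      rw [hbc] at hle
      exact (h1.trans hle).not_gt (hν0 x (by rw [hx]; exact List.mem_cons_self))

theorem StarRel.isOnePoint (hM : Matched c₀ d₀ P Q) (h : StarRel c₀ P Q t c d s s')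
    (hi : Between c₀ (P.stem c₀) c) (hI : Between c₀ (P.stem c₀) ν.c)
    (ht : ∀ γ₀ ∈ P.supp, γ₀ ≠ c₀ → (t γ₀).1 ≠ ν.c) (ho : IsOnePoint c d s ν b₁ b₀) :
    ∃ b₁', IsOnePoint c d s' ν b₁' (.full c d (s'.upper c d ν)) ∧
      StarRel c₀ P Q (fun γ => reloc c d s ν (t γ)) c d (s.upper c d ν) (s'.upper c d ν) ∧
      ∀ L₀ L₁ L₀' L₁' : List Blk.{u}, BlkRel c₀ P Q
        (StemAt (Between c₀ (P.stem c₀)) (L₀ ++ Blk.full c d (s.upper c d ν) :: b₁ :: L₁))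
        (StemAt (Between c₀ (P.stem c₀)) (L₀' ++ Blk.full c d (s'.upper c d ν) :: b₁' :: L₁'))
        (fun γ => reloc c d s ν (t γ)) b₁ b₁' := by
  rw [isOnePoint_iff] at ho
  obtain ⟨hν, hab, hν0, hv1, hv0, rfl, ho1, ho2⟩ := ho
  have hup := h.upper hν hν0 hI.2 hv0.2
  have hone : ∀ b₁', b₁'.Valid → LowerBlk c d s' ν b₁' →
      IsOnePoint c d s' ν b₁' (.full c d (s'.upper c d ν)) := fun b₁' hv hl =>
    isOnePoint_iff.2 ⟨h.T ▸ hν, (h.above_iff hM _).1 hab, by rwa [h.zero], hv,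
      ⟨h.sys, hup.valid'⟩, rfl, hl.1, hl.2⟩
  rcases eq_or_ne (len ν.d) 0 with h0 | h0
  · have hb := ho2 h0
    subst hb
    have hl' : LowerBlk c d s' ν (.degen ν.c (s.stem c) (s'.f ν)) :=
      ⟨fun h' => absurd h0 h'.ne', fun _ => by rw [h.zero]⟩
    have hf' := h.valid'.f_mem ν (h.T ▸ hν) h0
    rw [h.zero] at hf'
    refine ⟨.degen ν.c (s.stem c) (s'.f ν), hone _ ⟨hv1.1, hv1.2.1, hf'⟩ hl', hup, fun L₀ L₁ L₀' L₁' => ?_⟩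
    -- In the active case the new block of length `0` carries a condition below `P.f y`, where `y`
    -- is the projection of `ν` to `δ`. No coordinate moves, and if `P.mc ≠ c₀` then `y` has just
    -- been appended to `P.stem P.mc` in the upper part.
    by_cases ha : s.stem c = P.stem c₀
    · obtain ⟨δ, h1, h2, h3, h4, h5, h6, h7⟩ := h.active ha
      obtain ⟨h8, h9, h10⟩ := h7 ν hν h0
      have hδ : δ ∈ s.permSet ν := ⟨h1, h6 ν hν⟩
      have hmem : P.mc ≠ c₀ → δ ≠ c := fun hmc =>
        (h.tracked _ hM.mc_mem hmc δ (h3 hmc)).2.1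
      have hn : ¬ (δ ∈ s.permSet ν ∧ 0 < len ν.d) := fun h' => h'.2.ne' h0
      refine .active hI ha h8 h0 rfl (fun hmc => ?_) (fun hmc => ⟨[], ?_⟩)
        (fun hmc => ⟨[], ?_⟩) h9 hv1.2.2 h10
      · rw [h2 hmc]
        exact ESeq.ext rfl (h.proj_zero ν hν hν0)
          ((h.valid.T_ext ν hν).1.d_eq.1 h0)
      · rw [h3 hmc, reloc_of_not hn, ← h4]
        exact ⟨hi, d, s.upper c d ν, by simp, h1, hmem hmc,
          upper_stem_of_mem' hδ fun h' => h'.elim (fun h' => hn ⟨hδ, h'⟩) (hmem hmc)⟩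
      · rw [h3 hmc, reloc_of_not hn, ← h5, ← h.mc]
        refine ⟨hi, d, s'.upper c d ν, by simp, h.supp ▸ h1, hmem hmc, upper_stem_of_mem' ?_
          fun h' => h'.elim (fun h' => hn ⟨hδ, h'⟩) (hmem hmc)⟩
        rw [h.permSet_eq hν]; exact hδ
    · obtain ⟨h1, x, h2, h3⟩ := h.passive ha
      exact .passive hI h2 h3 (by rw [h1])
  · have h0 : 0 < len ν.d := pos_iff_ne_zero.2 h0
    obtain ⟨p₁, rfl, hl⟩ := ho1 h0
    obtain ⟨p₁', hl', hR⟩ := h.lower hν hν0 h0 ht hv1.1 hv1.2 hl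
    refine ⟨.full ν.c ν.d p₁', hone _ ⟨hR.sys, hR.valid'⟩
      ⟨fun _ => ⟨p₁', rfl, hl'⟩, fun h' => absurd h' h0.ne'⟩, hup, fun _ _ _ _ => .full hI hR⟩

theorem ListRel.exists_isOnePoint {L' : List Blk.{u}} (hM : Matched c₀ d₀ P Q)
    (h : ListRel c₀ P Q (L₀ ++ Blk.full c d s :: L₁) L' t)
    (hL : (L₀ ++ Blk.full c d s :: L₁).Pairwise Blk.Below) (hL' : L'.Pairwise Blk.Below)
    (hv : (Blk.full c d s).Valid) (ho : IsOnePoint c d s ν b₁ b₀) :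
    ∃ L₀' s' L₁' b₁' b₀' t', L' = L₀' ++ Blk.full c d s' :: L₁' ∧ IsOnePoint c d s' ν b₁' b₀' ∧
      ListRel c₀ P Q (L₀ ++ b₀ :: b₁ :: L₁) (L₀' ++ b₀' :: b₁' :: L₁') t' := by
  obtain ⟨hν, -, hν0, -, -, rfl, ho1, ho2⟩ := isOnePoint_iff.1 ho
  have hνc : ν.c < c := c_lt_of_code (hv.2.T_ext ν hν).2
  have hb₁c : b₁.c = ν.c := by
    rcases eq_or_ne (len ν.d) 0 with h0 | h0
    · rw [ho2 h0]; rfl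
    · obtain ⟨p₁, rfl, -⟩ := ho1 (pos_iff_ne_zero.2 h0); rfl
  have hbase : ∃ b ∈ L₀ ++ Blk.full c d (s.upper c d ν) :: b₁ :: L₁, b.c = c₀ := by
    obtain ⟨b, hb, hbc⟩ := h.base
    rcases List.mem_append.1 hb with hb | hb
    · exact ⟨b, mem_split (Or.inl hb), hbc⟩
    · rcases List.mem_cons.1 hb with rfl | hb
      · exact ⟨_, List.mem_append_right _ List.mem_cons_self, hbc⟩
      · exact ⟨b, mem_split (Or.inr hb), hbc⟩
  obtain ⟨L₀', b', L₁', rfl, h0, hb, h1⟩ := forall₂_split h.rel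
  have hmemb : ∀ b, b ∈ L₀ ∨ b ∈ L₁ → b ∈ L₀ ++ Blk.full c d s :: L₁ := fun b hb =>
    List.mem_append.2 (hb.imp_right (List.mem_cons_of_mem _))
  by_cases hi : Between c₀ (P.stem c₀) c
  · cases hb with
    | outside hi' _ => exact absurd hi hi'
    | @full _ _ _ s' _ hR =>
    -- `ν` is permitted to the current `p^0`, which is either `P.stem c₀` or lies above it.
    have hI : Between c₀ (P.stem c₀) ν.c := by
      refine ⟨hνc.le.trans hi.1, ?_⟩
      by_cases ha : s.stem c = P.stem c₀
      · rw [← ha]; exact hν0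
      · obtain ⟨-, x, h2, h3⟩ := hR.passive ha
        exact fun z hz => (h3 z hz).trans (hν0 x (by rw [h2]; exact List.mem_cons_self))
    have ht : ∀ γ₀ ∈ P.supp, γ₀ ≠ c₀ → (t γ₀).1 ≠ ν.c := by
      intro γ₀ h₀ hne
      obtain ⟨y, w, -, h2⟩ := h.tracksP γ₀ h₀ hne
      obtain ⟨w, -, d', u, hu, -⟩ := h2.endpoint
      exact c_ne_of_permitted hL hνc hν0 hu
    obtain ⟨b₁', hone, hup, hlow⟩ := hR.isOnePoint hM hi hI ht ho
    obtain ⟨-, -, -, -, -, -, ho1', ho2'⟩ := isOnePoint_iff.1 hone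
    have hprc := hR.proj_zero ν hν hν0
    have hrel : ∀ b, b ∈ L₀ ∨ b ∈ L₁ → ∀ b', _ → _ := fun b hb b' hb' =>
      BlkRel.relocate (b := b) (b' := b') hM hL hL' hR hν hν0 hI ⟨ho1, ho2⟩ ⟨ho1', ho2'⟩
        (c_ne_of_mem hL hb) (c_ne_of_permitted hL hνc hν0 (hmemb b hb)) hb'
    refine ⟨L₀', s', L₁', b₁', _, fun γ => reloc c d s ν (t γ), rfl, hone, ?_, ?_, ?_, hbase⟩
    · exact h.tracksP.relocate hL hR.valid hν hν0 hprc hI ⟨ho1, ho2⟩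
    · rw [← hR.reloc_eq hν]
      exact h.tracksQ.relocate hL' hR.valid' (hR.T ▸ hν) (by rwa [hR.zero])
        (by rw [hR.mc]; exact hprc) hI ⟨ho1', ho2'⟩
    · exact forall₂_append (forall₂_imp_mem h0 fun b hb => hrel b (Or.inl hb))
        (.cons (.full hi hup) (.cons (hlow _ _ _ _)
          (forall₂_imp_mem h1 fun b hb => hrel b (Or.inr hb))))
  · cases hb with
    | full hi' _ => exact absurd hi' hi
    | outside _ hb' =>
    subst hb'
    have hI := not_between_of_split hL h.base hνc hν0 hi
    have hA : ∀ (L₀ L₁ : List Blk.{u}), (L₀ ++ Blk.full c d s :: L₁).Pairwise Blk.Below →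
        ∀ e l, StemAt (Between c₀ (P.stem c₀)) (L₀ ++ Blk.full c d s :: L₁) e l →
        StemAt (Between c₀ (P.stem c₀)) (L₀ ++ Blk.full c d (s.upper c d ν) :: b₁ :: L₁) e l := by
      intro L₀ L₁ hL e l he
      rcases he.split hL with ⟨-, h⟩ | ⟨h2, -⟩
      · exact h
      · exact absurd (h2 ▸ he.1) hi
    refine ⟨L₀', s, L₁', b₁, _, t, rfl, ho, ?_, ?_, ?_, hbase⟩
    · intro γ₀ h₀ hne
      obtain ⟨y, w, h3, h4⟩ := h.tracksP γ₀ h₀ hne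
      exact ⟨y, w, h3, h4.mono (hA _ _ hL)⟩
    · intro γ₀ h₀ hne
      obtain ⟨y, w, h3, h4⟩ := h.tracksQ γ₀ h₀ hne
      exact ⟨y, w, h3, h4.mono (hA _ _ hL')⟩
    · exact forall₂_append (h0.imp fun _ _ hb => hb.mono (hA _ _ hL) (hA _ _ hL'))
        (.cons (.outside hi rfl) (.cons (.outside (by rwa [hb₁c]) rfl)
          (h1.imp fun _ _ hb => hb.mono (hA _ _ hL) (hA _ _ hL'))))

end

/-! ### Isomorphisms of cones from simulations -/

theorem Blk.Below.trans {b b' b'' : Blk.{u}} (h : b.Below b') (h' : b'.Below b'') : b.Below b'' := by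
  obtain ⟨h1, x, hx, h2⟩ := h
  exact ⟨h'.1.trans h1, x, hx, h'.1.le.trans h2⟩

instance : Trans Blk.Below.{u} Blk.Below.{u} Blk.Below.{u} := ⟨Blk.Below.trans⟩

/-! ### Building conditions of the same shape, and simulations. -/

section PCond

variable {κ : Ordinal.{u}} {d : ZFSet.{u}}

theorem PCond.pairwise (p : PCond κ d) : p.1.Pairwise Blk.Below :=
  List.isChain_iff_pairwise.1 p.2.2.2

/-- `b'` may replace `b` in a condition. -/
structure Blk.SameShape (b b' : Blk.{u}) : Prop where
  c_eq : b'.c = b.c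
  stemZero_eq : b'.stemZero = b.stemZero
  valid : b.Valid → b'.Valid
  full : ∀ c d s, b = .full c d s → ∃ s', b' = .full c d s'

theorem pairwise_below_of_sameShape {L L' : List Blk.{u}} (h : List.Forall₂ Blk.SameShape L L')
    (hL : L.Pairwise Blk.Below) : L'.Pairwise Blk.Below := by
  induction h with
  | nil => exact .nil
  | cons hb ht ih =>
    rw [List.pairwise_cons] at hL ⊢
    refine ⟨fun b' hb' => ?_, ih hL.2⟩
    obtain ⟨a, ha, h1⟩ := forall₂_exists_left ht hb'
    obtain ⟨h2, x, h3, h4⟩ := hL.1 a ha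
    exact ⟨by rw [h1.c_eq, hb.c_eq]; exact h2, x, hb.stemZero_eq.trans h3, by rwa [h1.c_eq]⟩

theorem PCond.exists_of_sameShape (p : PCond κ d) {L : List Blk.{u}}
    (h : List.Forall₂ Blk.SameShape p.1 L) : ∃ q : PCond κ d, q.1 = L := by
  refine ⟨⟨L, ?_, fun b hb => ?_,
    List.isChain_iff_pairwise.2 (pairwise_below_of_sameShape h p.pairwise)⟩, rfl⟩
  · obtain ⟨r, L', hr⟩ := p.2.1
    rw [hr] at h
    cases h with
    | cons h _ =>
      obtain ⟨s', hs⟩ := h.full _ _ _ rfl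
      exact ⟨s', _, by rw [hs]⟩
  · obtain ⟨a, ha, h1⟩ := forall₂_exists_left h hb
    exact h1.valid (p.2.2.1 a ha)

/-- `R` is a simulation for direct extensions and for one-point extensions. -/
structure Simulation (R : PCond κ d → PCond κ d → Prop) : Prop where
  leStar : ∀ p q r, R p q → r.LeStar p → ∃ r' : PCond κ d, r'.LeStar q ∧ R r r'
  leOne : ∀ p q r, R p q → r.LeOne p → ∃ r' : PCond κ d, r'.LeOne q ∧ R r r'
  unique : ∀ p q q', R p q → R p q' → q = q'

theorem Simulation.leN {R : PCond κ d → PCond κ d → Prop} (h : Simulation R) {p q : PCond κ d}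
    (hR : R p q) : ∀ n, ∀ r, PCond.LeN n r p → ∃ r', PCond.LeN n r' q ∧ R r r'
  | 0, r, hn => h.leStar p q r hR hn
  | 1, r, hn => h.leOne p q r hR hn
  | n + 2, r, ⟨s, h1, h2⟩ => by
    obtain ⟨s', h3, h4⟩ := h.leN hR (n + 1) s h2
    obtain ⟨r', h5, h6⟩ := h.leOne s s' r h4 h1
    exact ⟨r', ⟨s', h5, h3⟩, h6⟩

theorem Simulation.le {R : PCond κ d → PCond κ d → Prop} (h : Simulation R) {p q r : PCond κ d}
    (hR : R p q) (hr : r ≤ p) : ∃ r' ≤ q, R r r' := by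
  obtain ⟨n, hn⟩ := hr
  obtain ⟨r', h1, h2⟩ := h.leN hR n r hn
  exact ⟨r', ⟨n, h1⟩, h2⟩

/-- Uniqueness in both directions makes the two choice functions inverse to each other. For the
order, an element below a related one has a partner below the other, and uniqueness identifies that
partner with the chosen one. -/
theorem Simulation.nonempty_iso {R : PCond κ d → PCond κ d → Prop} (h : Simulation R)
    (h' : Simulation (flip R)) {p q : PCond κ d} (hR : R p q) :
    Nonempty ({r : PCond κ d // r ≤ p} ≃o {r : PCond κ d // r ≤ q}) := by
  have h1 : ∀ r : {r : PCond κ d // r ≤ p}, ∃ s : {r : PCond κ d // r ≤ q}, R r s := fun r => by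
    obtain ⟨s, hs, hRs⟩ := h.le hR r.2
    exact ⟨⟨s, hs⟩, hRs⟩
  have h2 : ∀ s : {r : PCond κ d // r ≤ q}, ∃ r : {r : PCond κ d // r ≤ p}, R r s := fun s => by
    obtain ⟨r, hr, hRr⟩ := h'.le hR s.2
    exact ⟨⟨r, hr⟩, hRr⟩
  choose f hf using h1
  choose g hg using h2
  refine ⟨⟨⟨f, g, fun r => ?_, fun s => ?_⟩, fun {r s} => ⟨fun hrs => ?_, fun hrs => ?_⟩⟩⟩
  · exact Subtype.ext (h'.unique _ _ _ (hg (f r)) (hf r))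
  · exact Subtype.ext (h.unique _ _ _ (hf (g s)) (hg s))
  · obtain ⟨r', hr', h3⟩ := h'.le (hf s) (show (f r).1 ≤ (f s).1 from hrs)
    change r.1 ≤ s.1
    rw [h'.unique _ _ _ (hf r) h3]
    exact hr'
  · obtain ⟨r', hr', h3⟩ := h.le (hf s) (show r.1 ≤ s.1 from hrs)
    change (f r).1 ≤ (f s).1
    rw [h.unique _ _ _ (hf r) h3]
    exact hr'

end PCond

/-! ### Changing a block of positive length -/

section

variable {κ c₀ : Ordinal.{u}} {d d₀ : ZFSet.{u}} {P Q : StarData.{u}}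

theorem BlkRel.sameShape {A A' : Ordinal.{u} × Ordinal.{u} → List ESeq.{u} → Prop}
    {t : Ordinal.{u} → Ordinal.{u} × Ordinal.{u}} {b b' : Blk.{u}} (hM : Matched c₀ d₀ P Q)
    (h : BlkRel c₀ P Q A A' t b b') : b.SameShape b' where
  c_eq := h.c_eq
  stemZero_eq := h.stemZero_eq
  valid := h.valid hM
  full := by
    rintro c d s rfl
    cases h with
    | outside _ h => exact ⟨_, h⟩
    | full _ _ => exact ⟨_, rfl⟩

/-- The relation between the extensions of two conditions which differ in one block. -/
def CondRel (c₀ : Ordinal.{u}) (P Q : StarData.{u}) (p q : PCond κ d) : Prop :=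
  ∃ t, ListRel c₀ P Q p.1 q.1 t

theorem condRel_symm (hM : Matched c₀ d₀ P Q) {p q : PCond κ d} (h : CondRel c₀ P Q p q) :
    CondRel c₀ Q P q p := h.imp fun _ h => h.symm hM

theorem exists_condRel (hM : Matched c₀ d₀ P Q) {r : PCond κ d} {L L' : List Blk.{u}}
    {t : Ordinal.{u} → Ordinal.{u} × Ordinal.{u}} (h : ListRel c₀ P Q L L' t)
    (hr : List.Forall₂ Blk.LeStar r.1 L) :
    ∃ r' : PCond κ d, List.Forall₂ Blk.LeStar r'.1 L' ∧ CondRel c₀ P Q r r' := by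
  obtain ⟨K', h1, h2⟩ := h.exists_leStar hM r.2.2.1 hr
  obtain ⟨r', rfl⟩ := r.exists_of_sameShape (h2.rel.imp fun _ _ h => h.sameShape hM)
  exact ⟨r', h1, t, h2⟩

theorem simulation_condRel (hM : Matched c₀ d₀ P Q) :
    Simulation (CondRel (κ := κ) (d := d) c₀ P Q) where
  leStar := fun p q r ⟨t, h⟩ hr => exists_condRel hM h hr
  leOne := fun p q r ⟨t, h⟩ hr => by
    obtain ⟨L₀, L₁, c, e, s, ν, b₁, b₀, hp, ho, hle⟩ := hr
    have hpw := p.pairwise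
    have hv := p.2.2.1 (.full c e s) (by rw [hp]; simp)
    rw [hp] at h hpw
    obtain ⟨L₀', s', L₁', b₁', b₀', t', hq, ho', h'⟩ :=
      h.exists_isOnePoint hM hpw q.pairwise hv ho
    obtain ⟨r', h1, h2⟩ := exists_condRel hM h' hle
    exact ⟨r', ⟨L₀', L₁', c, e, s', ν, b₁', b₀', hq, ho', h1⟩, h2⟩
  unique := fun p q q' ⟨t, h⟩ ⟨t', h'⟩ => Subtype.ext (h.unique hM p.pairwise h')

theorem IsR.modf_self {R g h : ZFSet.{u}} (hR : IsR R) (hh : h ∈ R) : modf g h g = h := by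
  conv_rhs => rw [hR.eq_tup hh]
  rw [modf]
  congr 1
  funext i
  ext z
  simp

theorem Matched.starRel (hS : IsSystem c₀ d₀) (hM : Matched c₀ d₀ P Q) :
    StarRel c₀ P Q (fun γ => (c₀, γ)) c₀ d₀ P Q where
  sys := hS
  valid := hM.validP
  valid' := hM.validQ
  mc := hM.mc
  supp := hM.supp
  T := hM.T
  F := hM.F
  zero := hM.stem_zero
  perm := hM.perm
  inV := hM.inV
  proj_zero := fun ν hν _ => hM.proj_zero ν hν
  tracked := fun γ₀ h₀ hne γ hγ => by
    obtain rfl := congrArg Prod.snd hγ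
    exact ⟨h₀, hne, [], by simp, by simp⟩
  untracked := fun γ hγ => by
    by_cases h : γ ∈ P.supp
    · by_cases hc : γ = c₀
      · rw [hc, hM.stem_zero]
      · exact absurd rfl (hγ γ h hc)
    · rw [hM.validP.stem_off γ h, hM.validQ.stem_off γ (by rwa [hM.supp])]
  active := fun _ => by
    refine ⟨P.mc, hM.mc_mem, id, fun _ => rfl, rfl, rfl, hM.perm_mc, fun x hx h0 => ?_⟩
    have hR := isR_Rstem (P.stem c₀) x.c
    obtain ⟨hP, hQ⟩ := hM.f_mem hx h0
    rw [proj_self_eq hS hM.validP.mc_dom.1 hM.validP.mc_dom.2 (hM.validP.T_ext x hx).2]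
    exact ⟨hx, hR.rle_refl hP, (hR.modf_self hQ).symm⟩
  passive := fun h => absurd rfl h

/-- Initially only the exchanged block is concerned: higher blocks have larger critical points, and
lower ones lie at or below `κ⁰(p^0)`. -/
theorem not_between_of_append {L₀ L₁ : List Blk.{u}}
    (hL : (L₀ ++ Blk.full c₀ d₀ P :: L₁).Pairwise Blk.Below) {b : Blk.{u}}
    (hb : b ∈ L₀ ∨ b ∈ L₁) : ¬ Between c₀ (P.stem c₀) b.c := by
  rintro ⟨h1, h2⟩
  rw [List.pairwise_append, List.pairwise_cons] at hL
  rcases hb with hb | hb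
  · exact (hL.2.2 b hb _ List.mem_cons_self).1.not_ge h1
  · obtain ⟨-, x, hx, hle⟩ := hL.2.1.1 b hb
    change P.stem c₀ = [x] at hx
    exact (h2 x (by rw [hx]; exact List.mem_cons_self)).not_ge hle

theorem Matched.tracks (hi : Between c₀ (P.stem c₀) c₀) (hP : P.Valid c₀ d₀)
    (L₀ L₁ : List Blk.{u}) :
    Tracks c₀ P (fun γ => (c₀, γ))
      (StemAt (Between c₀ (P.stem c₀)) (L₀ ++ Blk.full c₀ d₀ P :: L₁)) := by
  intro γ₀ h₀ hne
  obtain ⟨h1, -⟩ := hP.stem_ne γ₀ h₀ hne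
  obtain ⟨y, w, h2⟩ := List.exists_cons_of_ne_nil h1
  exact ⟨y, w, h2, .here (w := w) ⟨hi, d₀, P, by simp, h₀, hne, h2⟩⟩

theorem Matched.listRel (hS : IsSystem c₀ d₀) (hM : Matched c₀ d₀ P Q) {L₀ L₁ : List Blk.{u}}
    (hL : (L₀ ++ Blk.full c₀ d₀ P :: L₁).Pairwise Blk.Below) :
    ListRel c₀ P Q (L₀ ++ Blk.full c₀ d₀ P :: L₁) (L₀ ++ Blk.full c₀ d₀ Q :: L₁)
      (fun γ => (c₀, γ)) := by
  have hi : Between c₀ (P.stem c₀) c₀ :=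
    ⟨le_rfl, fun x hx => c_lt_of_code (hM.validP.stem_mem hx).2⟩
  have hself : ∀ {A A' : Ordinal.{u} × Ordinal.{u} → List ESeq.{u} → Prop} (l : List Blk.{u}),
      (∀ b ∈ l, ¬ Between c₀ (P.stem c₀) b.c) →
      List.Forall₂ (BlkRel c₀ P Q A A' fun γ => (c₀, γ)) l l := fun l hl =>
    List.forall₂_same.2 fun b hb => .outside (hl b hb) rfl
  refine ⟨Matched.tracks hi hM.validP L₀ L₁, ?_, ?_,
    ⟨.full c₀ d₀ P, by simp, rfl⟩⟩
  · rw [← hM.stem_zero] at hi ⊢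
    exact Matched.tracks hi hM.validQ L₀ L₁
  · exact forall₂_append (hself _ fun b hb => not_between_of_append hL (Or.inl hb))
      (.cons (.full hi (hM.starRel hS)) (hself _ fun b hb => not_between_of_append hL (Or.inr hb)))

end

/-! ### Changing a block of length zero -/

/-- `b` and `b'` occur in corresponding extensions of conditions with the blocks given by `r₁` and
`r₂` on `c₀`. -/
inductive DegenRel (c₀ : Ordinal.{u}) (z : List ESeq.{u}) (r₁ r₂ : ZFSet.{u}) :
    Blk.{u} → Blk.{u} → Prop
  | other {b b' : Blk.{u}} (hb : b.c ≠ c₀) (h : b' = b) : DegenRel c₀ z r₁ r₂ b b'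
  | degen {r r' : ZFSet.{u}} (hr : rle r r₁) (hR : r ∈ Rstem z c₀) (h : r' = modf r₁ r₂ r) :
      DegenRel c₀ z r₁ r₂ (.degen c₀ z r) (.degen c₀ z r')

section

variable {κ c₀ : Ordinal.{u}} {d : ZFSet.{u}} {z : List ESeq.{u}} {r₁ r₂ : ZFSet.{u}}
  {b b' b'' : Blk.{u}}

theorem DegenRel.sameShape (hr₂ : r₂ ∈ Rstem z c₀) (hd : ∀ i, SameDom (crd r₁ i) (crd r₂ i))
    (h : DegenRel c₀ z r₁ r₂ b b') : b.SameShape b' := by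
  cases h with
  | other _ h => subst h; exact ⟨rfl, rfl, id, fun c d s h => ⟨s, h⟩⟩
  | degen hr hR h =>
    refine ⟨rfl, rfl, fun hv => ⟨hv.1, hv.2.1, ?_⟩, fun c d s h => by cases h⟩
    rw [h]
    exact (isR_Rstem _ _).modf_mem hR hr₂ hr hd

theorem DegenRel.symm (hr₂ : r₂ ∈ Rstem z c₀) (hd : ∀ i, SameDom (crd r₁ i) (crd r₂ i))
    (h : DegenRel c₀ z r₁ r₂ b b') : DegenRel c₀ z r₂ r₁ b' b := by
  cases h with
  | other hb h => subst h; exact .other hb rfl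
  | degen hr hR h =>
    have h3 := isR_Rstem z c₀
    refine .degen ?_ ?_ ?_
    · rw [h]; exact h3.modf_rle hr₂
    · rw [h]; exact h3.modf_mem hR hr₂ hr hd
    · rw [h, h3.modf_modf hR hr₂ hr hd]

theorem DegenRel.unique (h : DegenRel c₀ z r₁ r₂ b b') (h' : DegenRel c₀ z r₁ r₂ b b'') :
    b' = b'' := by
  cases h with
  | other hb h =>
    cases h' with
    | other _ h' => rw [h, h']
    | degen => exact absurd rfl hb
  | degen _ _ h =>
    cases h' with
    | other hb _ => exact absurd rfl hb
    | degen _ _ h' => rw [h, h']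

theorem DegenRel.exists_leStar (h : DegenRel c₀ z r₁ r₂ b b') {a : Blk.{u}} (ha : a.Valid)
    (hle : a.LeStar b) : ∃ a', a'.LeStar b' ∧ DegenRel c₀ z r₁ r₂ a a' := by
  cases h with
  | other hb h =>
    subst h
    refine ⟨a, hle, .other ?_ rfl⟩
    cases a <;> cases b' <;> simp only [Blk.LeStar] at hle
    · rwa [Blk.c, hle.1]
    · rwa [Blk.c, hle.1]
  | degen hr hR h =>
    cases a <;> simp only [Blk.LeStar] at hle
    obtain ⟨rfl, rfl, hle⟩ := hle
    subst h
    exact ⟨_, leStar_degen (modf_mono hle), .degen (hle.trans hr) ha.2.2 rfl⟩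

/-- The relation between the extensions of two conditions which differ in one block of length
zero. -/
def CondDegenRel (c₀ : Ordinal.{u}) (z : List ESeq.{u}) (r₁ r₂ : ZFSet.{u}) (p q : PCond κ d) :
    Prop :=
  List.Forall₂ (DegenRel c₀ z r₁ r₂) p.1 q.1 ∧ ∃ b ∈ p.1, b.c = c₀

theorem condDegenRel_symm (hr₂ : r₂ ∈ Rstem z c₀) (hd : ∀ i, SameDom (crd r₁ i) (crd r₂ i))
    {p q : PCond κ d} (h : CondDegenRel c₀ z r₁ r₂ p q) : CondDegenRel c₀ z r₂ r₁ q p := by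
  refine ⟨(h.1.imp fun _ _ h => h.symm hr₂ hd).flip, ?_⟩
  obtain ⟨b, hb, hc⟩ := h.2
  obtain ⟨b', hb', h'⟩ := forall₂_exists_left h.1.flip hb
  exact ⟨b', hb', (DegenRel.sameShape hr₂ hd h').c_eq.trans hc⟩

theorem exists_condDegenRel (hr₂ : r₂ ∈ Rstem z c₀) (hd : ∀ i, SameDom (crd r₁ i) (crd r₂ i))
    {r : PCond κ d} {L L' : List Blk.{u}} (h : List.Forall₂ (DegenRel c₀ z r₁ r₂) L L')
    (hb : ∃ b ∈ L, b.c = c₀) (hr : List.Forall₂ Blk.LeStar r.1 L) :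
    ∃ r' : PCond κ d, List.Forall₂ Blk.LeStar r'.1 L' ∧ CondDegenRel c₀ z r₁ r₂ r r' := by
  have key : ∀ {l l' k : List Blk.{u}}, List.Forall₂ (DegenRel c₀ z r₁ r₂) l l' →
      List.Forall₂ Blk.LeStar k l → (∀ b ∈ k, b.Valid) →
      ∃ k', List.Forall₂ Blk.LeStar k' l' ∧ List.Forall₂ (DegenRel c₀ z r₁ r₂) k k' := by
    intro l l' k h1 h2 hk
    induction h1 generalizing k with
    | nil => cases h2; exact ⟨[], .nil, .nil⟩
    | cons hb _ ih =>
      cases h2 with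
      | cons ha hl =>
        obtain ⟨a', h3, h4⟩ := hb.exists_leStar (hk _ List.mem_cons_self) ha
        obtain ⟨k', h5, h6⟩ := ih hl fun b hb => hk b (List.mem_cons_of_mem _ hb)
        exact ⟨a' :: k', .cons h3 h5, .cons h4 h6⟩
  obtain ⟨K', h1, h2⟩ := key h hr r.2.2.1
  obtain ⟨r', rfl⟩ := r.exists_of_sameShape (h2.imp fun _ _ h => h.sameShape hr₂ hd)
  refine ⟨r', h1, h2, ?_⟩
  obtain ⟨b, hb, hc⟩ := hb
  obtain ⟨a, ha, h3⟩ := forall₂_exists_left hr hb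
  refine ⟨a, ha, ?_⟩
  cases a <;> cases b <;> simp only [Blk.LeStar] at h3
  · exact h3.1.trans hc
  · exact h3.1.trans hc

theorem simulation_condDegenRel (hr₂ : r₂ ∈ Rstem z c₀)
    (hd : ∀ i, SameDom (crd r₁ i) (crd r₂ i)) :
    Simulation (CondDegenRel (κ := κ) (d := d) c₀ z r₁ r₂) where
  leStar := fun p q r h hr => exists_condDegenRel hr₂ hd h.1 h.2 hr
  leOne := fun p q r h hr => by
    obtain ⟨L₀, L₁, c, e, s, ν, b₁, b₀, hp, ho, hle⟩ := hr
    obtain ⟨h, hbase⟩ := h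
    have hpw := p.pairwise
    have hv := p.2.2.1 (.full c e s) (by rw [hp]; simp)
    rw [hp] at h hpw hbase
    obtain ⟨L₀', b, L₁', hq, h0, hb, h1⟩ := forall₂_split h
    -- The block that is split has positive length, so it is not the exchanged one and has itself as
    -- partner.
    have hb' : b = .full c e s ∧ c ≠ c₀ := by
      cases hb with
      | other hb h => exact ⟨h, hb⟩
    obtain ⟨rfl, hc⟩ := hb'
    obtain ⟨hν, -, hν0, -, -, rfl, ho1, ho2⟩ := isOnePoint_iff.1 ho
    have hb₁c : b₁.c = ν.c := by
      rcases eq_or_ne (len ν.d) 0 with h0 | h0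
      · rw [ho2 h0]; rfl
      · obtain ⟨p₁, rfl, -⟩ := ho1 (pos_iff_ne_zero.2 h0); rfl
    obtain ⟨b, hb, hbc⟩ := hbase
    have hνc₀ : ν.c ≠ c₀ := by
      rw [← hbc]
      exact (c_ne_of_permitted hpw (c_lt_of_code (hv.2.T_ext ν hν).2) hν0 hb).symm
    have hbase' : ∃ b ∈ L₀ ++ Blk.full c e (s.upper c e ν) :: b₁ :: L₁, b.c = c₀ := by
      refine ⟨b, mem_split ?_, hbc⟩
      rcases List.mem_append.1 hb with hb | hb
      · exact Or.inl hb
      · rcases List.mem_cons.1 hb with rfl | hb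
        · exact absurd hbc hc
        · exact Or.inr hb
    obtain ⟨r', h2, h3⟩ := exists_condDegenRel hr₂ hd (forall₂_append h0
      (.cons (.other (b := Blk.full c e (s.upper c e ν)) hc rfl)
        (.cons (.other (b := b₁) (by rwa [hb₁c]) rfl) h1))) hbase' hle
    exact ⟨r', ⟨L₀', L₁', c, e, s, ν, b₁, _, hq, ho, h2⟩, h3⟩
  unique := fun p q q' h h' => by
    have key : ∀ {l l₁ l₂ : List Blk.{u}}, List.Forall₂ (DegenRel c₀ z r₁ r₂) l l₁ →
        List.Forall₂ (DegenRel c₀ z r₁ r₂) l l₂ → l₁ = l₂ := by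
      intro l l₁ l₂ h1 h2
      induction h1 generalizing l₂ with
      | nil => cases h2; rfl
      | cons hb _ ih =>
        cases h2 with
        | cons hb' hl => rw [hb.unique hb', ih hl]
    exact Subtype.ext (key h.1 h'.1)

end

/-! ### Changing all the blocks -/

/-- Replacing `b` by `b'` in a condition does not change the isomorphism type of the cone. -/
def Blk.Exchange (b b' : Blk.{u}) : Prop :=
  (∃ c d P Q, b = .full c d P ∧ b' = .full c d Q ∧ IsSystem c d ∧ Matched c d P Q) ∨
    ∃ c z r₁ r₂, b = .degen c z r₁ ∧ b' = .degen c z r₂ ∧ r₁ ∈ Rstem z c ∧ r₂ ∈ Rstem z c ∧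
      ∀ i, SameDom (crd r₁ i) (crd r₂ i)

theorem Blk.Exchange.sameShape {b b' : Blk.{u}} (h : b.Exchange b') : b.SameShape b' := by
  rcases h with ⟨c, d, P, Q, rfl, rfl, hS, hM⟩ | ⟨c, z, r₁, r₂, rfl, rfl, hr₁, hr₂, hd⟩
  · exact ⟨rfl, hM.stem_zero, fun _ => ⟨hS, hM.validQ⟩, fun _ _ _ h => by
      injection h with h1 h2; exact ⟨Q, by rw [h1, h2]⟩⟩
  · exact ⟨rfl, rfl, fun h => ⟨h.1, h.2.1, hr₂⟩, fun c d s h => by cases h⟩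

section

variable {κ : Ordinal.{u}} {d : ZFSet.{u}}

theorem sameShape_refl (b : Blk.{u}) : b.SameShape b := ⟨rfl, rfl, id, fun _ _ s h => ⟨s, h⟩⟩

theorem Blk.Exchange.exists_iso {b b' : Blk.{u}} (h : b.Exchange b') {L₀ L₁ : List Blk.{u}}
    {p : PCond κ d} (hp : p.1 = L₀ ++ b :: L₁) : ∃ q : PCond κ d, q.1 = L₀ ++ b' :: L₁ ∧
      Nonempty ({r : PCond κ d // r ≤ p} ≃o {r : PCond κ d // r ≤ q}) := by
  obtain ⟨q, hq⟩ := p.exists_of_sameShape (L := L₀ ++ b' :: L₁) (by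
    rw [hp]
    exact forall₂_append (List.forall₂_same.2 fun b _ => sameShape_refl b)
      (.cons h.sameShape (List.forall₂_same.2 fun b _ => sameShape_refl b)))
  refine ⟨q, hq, ?_⟩
  have hpw := p.pairwise
  rw [hp] at hpw
  rcases h with ⟨c, e, P, Q, rfl, rfl, hS, hM⟩ | ⟨c, z, r₁, r₂, rfl, rfl, hr₁, hr₂, hd⟩
  · refine (simulation_condRel hM).nonempty_iso ?_ (p := p) (q := q) ⟨fun γ => (c, γ), ?_⟩
    · have : flip (CondRel (κ := κ) (d := d) c P Q) = CondRel c Q P := by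
        funext a b
        exact propext ⟨condRel_symm hM, condRel_symm hM.symm⟩
      rw [this]
      exact simulation_condRel hM.symm
    · rw [hp, hq]
      exact hM.listRel hS hpw
  · have hd' : ∀ i, SameDom (crd r₂ i) (crd r₁ i) := fun i => (hd i).symm
    refine (simulation_condDegenRel hr₂ hd).nonempty_iso ?_ (p := p) (q := q) ⟨?_, ?_⟩
    · have : flip (CondDegenRel (κ := κ) (d := d) c z r₁ r₂) = CondDegenRel c z r₂ r₁ := by
        funext a b
        exact propext ⟨condDegenRel_symm hr₂ hd, condDegenRel_symm hr₁ hd'⟩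
      rw [this]
      exact simulation_condDegenRel hr₁ hd'
    · have hne : ∀ a, a ∈ L₀ ∨ a ∈ L₁ → a.c ≠ c := by
        intro a ha
        rw [List.pairwise_append, List.pairwise_cons] at hpw
        rcases ha with ha | ha
        · exact (hpw.2.2 a ha _ List.mem_cons_self).1.ne'
        · exact (hpw.2.1.1 a ha).1.ne
      rw [hp, hq]
      have hR := isR_Rstem z c
      exact forall₂_append (List.forall₂_same.2 fun a ha => .other (hne a (Or.inl ha)) rfl)
        (.cons (.degen (hR.rle_refl hr₁) hr₁ (hR.modf_self hr₂).symm)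
          (List.forall₂_same.2 fun a ha => .other (hne a (Or.inr ha)) rfl))
    · rw [hp]
      exact ⟨.degen c z r₁, by simp, rfl⟩

/-- Blocks are exchanged one at a time, `L₀` holding those already passed, and the isomorphisms are
composed. -/
theorem exists_iso_of_exchange {L L' : List Blk.{u}} (h : List.Forall₂ Blk.Exchange L L')
    (L₀ : List Blk.{u}) {p : PCond κ d} (hp : p.1 = L₀ ++ L) :
    ∃ q : PCond κ d, q.1 = L₀ ++ L' ∧
      Nonempty ({r : PCond κ d // r ≤ p} ≃o {r : PCond κ d // r ≤ q}) := by
  induction h generalizing L₀ p with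
  | nil => exact ⟨p, hp, ⟨OrderIso.refl _⟩⟩
  | @cons b b' L L' hb _ ih =>
    obtain ⟨q, hq, ⟨f⟩⟩ := hb.exists_iso hp
    obtain ⟨q', hq', ⟨g⟩⟩ := ih (L₀ ++ [b']) (p := q) (by rw [hq, List.append_assoc]; rfl)
    exact ⟨q', by rw [hq', List.append_assoc]; rfl, ⟨f.trans g⟩⟩

theorem exists_exchange {b b' : Blk.{u}} (hb : b.Valid) (hb' : b'.Valid)
    (h : (phiBlk b).Sim (phiBlk b')) : ∃ B B' : Blk.{u}, B.LeStar b ∧ B'.LeStar b' ∧ B.Valid ∧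
      b.SameShape B ∧ B.Exchange B' := by
  cases b with
  | full c d p =>
    cases b' with
    | full c' d' q =>
      obtain ⟨rfl, rfl, h1, h2, h3⟩ := h
      simp only [phiStar, if_true] at h1
      obtain ⟨P, Q, hP, hQ, hM⟩ := exists_matched hb.1 hb.2 hb'.2 h2.symm h3.symm h1.symm
      refine ⟨.full c d P, .full c d Q, ⟨rfl, rfl, hP⟩, ⟨rfl, rfl, hQ⟩, ⟨hb.1, hM.validP⟩,
        ⟨rfl, hP.stem_eq c hb.2.zero_mem, fun _ => ⟨hb.1, hM.validP⟩, fun _ _ _ h => ?_⟩,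
        Or.inl ⟨c, d, P, Q, rfl, rfl, hb.1, hM⟩⟩
      injection h with h1 h2
      exact ⟨P, by rw [h1, h2]⟩
    | degen c' s' r' => exact h.elim
  | degen c z r =>
    cases b' with
    | full c' d' q => exact h.elim
    | degen c' z' r' =>
      obtain ⟨rfl, rfl⟩ := h
      obtain ⟨r₁, hr₁, r₂, hr₂, h1, h2, h3, -⟩ :=
        (isR_Rstem z c).exists_sameDom hb.2.2 hb'.2.2
      exact ⟨.degen c z r₁, .degen c z r₂, leStar_degen h1, leStar_degen h2,
        ⟨hb.1, hb.2.1, hr₁⟩, ⟨rfl, rfl, fun h => ⟨h.1, h.2.1, hr₁⟩, fun c d s h => by cases h⟩,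
        Or.inr ⟨c, z, r₁, r₂, rfl, rfl, hr₁, hr₂, h3⟩⟩

theorem exists_exchange_list {L L' : List Blk.{u}} (hL : ∀ b ∈ L, b.Valid)
    (hL' : ∀ b ∈ L', b.Valid) (h : List.Forall₂ (fun b b' => (phiBlk b).Sim (phiBlk b')) L L') :
    ∃ K K' : List Blk.{u}, List.Forall₂ Blk.LeStar K L ∧ List.Forall₂ Blk.LeStar K' L' ∧
      List.Forall₂ Blk.SameShape L K ∧ List.Forall₂ Blk.Exchange K K' := by
  induction h with
  | nil => exact ⟨[], [], .nil, .nil, .nil, .nil⟩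
  | cons hb _ ih =>
    obtain ⟨B, B', h1, h2, -, h3, h4⟩ :=
      exists_exchange (hL _ List.mem_cons_self) (hL' _ List.mem_cons_self) hb
    obtain ⟨K, K', h5, h6, h7, h8⟩ := ih (fun b hb => hL b (List.mem_cons_of_mem _ hb))
      fun b hb => hL' b (List.mem_cons_of_mem _ hb)
    exact ⟨B :: K, B' :: K', .cons h1 h5, .cons h2 h6, .cons h3 h7, .cons h4 h8⟩

end

end ExtRadin

theorem theorem3p40 (κ : Ordinal.{u}) (d : ZFSet.{u}) (_hE : ExtRadin.IsSystem κ d)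
    (p q : ExtRadin.PCond κ d) (_hpq : ExtRadin.Phi p = ExtRadin.Phi q) :
    ∃ p' q' : ExtRadin.PCond κ d, p'.LeStar p ∧ q'.LeStar q ∧
      Nonempty ({r : ExtRadin.PCond κ d // r ≤ p'} ≃o {r : ExtRadin.PCond κ d // r ≤ q'}) := by
  have h : List.Forall₂ ExtRadin.QBlk.Sim (p.1.map ExtRadin.phiBlk) (q.1.map ExtRadin.phiBlk) :=
    Quotient.exact _hpq
  rw [List.forall₂_map_left_iff, List.forall₂_map_right_iff] at h
  obtain ⟨K, K', h1, h2, h3, h4⟩ := ExtRadin.exists_exchange_list p.2.2.1 q.2.2.1 h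
  obtain ⟨p', rfl⟩ := p.exists_of_sameShape h3
  obtain ⟨q', rfl, h5⟩ := ExtRadin.exists_iso_of_exchange h4 [] (p := p') rfl
  exact ⟨p', q', h1, h2, h5⟩
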